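/- **Setting.** Let $\mathcal X\subset\mathbb R^d$ be compact and non-empty, let $\Theta\subset(0,\infty)^m$ be a compact non-empty set of lengthscale vectors, and let $(k_\theta)_{\theta\in\Theta}$ be the Matérn kernels of a fixed smoothness $\nu>0$ and a fixed output variance $\sigma_f^2\in(0,1]$ on $\mathcal X$, where each coordinate of $\mathbb R^d$ is divided by one of the $m$ lengthscales (isotropic: $m=1$; ARD: $m=d$). Assume $f\in\mathcal H_{k_\theta}$ with $\|f\|_{k_\theta}\le B$ for the true $\theta\in\Theta$ and, more precisely, $\sup_{\hat\theta\in\Theta}\|f\|_{k_{\hat\theta}}\le B$, $B>0$; let $x^\ast\in\arg\max_{\mathcal X}f$. Observations are $y_t=f(x_t)+\epsilon_t$ with $\mathbb E[e^{s\epsilon_t}\mid\mathcal F_{t-1}]\le e^{s^2R^2/2}$ for all $s\in\mathbb R$, where $\mathcal F_{t-1}$ is the history up to and including the choice of $x_t$. The GP surrogate has zero mean and noise variance $\sigma^2$ with $1\le\sigma\le\sigma_{\max}$ (for instance $\sigma^2=1+2/T$), and $\mu_{t-1}(\cdot;\hat\theta)$, $\sigma_{t-1}^2(\cdot;\hat\theta)$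 are its posterior mean and variance given $(x_i,y_i)_{i<t}$ under $k_{\hat\theta}$. Let $\gamma_t(\hat\theta)=\max_{x_1,\dots,x_t\in\mathcal X}\frac12\log\det(I+\sigma^{-2}[k_{\hat\theta}(x_i,x_j)]_{i,j})$, $\Gamma_{t}=\max_{\hat\theta\in\Theta}\gamma_{t}(\hat\theta)$, let $N_\varepsilon(\Theta,d)$ be the $\varepsilon$-covering number of $\Theta$ for $d(\theta,\theta')=\sup_{x,x'\in\mathcal X}|k_\theta(x,x')-k_{\theta'}(x,x')|$, and put $\varepsilon_T=T^{-4}$, $$\beta_t^{1/2}(\delta)=B+R\sqrt{2\Bigl(\Gamma_{t-1}+1+\log\frac{6N_{\varepsilon_T}(\Theta,d)}{\delta}\Bigr)} .$$ **Algorithm (OSCBO with UCB, horizon $T$).** Let $p\in\{1,2\}$, $\hat\rho>0$, $\tilde\rho=\max\{\hat\rho/2,T^{-1/4}\}$, $\eta=\delta/3$, $L^s_t(\hat\theta)=\frac{\log(1+\sigma^{-2}\sigma^2_{t-1}(x_t;\hat\theta))}{\log(1+\sigma^{-2})}$, $L^c_t(\hat\theta)=\Bigl(\frac{|y_t-\mu_{t-1}(x_t;\hat\theta)|}{\beta_t^{1/2}(\delta)\sqrt{\sigma_{t-1}^2(x_t;\hat\theta)+\sigma^2}}\Bigr)^p-1$.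 In round $t=1,\dots,T$: if $\sum_{j<t}L^c_j(\hat\theta_{j-1})>(T-t)\tilde\rho+M_t-1$ with $M_t=\frac2{\tilde\rho}\sqrt T+(2+\frac3{\tilde\rho})\sqrt{8t\log(18t^2/\eta)}+(1+\frac2{\tilde\rho})R^P+\frac1{\tilde\rho}R^D$ ($R^P,R^D\ge0$ given), both learners are re-initialized and the recovery phase begins (re-initialization either at every such round or only at the first). The primal learner (follow the perturbed leader with fresh i.i.d. exponential perturbations $\xi_{t-1}$) outputs a minimizer $\hat\theta_{t-1}$, up to an error $g+h\|\xi_{t-1}\|_1$, of $\hat\theta\mapsto\sum_j\bigl(v_jL_j^s(\hat\theta)+\lambda_{j-1}L_j^c(\hat\theta)\bigr)-\langle\hat\theta,\xi_{t-1}\rangle$ over $\Theta$ or over an $\varepsilon_T$-cover of $\Theta$, the sum being over the rounds $j<t$ since the last initialization, with $v_j=1$ in the play phase and $v_j$ a fixed number in $[0,1]$ in recovery. The dual learner (online mirror descent with negative entropy, initialized at a positive value, positive step sizes, gradient $-L_t^c(\hat\theta_{t-1})$) updates $\lambda$ in $[0,1/\tilde\rho]$ in the play phase and in $[0,1]$ in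 recovery. Then $x_t\in\arg\max_{x\in\mathcal X}\mu_{t-1}(x;\hat\theta_{t-1})+\beta_t^{1/2}(\delta)\sigma_{t-1}(x;\hat\theta_{t-1})$ is queried. **Theorem.** There are a constant $C>0$ and an integer $q\ge0$, depending only on $\mathcal X$, $\Theta$, the kernel family, $R$ and $\sigma_{\max}$, such that for all $T\ge1$, $\delta\in(0,1)$, $B>0$, $f$, $\theta$ as above, every choice of the tuning parameters and every run of OSCBO, with probability at least $1-\delta$, $$R_T=\sum_{t=1}^T\bigl(f(x^\ast)-f(x_t)\bigr)\le C(1+\log T)^q\Bigl(B+\sqrt{\Gamma_{T-1}+\log\tfrac{6N_{\varepsilon_T}(\Theta,d)}{\delta}}\Bigr)\Bigl(T^{3/4}+\sqrt{T\gamma_T(\theta)}\Bigr).$$ Moreover, if $\nu>d/2$, this bound is sublinear: for fixed $B,\delta,\theta$ and any $\sigma=\sigma_T\in[1,\sigma_{\max}]$, its right-hand side divided by $T$ tends to $0$ as $T\to\infty$. -/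

import Mathlib

open MeasureTheory ProbabilityTheory Filter Topology

noncomputable section

namespace OSCBO

/-! ### The Matérn kernel family -/

/-- Modified Bessel function of the second kind, for real order `ν` and real argument `z > 0`,
through the integral `K_ν(z) = (1/2) (z/2)^(-ν) ∫_0^∞ exp(-u - z²/(4u)) u^(ν-1) du`. -/
def besselK (ν z : ℝ) : ℝ :=
  (1 / 2) * (z / 2) ^ (-ν) *
    ∫ u in Set.Ioi (0 : ℝ), Real.exp (-u - z ^ 2 / (4 * u)) * u ^ (ν - 1)

/-- Distance after dividing the coordinate `i` by its lengthscale `θ (grp i)`. -/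
def scaledDist {d m : ℕ} (grp : Fin d → Fin m) (θ : Fin m → ℝ)
    (x x' : EuclideanSpace ℝ (Fin d)) : ℝ :=
  √(∑ i, ((x i - x' i) / θ (grp i)) ^ 2)

open Classical in
/-- Matérn kernel of smoothness `ν` and output variance `var`, with its limit `var` at
distance zero. -/
def matern {d m : ℕ} (ν var : ℝ) (grp : Fin d → Fin m) (θ : Fin m → ℝ)
    (x x' : EuclideanSpace ℝ (Fin d)) : ℝ :=
  if scaledDist grp θ x x' = 0 then var
  else var * (2 ^ (1 - ν) / Real.Gamma ν * (√(2 * ν) * scaledDist grp θ x x') ^ ν *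
    besselK ν (√(2 * ν) * scaledDist grp θ x x'))

/-- The fixed data: a compact input space `X ⊆ ℝ^d`, a compact set `Θ ⊆ (0, ∞)^m` of
lengthscale vectors, and a Matérn family indexed by `Θ` with output variance at most one.
The coordinate `i` uses the lengthscale number `grp i`: `m = 1` is the isotropic case, and
`m = d`, `grp = id` is automatic relevance determination. -/
structure Problem (d m : ℕ) where
  ν : ℝ
  var : ℝ
  grp : Fin d → Fin m
  X : Set (EuclideanSpace ℝ (Fin d))
  Θ : Set (Fin m → ℝ)
  ν_pos : 0 < ν
  var_pos : 0 < var
  var_le_one : var ≤ 1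
  X_compact : IsCompact X
  X_nonempty : X.Nonempty
  Θ_compact : IsCompact Θ
  Θ_nonempty : Θ.Nonempty
  Θ_pos : ∀ θ ∈ Θ, ∀ i, 0 < θ i

/-- The kernel `k_θ` of the family. -/
def Problem.ker {d m : ℕ} (P : Problem d m) (θ : Fin m → ℝ) :
    EuclideanSpace ℝ (Fin d) → EuclideanSpace ℝ (Fin d) → ℝ :=
  matern P.ν P.var P.grp θ

/-- `f`, restricted to `X`, lies in the reproducing kernel Hilbert space of the kernel `k` on `X`
and has norm at most `B` there. -/
def InRKHSBall {E : Type} (X : Set E) (k : E → E → ℝ) (B : ℝ) (f : E → ℝ) : Prop :=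
  ∃ (H : Type) (_ : NormedAddCommGroup H) (_ : InnerProductSpace ℝ H) (_ : CompleteSpace H)
    (_ : RKHS ℝ H X ℝ),
    (∀ x x' : X, RKHS.kernel H x x' 1 = k x x') ∧
    ∃ h : H, (∀ x : X, h x = f x) ∧ ‖h‖ ≤ B

/-! ### Gaussian process posterior and information gain -/

section GP

variable {E : Type} {n : ℕ}

def gram (k : E → E → ℝ) (x : Fin n → E) : Matrix (Fin n) (Fin n) ℝ :=
  Matrix.of fun i j => k (x i) (x j)

def kvec (k : E → E → ℝ) (x : Fin n → E) (z : E) : Fin n → ℝ := fun i => k (x i) z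

/-- Posterior mean at `z` given the data `(x i, y i)`, with noise variance `σ ^ 2`. -/
def postMean (k : E → E → ℝ) (σ : ℝ) (x : Fin n → E) (y : Fin n → ℝ) (z : E) : ℝ :=
  kvec k x z ⬝ᵥ ((gram k x + σ ^ 2 • (1 : Matrix (Fin n) (Fin n) ℝ))⁻¹).mulVec y

/-- Posterior variance at `z`. -/
def postVar (k : E → E → ℝ) (σ : ℝ) (x : Fin n → E) (z : E) : ℝ :=
  k z z - kvec k x z ⬝ᵥ
    ((gram k x + σ ^ 2 • (1 : Matrix (Fin n) (Fin n) ℝ))⁻¹).mulVec (kvec k x z)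

/-- Posterior standard deviation at `z`. -/
def postStd (k : E → E → ℝ) (σ : ℝ) (x : Fin n → E) (z : E) : ℝ := √(postVar k σ x z)

def infoGain (k : E → E → ℝ) (σ : ℝ) (x : Fin n → E) : ℝ :=
  (1 / 2) * Real.log (1 + (σ ^ 2)⁻¹ • gram k x).det

/-- Maximum information gain of `n` evaluations in `X`. -/
def maxInfoGain (k : E → E → ℝ) (σ : ℝ) (X : Set E) (n : ℕ) : ℝ :=
  ⨆ x : Fin n → X, infoGain k σ (fun i => (x i : E))

end GP

variable {d m : ℕ}

/-- `γ_n(θ)`. -/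
def Problem.gain (P : Problem d m) (σ : ℝ) (n : ℕ) (θ : Fin m → ℝ) : ℝ :=
  maxInfoGain (P.ker θ) σ P.X n

/-- `Γ_n`, the maximum of `γ_n` over `Θ`. -/
def Problem.supGain (P : Problem d m) (σ : ℝ) (n : ℕ) : ℝ :=
  ⨆ θ : P.Θ, P.gain σ n θ

/-- The distance `d(θ, θ') = sup_{x, x' ∈ X} |k_θ(x, x') - k_θ'(x, x')|`. -/
def Problem.kdist (P : Problem d m) (θ θ' : Fin m → ℝ) : ℝ :=
  ⨆ q : P.X × P.X, |P.ker θ q.1 q.2 - P.ker θ' q.1 q.2|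

/-- `A` is an `ε`-cover of `Θ` for the distance `d`, with centres in `Θ`. -/
def Problem.IsNet (P : Problem d m) (ε : ℝ) (A : Set (Fin m → ℝ)) : Prop :=
  A ⊆ P.Θ ∧ ∀ θ ∈ P.Θ, ∃ θ' ∈ A, P.kdist θ θ' ≤ ε

/-- The `ε`-covering number of `Θ` for the distance `d`. -/
def Problem.covNum (P : Problem d m) (ε : ℝ) : ℕ :=
  sInf {n : ℕ | ∃ s : Finset (Fin m → ℝ), P.IsNet ε ↑s ∧ s.card = n}

/-- The covering radius `ε_T = T^(-4)`. -/
def epsT (T : ℕ) : ℝ := ((T : ℝ) ^ 4)⁻¹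

/-! ### The algorithm -/

/-- Surrogate noise level `σ`, norm bound `B`, sub-Gaussian constant `R`, failure probability `δ`
and horizon `T`. -/
structure Config where
  σ : ℝ
  B : ℝ
  R : ℝ
  δ : ℝ
  T : ℕ

/-- `β_t^(1/2)(δ)` for `t = n + 1`. -/
def betaSqrt (P : Problem d m) (c : Config) (n : ℕ) : ℝ :=
  c.B + c.R * √(2 * (P.supGain c.σ n + 1 + Real.log (6 * P.covNum (epsT c.T) / c.δ)))

/-- Tuning inputs of the algorithm: the exponent `p` of the calibration constraint, the supplied
margin `ρhat`, the regret bounds `RP`, `RD` of the two regret minimizers that enter the switching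
threshold, the rate `τ` of the exponential perturbations, the accuracy `(g, h)` of the optimization
oracle, the step sizes and starting points of mirror descent, the weight of the sharpness loss in
the primal utility after the switch to recovery, and whether the regret minimizers restart at every
round at which the threshold is exceeded or only at the first one. -/
structure Tuning where
  p : ℕ
  ρhat : ℝ
  RP : ℝ
  RD : ℝ
  τ : ℝ
  g : ℝ
  h : ℝ
  step : ℕ → ℝ
  lamPlay : ℝ
  lamRec : ℝ
  recWeight : ℝ
  restart : Prop
  p_mem : p = 1 ∨ p = 2
  ρhat_pos : 0 < ρhat
  RP_nonneg : 0 ≤ RP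
  RD_nonneg : 0 ≤ RD
  τ_pos : 0 < τ
  g_nonneg : 0 ≤ g
  h_nonneg : 0 ≤ h
  step_pos : ∀ n, 0 < step n
  lamPlay_pos : 0 < lamPlay
  lamRec_pos : 0 < lamRec
  lamRec_le : lamRec ≤ 1
  recWeight_nonneg : 0 ≤ recWeight
  recWeight_le : recWeight ≤ 1

/-- `ρ̃ = max (ρhat / 2) T^(-1/4)`. -/
def rhoTilde (c : Config) (a : Tuning) : ℝ := max (a.ρhat / 2) ((c.T : ℝ) ^ (-(1 / 4) : ℝ))

/-- `E_{t,η} = √(8 t log(18 t² / η))` with `η = δ / 3`. -/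
def errTerm (c : Config) (t : ℕ) : ℝ := √(8 * t * Real.log (18 * (t : ℝ) ^ 2 / (c.δ / 3)))

/-- The violation budget `M_ρ̃` at round `t`. -/
def budget (c : Config) (a : Tuning) (t : ℕ) : ℝ :=
  2 / rhoTilde c a * √c.T + (2 + 3 / rhoTilde c a) * errTerm c t
    + (1 + 2 / rhoTilde c a) * a.RP + 1 / rhoTilde c a * a.RD

/-- One trajectory. Index `n` is the round `t = n + 1`: `x n = x_{n+1}` and `y n = y_{n+1}` are the
query and the observation of that round, `th n` and `lam n` the hyperparameter and the multiplier
used in it, so that the posterior of that round rests on `x 0, …, x (n - 1)`. -/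
structure Path (d m : ℕ) where
  x : ℕ → EuclideanSpace ℝ (Fin d)
  y : ℕ → ℝ
  th : ℕ → Fin m → ℝ
  lam : ℕ → ℝ

/-- The trajectory of the processes `x`, `y`, `th`, `lam` at `ω`. -/
def pathOf {Ω : Type*} (x : ℕ → Ω → EuclideanSpace ℝ (Fin d)) (y : ℕ → Ω → ℝ)
    (th : ℕ → Ω → Fin m → ℝ) (lam : ℕ → Ω → ℝ) (ω : Ω) : Path d m :=
  ⟨fun n => x n ω, fun n => y n ω, fun n => th n ω, fun n => lam n ω⟩

section Trajectory

variable (P : Problem d m) (c : Config) (a : Tuning) (w : Path d m)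

/-- Posterior mean before round `n + 1`. -/
def mean (n : ℕ) (θ : Fin m → ℝ) (z : EuclideanSpace ℝ (Fin d)) : ℝ :=
  postMean (P.ker θ) c.σ (fun i : Fin n => w.x i) (fun i : Fin n => w.y i) z

/-- Posterior variance before round `n + 1`. -/
def variance (n : ℕ) (θ : Fin m → ℝ) (z : EuclideanSpace ℝ (Fin d)) : ℝ :=
  postVar (P.ker θ) c.σ (fun i : Fin n => w.x i) z

/-- The upper confidence bound that is maximized in round `n + 1`. -/
def ucb (n : ℕ) (z : EuclideanSpace ℝ (Fin d)) : ℝ :=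
  mean P c w n (w.th n) z
    + betaSqrt P c n * postStd (P.ker (w.th n)) c.σ (fun i : Fin n => w.x i) z

/-- Sharpness loss of round `n + 1`. -/
def sharpLoss (n : ℕ) (θ : Fin m → ℝ) : ℝ :=
  1 / Real.log (1 + (c.σ ^ 2)⁻¹) * Real.log (1 + (c.σ ^ 2)⁻¹ * variance P c w n θ (w.x n))

/-- Calibration constraint of round `n + 1`. -/
def calLoss (n : ℕ) (θ : Fin m → ℝ) : ℝ :=
  |w.y n - mean P c w n θ (w.x n)| ^ a.p
    / (betaSqrt P c n * √(variance P c w n θ (w.x n) + c.σ ^ 2)) ^ a.p - 1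

/-- Cumulative violation before round `n + 1`. -/
def violation (n : ℕ) : ℝ := ∑ j ∈ Finset.range n, calLoss P c a w j (w.th j)

/-- The switching test of round `t = n + 1`: `V_t > (T - t) ρ̃ + M_ρ̃ - 1`. -/
def Exceeds (n : ℕ) : Prop :=
  ((c.T : ℝ) - (n + 1)) * rhoTilde c a + budget c a (n + 1) - 1 < violation P c a w n

/-- Round `n + 1` belongs to the recovery phase. -/
def InRecovery (n : ℕ) : Prop := ∃ j ≤ n, Exceeds P c a w j

/-- Both regret minimizers are initialized anew, for recovery, in round `n + 1`. -/
def Reinit (n : ℕ) : Prop := Exceeds P c a w n ∧ (a.restart ∨ ∀ j < n, ¬ Exceeds P c a w j)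

/-- Round at which the regret minimizers in use at index `n` were initialized. -/
def rmStart (n : ℕ) : ℕ := sSup {j | j ≤ n ∧ Reinit P c a w j}

open Classical in
/-- Weight of the sharpness loss. -/
def sharpWeight (n : ℕ) : ℝ := if InRecovery P c a w n then a.recWeight else 1

/-- Primal utility `L^s + λ L^c` of round `n + 1`. -/
def primalUtility (n : ℕ) (θ : Fin m → ℝ) : ℝ :=
  sharpWeight P c a w n * sharpLoss P c w n θ + w.lam n * calLoss P c a w n θ

/-- Dual utility `λ ↦ - L^s - λ L^c` of round `n + 1`. -/
def dualUtility (n : ℕ) (l : ℝ) : ℝ :=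
  -(sharpWeight P c a w n * sharpLoss P c w n (w.th n)) - l * calLoss P c a w n (w.th n)

/-- Objective of follow-the-perturbed-leader at index `n`, with perturbation `η`. -/
def ftplObjective (n : ℕ) (η θ : Fin m → ℝ) : ℝ :=
  ∑ j ∈ Finset.Ico (rmStart P c a w n) n, primalUtility P c a w j θ - ∑ i, θ i * η i

open Classical in
/-- Domain of the multiplier: `[0, 1/ρ̃]` in the play phase and `[0, 1]` in recovery. -/
def dualDomain (n : ℕ) : Set ℝ :=
  Set.Icc 0 (if InRecovery P c a w n then 1 else 1 / rhoTilde c a)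

/-- Bregman divergence of the negative entropy `λ log λ - λ`. -/
def bregman (l l' : ℝ) : ℝ := l * Real.log (l / l') - l + l'

/-- `w.lam (n + 1)` is the mirror-descent update of `w.lam n`. -/
def OMDStep (n : ℕ) : Prop :=
  w.lam (n + 1) ∈ dualDomain P c a w (n + 1) ∧
  IsMinOn (fun l => deriv (dualUtility P c a w n) (w.lam n) * l
      + 1 / a.step n * bregman l (w.lam n))
    (dualDomain P c a w (n + 1)) (w.lam (n + 1))

end Trajectory

/-- A run of OSCBO with UCB acquisition for `c.T` rounds on the objective `f`, on a probability
space `(Ω, μ)`. The σ-algebra `ℱ n` is the information available when `y n` is about to be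
observed: it contains the queries up to `x n`, the perturbations and decisions that led to them,
and the earlier noise. Follow-the-perturbed-leader minimizes over `act`, an `ε_T`-cover of `Θ` with
centres in `Θ`, finite or not; `act = Θ` is one. -/
structure Run {Ω : Type*} [mΩ : MeasurableSpace Ω] (μ : Measure Ω) (P : Problem d m) (c : Config)
    (a : Tuning) (f : EuclideanSpace ℝ (Fin d) → ℝ) where
  x : ℕ → Ω → EuclideanSpace ℝ (Fin d)
  y : ℕ → Ω → ℝ
  noise : ℕ → Ω → ℝ
  th : ℕ → Ω → Fin m → ℝ
  lam : ℕ → Ω → ℝ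
  pert : ℕ → Ω → Fin m → ℝ
  act : Set (Fin m → ℝ)
  ℱ : Filtration ℕ mΩ
  /- information structure -/
  x_meas : ∀ n < c.T, Measurable[ℱ n] (x n)
  th_meas : ∀ n < c.T, Measurable[ℱ n] (th n)
  lam_meas : ∀ n < c.T, Measurable[ℱ n] (lam n)
  pert_meas : ∀ n < c.T, Measurable[ℱ n] (pert n)
  noise_meas : ∀ n < c.T, Measurable[ℱ (n + 1)] (noise n)
  /- observations with conditionally `R`-sub-Gaussian noise -/
  obs : ∀ n < c.T, ∀ ω, y n ω = f (x n ω) + noise n ω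
  noise_integrable : ∀ n < c.T, ∀ s : ℝ, Integrable (fun ω => Real.exp (s * noise n ω)) μ
  noise_subG : ∀ n < c.T, ∀ s : ℝ,
    μ[fun ω => Real.exp (s * noise n ω) | ℱ n] ≤ᵐ[μ] fun _ => Real.exp (s ^ 2 * c.R ^ 2 / 2)
  /- fresh perturbations with independent exponential components -/
  pert_law : ∀ n < c.T, μ.map (pert n) = Measure.pi fun _ : Fin m => expMeasure a.τ
  pert_indep : ∀ n < c.T, Indep (MeasurableSpace.comap (pert n) inferInstance)
    (⨆ j ∈ Finset.range n, MeasurableSpace.comap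
      (fun ω => (x j ω, y j ω, th j ω, lam j ω, pert j ω)) inferInstance) μ
  /- primal regret minimizer -/
  act_net : P.IsNet (epsT c.T) act
  th_mem : ∀ n < c.T, ∀ ω, th n ω ∈ act
  ftpl : ∀ n < c.T, ∀ ω, ∀ θ ∈ act,
    ftplObjective P c a (pathOf x y th lam ω) n (pert n ω) (th n ω)
      ≤ ftplObjective P c a (pathOf x y th lam ω) n (pert n ω) θ + (a.g + a.h * ∑ i, |pert n ω i|)
  /- dual regret minimizer -/
  lamPlay_le : a.lamPlay ≤ 1 / rhoTilde c a
  lam_zero : ∀ ω, ¬ Reinit P c a (pathOf x y th lam ω) 0 → lam 0 ω = a.lamPlay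
  lam_reinit : ∀ n < c.T, ∀ ω, Reinit P c a (pathOf x y th lam ω) n → lam n ω = a.lamRec
  omd : ∀ n, n + 1 < c.T → ∀ ω, ¬ Reinit P c a (pathOf x y th lam ω) (n + 1) →
    OMDStep P c a (pathOf x y th lam ω) n
  /- acquisition -/
  x_mem : ∀ n < c.T, ∀ ω, x n ω ∈ P.X
  x_max : ∀ n < c.T, ∀ ω, IsMaxOn (ucb P c (pathOf x y th lam ω) n) P.X (x n ω)

/-- Cumulative regret of the run after `c.T` rounds, with respect to the point `xstar`. -/
def Run.regret {Ω : Type*} [MeasurableSpace Ω] {μ : Measure Ω} {P : Problem d m} {c : Config}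
    {a : Tuning} {f : EuclideanSpace ℝ (Fin d) → ℝ} (r : Run μ P c a f)
    (xstar : EuclideanSpace ℝ (Fin d)) (ω : Ω) : ℝ :=
  ∑ n ∈ Finset.range c.T, (f xstar - f (r.x n ω))

/-- `(B + √(Γ_{T-1} + log(6 N_{ε_T}(Θ, d) / δ))) (T^(3/4) + √(T γ_T(θ)))`. -/
def regretRate (P : Problem d m) (σ B δ : ℝ) (T : ℕ) (θ : Fin m → ℝ) : ℝ :=
  (B + √(P.supGain σ (T - 1) + Real.log (6 * P.covNum (epsT T) / δ)))
    * ((T : ℝ) ^ (3 / 4 : ℝ) + √(T * P.gain σ T θ))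

end OSCBO

end

/-! The regret of an optimistic rule is bounded by twice the sum of its confidence widths at the
queried points. Two facts keep this sum small although the kernel that defines the width is chosen
from the data.

First, the confidence bands hold for all of Θ at once. The noise part of a posterior mean is
controlled by the explained energy eᵀK(K + σ²I)⁻¹e of the noise vector e (`abs_postMean_le`). By the
method of mixtures, exp(explained energy / 2R² - information gain) is a nonnegative supermartingale,
so Ville's inequality controls it uniformly in time (`measure_explained_gt_le`). A union bound
covers a finite ε_T-net. Passing to a nearby kernel changes the Gram matrix by at most nε_T as a
quadratic form, which costs only O(T⁻² log(T/δ)) (`GoodNoise.explained_le`). The signal part is at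
most B posterior standard deviations, since f has norm at most B for every kernel of the family.
Hence every data-dependent choice of θ̂ in Θ is covered.

Second, the kernels with lengthscales in the compact set Θ are equivalent: k_θ̂ ≤ b k_θ as quadratic
forms (`matern_kernelLE`). Indeed a Matérn kernel is a Gamma mixture of Gaussians, and on the
Fourier side Gaussians are ordered by their width. A posterior variance is the minimum of a
regularized quadratic form, so it is monotone in the kernel (`postVar_le_of_kernelLE`). The
variances under the chosen θ̂ are thus summed by the information gain of the one fixed θ
(`sum_postVar_le`), and Cauchy–Schwarz yields √(T γ_T(θ)) without a logarithmic factor. The term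
T^(3/4) absorbs the discretization slack.

Sublinearity requires an information gain of order n^a with a < 1/2. The Matérn Gram matrix is a
Gram matrix of random plane waves, whose frequencies have tails of order Ω^(-2κ) for any κ < ν.
Waves below the cutoff Ω are, up to a small error, combinations of N^d monomials in the frequency.
The log-determinant is at most that of a low-rank matrix plus the trace of the remainder
(`infoGain_matern_le`), and balancing Ω gives an exponent below 1/2 when ν > d/2. -/

noncomputable section

namespace OSCBO

/-! ### Positive semidefinite kernels and the Gaussian process posterior -/

section PosteriorAlgebra

open Matrix

variable {E : Type} {n : ℕ} {k : E → E → ℝ} {σ : ℝ}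

/-- All Gram matrices of `k` are positive semidefinite. -/
def IsPSDKernel (k : E → E → ℝ) : Prop := ∀ (n : ℕ) (x : Fin n → E), (gram k x).PosSemidef

/-- The kernel order: `b k - a` is positive semidefinite, in terms of quadratic forms. -/
def KernelLE (a k : E → E → ℝ) (b : ℝ) : Prop :=
  ∀ (n : ℕ) (x : Fin n → E) (c : Fin n → ℝ),
    c ⬝ᵥ gram a x *ᵥ c ≤ b * (c ⬝ᵥ gram k x *ᵥ c)

/-- The matrix `K + σ² I`. -/
def noisyGram (k : E → E → ℝ) (σ : ℝ) (x : Fin n → E) : Matrix (Fin n) (Fin n) ℝ :=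
  gram k x + σ ^ 2 • (1 : Matrix (Fin n) (Fin n) ℝ)

/-- The part of `|v|²` explained by the posterior: `|v|² - σ² vᵀ (K + σ² I)⁻¹ v`. -/
def explained (k : E → E → ℝ) (σ : ℝ) (x : Fin n → E) (v : Fin n → ℝ) : ℝ :=
  v ⬝ᵥ v - σ ^ 2 * (v ⬝ᵥ (noisyGram k σ x)⁻¹ *ᵥ v)

lemma IsPSDKernel.symm (hk : IsPSDKernel k) (x y : E) : k x y = k y x := by
  have h := (hk 2 ![x, y]).1.apply 0 1
  simpa [gram] using h.symm

lemma IsPSDKernel.nonneg (hk : IsPSDKernel k) (x : Fin n → E) (c : Fin n → ℝ) :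
    0 ≤ c ⬝ᵥ gram k x *ᵥ c := by
  simpa using (hk n x).dotProduct_mulVec_nonneg c

lemma noisyGram_mulVec (x : Fin n → E) (v : Fin n → ℝ) :
    noisyGram k σ x *ᵥ v = gram k x *ᵥ v + σ ^ 2 • v := by
  simp [noisyGram, add_mulVec, smul_mulVec]

lemma noisyGram_posDef (hk : IsPSDKernel k) (hσ : 0 < σ) (x : Fin n → E) :
    (noisyGram k σ x).PosDef :=
  PosDef.posSemidef_add (hk n x) (PosDef.one.smul (by positivity))

lemma noisyGram_mul_inv (hk : IsPSDKernel k) (hσ : 0 < σ) (x : Fin n → E) (v : Fin n → ℝ) :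
    noisyGram k σ x *ᵥ ((noisyGram k σ x)⁻¹ *ᵥ v) = v := by
  have h : IsUnit (noisyGram k σ x).det :=
    (Matrix.isUnit_iff_isUnit_det _).1 (noisyGram_posDef hk hσ x).isUnit
  rw [mulVec_mulVec, mul_nonsing_inv _ h, one_mulVec]

lemma noisyGram_inv_mul (hk : IsPSDKernel k) (hσ : 0 < σ) (x : Fin n → E) (v : Fin n → ℝ) :
    (noisyGram k σ x)⁻¹ *ᵥ (noisyGram k σ x *ᵥ v) = v := by
  have h : IsUnit (noisyGram k σ x).det :=
    (Matrix.isUnit_iff_isUnit_det _).1 (noisyGram_posDef hk hσ x).isUnit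
  rw [mulVec_mulVec, nonsing_inv_mul _ h, one_mulVec]

lemma dotProduct_mulVec_comm {M : Matrix (Fin n) (Fin n) ℝ} (hM : M.IsHermitian)
    (v w : Fin n → ℝ) : v ⬝ᵥ M *ᵥ w = w ⬝ᵥ M *ᵥ v := by
  have hT : Mᵀ = M := by simpa using hM.eq
  rw [dotProduct_mulVec, ← mulVec_transpose, hT, dotProduct_comm]

lemma noisyGram_inv_comm (hk : IsPSDKernel k) (hσ : 0 < σ) (x : Fin n → E) (v w : Fin n → ℝ) :
    v ⬝ᵥ (noisyGram k σ x)⁻¹ *ᵥ w = w ⬝ᵥ (noisyGram k σ x)⁻¹ *ᵥ v :=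
  dotProduct_mulVec_comm (noisyGram_posDef hk hσ x).inv.1 v w

lemma noisyGram_quad (x : Fin n → E) (v : Fin n → ℝ) :
    v ⬝ᵥ noisyGram k σ x *ᵥ v = v ⬝ᵥ gram k x *ᵥ v + σ ^ 2 * (v ⬝ᵥ v) := by
  rw [noisyGram_mulVec, dotProduct_add, dotProduct_smul, smul_eq_mul]

/-- The posterior variance minimizes the regularized residual. -/
lemma postVar_le (hk : IsPSDKernel k) (hσ : 0 < σ) (x : Fin n → E) (z : E) (α : Fin n → ℝ) :
    postVar k σ x z ≤ k z z - 2 * (α ⬝ᵥ kvec k x z) + α ⬝ᵥ gram k x *ᵥ α + σ ^ 2 * (α ⬝ᵥ α) := by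
  set A := noisyGram k σ x with hA
  set b := kvec k x z
  -- Completing the square around the minimizer A⁻¹b, with A = K + σ²I.
  have h0 : 0 ≤ (α - A⁻¹ *ᵥ b) ⬝ᵥ A *ᵥ (α - A⁻¹ *ᵥ b) := by
    simpa using (noisyGram_posDef hk hσ x).posSemidef.dotProduct_mulVec_nonneg (α - A⁻¹ *ᵥ b)
  rw [mulVec_sub, noisyGram_mul_inv hk hσ, sub_dotProduct, dotProduct_sub, dotProduct_sub,
    noisyGram_quad, dotProduct_comm (A⁻¹ *ᵥ b) b,
    dotProduct_mulVec_comm (noisyGram_posDef hk hσ x).1, noisyGram_mul_inv hk hσ] at h0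
  change k z z - b ⬝ᵥ A⁻¹ *ᵥ b ≤ _
  linarith

/-- The optimal weights attain the posterior variance. -/
lemma postVar_eq (hk : IsPSDKernel k) (hσ : 0 < σ) (x : Fin n → E) (z : E) :
    postVar k σ x z = k z z - 2 * ((noisyGram k σ x)⁻¹ *ᵥ kvec k x z ⬝ᵥ kvec k x z)
      + (noisyGram k σ x)⁻¹ *ᵥ kvec k x z ⬝ᵥ gram k x *ᵥ ((noisyGram k σ x)⁻¹ *ᵥ kvec k x z)
      + σ ^ 2 * ((noisyGram k σ x)⁻¹ *ᵥ kvec k x z ⬝ᵥ (noisyGram k σ x)⁻¹ *ᵥ kvec k x z) := by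
  set A := noisyGram k σ x with hA
  set b := kvec k x z
  have h := noisyGram_quad (k := k) (σ := σ) x (A⁻¹ *ᵥ b)
  rw [noisyGram_mul_inv hk hσ] at h
  change k z z - b ⬝ᵥ A⁻¹ *ᵥ b = _
  rw [dotProduct_comm b]
  linarith

/-- Quadratic form of the Gram matrix at `(x, z)` and the weights `(-α, 1)`. -/
lemma gram_snoc_quad (hs : ∀ x y, k x y = k y x) (x : Fin n → E) (z : E) (α : Fin n → ℝ) (t : ℝ) :
    (Fin.snoc (-α) t : Fin (n + 1) → ℝ) ⬝ᵥ
        gram k (Fin.snoc x z : Fin (n + 1) → E) *ᵥ (Fin.snoc (-α) t : Fin (n + 1) → ℝ)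
      = t ^ 2 * k z z - 2 * t * (α ⬝ᵥ kvec k x z) + α ⬝ᵥ gram k x *ᵥ α := by
  simp only [dotProduct, mulVec, gram, kvec, of_apply, Fin.sum_univ_castSucc, Fin.snoc_castSucc,
    Fin.snoc_last, Pi.neg_apply, Finset.mul_sum, Finset.sum_add_distrib, mul_add]
  have : ∀ i : Fin n, k z (x i) = k (x i) z := fun i => hs _ _
  simp only [this, neg_mul, mul_neg, neg_neg, Finset.sum_neg_distrib]
  have e1 : ∑ i, α i * (k (x i) z * t) = ∑ i, t * (k (x i) z * α i) :=
    Finset.sum_congr rfl fun i _ => by ring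
  have e2 : ∑ i, 2 * t * (α i * k (x i) z) = 2 * ∑ i, t * (k (x i) z * α i) := by
    rw [Finset.mul_sum]; exact Finset.sum_congr rfl fun i _ => by ring
  rw [e1, e2]; ring

lemma postVar_nonneg (hk : IsPSDKernel k) (hσ : 0 < σ) (x : Fin n → E) (z : E) :
    0 ≤ postVar k σ x z := by
  rw [postVar_eq hk hσ]
  set α := (noisyGram k σ x)⁻¹ *ᵥ kvec k x z
  have h := hk.nonneg (Fin.snoc x z : Fin (n + 1) → E) (Fin.snoc (-α) 1)
  rw [gram_snoc_quad hk.symm] at h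
  have : 0 ≤ σ ^ 2 * (α ⬝ᵥ α) :=
    mul_nonneg (sq_nonneg _) (by simpa using dotProduct_star_self_nonneg α)
  linarith

lemma postVar_le_diag (hk : IsPSDKernel k) (hσ : 0 < σ) (x : Fin n → E) (z : E) :
    postVar k σ x z ≤ k z z := by
  simpa using postVar_le hk hσ x z 0

/-- Posterior variances are monotone, up to the constant, in the kernel order. -/
lemma postVar_le_of_kernelLE {a : E → E → ℝ} {b : ℝ} (ha : IsPSDKernel a) (hk : IsPSDKernel k)
    (hak : KernelLE a k b) (hb : 1 ≤ b) (hσ : 0 < σ) (x : Fin n → E) (z : E) :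
    postVar a σ x z ≤ b * postVar k σ x z := by
  rw [postVar_eq hk hσ x z]
  set α := (noisyGram k σ x)⁻¹ *ᵥ kvec k x z
  -- The optimal weights for `k` serve as trial weights for `a`. The kernel order is then used on
  -- the points (x, z) with weights (-α, 1), and 1 ≤ b lets the ridge term σ²|α|² be multiplied by b
  -- as well.
  have h1 := postVar_le ha hσ x z α
  have h2 := hak (n + 1) (Fin.snoc x z : Fin (n + 1) → E) (Fin.snoc (-α) 1)
  rw [gram_snoc_quad hk.symm, gram_snoc_quad ha.symm] at h2
  have h3 : 0 ≤ σ ^ 2 * (α ⬝ᵥ α) :=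
    mul_nonneg (sq_nonneg _) (by simpa using dotProduct_star_self_nonneg α)
  nlinarith

/-- Interpolation error of a function of bounded kernel norm. -/
lemma abs_sub_postMean_le (hk : IsPSDKernel k) (hσ : 0 < σ) {X : Set E} {f : E → ℝ} {B : ℝ}
    (hB : 0 ≤ B)
    (hf : ∀ (n : ℕ) (x : Fin n → E), (∀ i, x i ∈ X) → ∀ c : Fin n → ℝ,
      (c ⬝ᵥ fun i => f (x i)) ^ 2 ≤ B ^ 2 * (c ⬝ᵥ gram k x *ᵥ c))
    (x : Fin n → E) (hx : ∀ i, x i ∈ X) {z : E} (hz : z ∈ X) :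
    |f z - postMean k σ x (fun i => f (x i)) z| ≤ B * postStd k σ x z := by
  set α := (noisyGram k σ x)⁻¹ *ᵥ kvec k x z with hα
  have hmean : postMean k σ x (fun i => f (x i)) z = α ⬝ᵥ fun i => f (x i) := by
    change kvec k x z ⬝ᵥ (noisyGram k σ x)⁻¹ *ᵥ _ = _
    rw [noisyGram_inv_comm hk hσ, dotProduct_comm]
  -- With the weights (-α, 1) the functional is the interpolation error at z, and its quadratic form
  -- is the posterior variance minus σ²|α|².
  have h := hf (n + 1) (Fin.snoc x z : Fin (n + 1) → E)
    (fun i => by refine Fin.lastCases ?_ (fun j => ?_) i <;> simp [hz, hx]) (Fin.snoc (-α) 1)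
  rw [gram_snoc_quad hk.symm] at h
  have he : ((Fin.snoc (-α) 1 : Fin (n + 1) → ℝ) ⬝ᵥ
      fun i => f ((Fin.snoc x z : Fin (n + 1) → E) i)) = f z - α ⬝ᵥ fun i => f (x i) := by
    simp [dotProduct, Fin.sum_univ_castSucc]; ring
  rw [he, ← hmean] at h
  have h3 : 0 ≤ σ ^ 2 * (α ⬝ᵥ α) :=
    mul_nonneg (sq_nonneg _) (by simpa using dotProduct_star_self_nonneg α)
  have h4 := postVar_eq hk hσ x z
  rw [← hα] at h4
  rw [postStd, ← Real.sqrt_sq hB, ← Real.sqrt_mul (sq_nonneg B)]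
  refine Real.abs_le_sqrt (h.trans ?_)
  gcongr
  linarith

/-! ### Adding one data point -/

/-- Elimination of the last row: the Schur complement of the bordered matrix is the posterior
variance plus σ², and the last coordinate enters only through its residual against the posterior
mean. The linear system is solved explicitly, without a formula for the block inverse. -/
lemma noisyGram_inv_quad_succ (hk : IsPSDKernel k) (hσ : 0 < σ) (x : Fin (n + 1) → E)
    (v : Fin (n + 1) → ℝ) :
    v ⬝ᵥ (noisyGram k σ x)⁻¹ *ᵥ v
      = (fun i : Fin n => v i.castSucc) ⬝ᵥ (noisyGram k σ fun i : Fin n => x i.castSucc)⁻¹ *ᵥ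
          (fun i : Fin n => v i.castSucc)
        + (v (Fin.last n) - postMean k σ (fun i : Fin n => x i.castSucc)
            (fun i : Fin n => v i.castSucc) (x (Fin.last n))) ^ 2
          / (postVar k σ (fun i : Fin n => x i.castSucc) (x (Fin.last n)) + σ ^ 2) := by
  set x' : Fin n → E := fun i => x i.castSucc with hx'
  set v' : Fin n → ℝ := fun i => v i.castSucc with hv'
  set z := x (Fin.last n) with hz
  set A := noisyGram k σ x'
  set b := kvec k x' z with hb
  set s := postVar k σ x' z with hs
  set μ := postMean k σ x' v' z with hμ
  have hs0 : 0 < s + σ ^ 2 := by have := postVar_nonneg hk hσ x' z; positivity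
  have hμ' : μ = b ⬝ᵥ A⁻¹ *ᵥ v' := rfl
  have hs' : s = k z z - b ⬝ᵥ A⁻¹ *ᵥ b := rfl
  -- The last coordinate of the solution is the residual over the Schur complement; the others
  -- follow by back substitution.
  set l := (v (Fin.last n) - μ) / (s + σ ^ 2) with hl
  set w : Fin n → ℝ := A⁻¹ *ᵥ v' - l • A⁻¹ *ᵥ b with hw
  have hAw : A *ᵥ w = v' - l • b := by
    rw [hw, mulVec_sub, mulVec_smul, noisyGram_mul_inv hk hσ, noisyGram_mul_inv hk hσ]
  have hsol : noisyGram k σ x *ᵥ (Fin.snoc w l : Fin (n + 1) → ℝ) = v := by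
    rw [noisyGram_mulVec]
    funext i
    refine Fin.lastCases ?_ (fun j => ?_) i
    · have e : (gram k x *ᵥ (Fin.snoc w l : Fin (n + 1) → ℝ)) (Fin.last n)
          = b ⬝ᵥ w + k z z * l := by
        simp only [mulVec, dotProduct, gram, of_apply, Fin.sum_univ_castSucc, Fin.snoc_castSucc,
          Fin.snoc_last, hb, kvec]
        congr 1
        exact Finset.sum_congr rfl fun i _ => by rw [hk.symm]
      rw [Pi.add_apply, e, Pi.smul_apply, Fin.snoc_last, hw, dotProduct_sub, dotProduct_smul,
        ← hμ', smul_eq_mul, smul_eq_mul]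
      have : (s + σ ^ 2) * l = v (Fin.last n) - μ := by rw [hl]; field_simp
      rw [hs'] at this
      linarith
    · have e : (gram k x *ᵥ (Fin.snoc w l : Fin (n + 1) → ℝ)) j.castSucc
          = (gram k x' *ᵥ w) j + b j * l := by
        simp only [mulVec, dotProduct, gram, of_apply, Fin.sum_univ_castSucc, Fin.snoc_castSucc,
          Fin.snoc_last, hb, kvec, hx', hz]
      have h2 := congrFun hAw j
      rw [noisyGram_mulVec] at h2
      simp only [Pi.add_apply, Pi.smul_apply, smul_eq_mul, Pi.sub_apply] at h2 ⊢
      rw [e, Fin.snoc_castSucc]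
      have : v' j = v j.castSucc := rfl
      linarith
  have hinv : (noisyGram k σ x)⁻¹ *ᵥ v = (Fin.snoc w l : Fin (n + 1) → ℝ) := by
    conv_lhs => rw [← hsol]
    exact noisyGram_inv_mul hk hσ x _
  rw [hinv]
  have e : v ⬝ᵥ (Fin.snoc w l : Fin (n + 1) → ℝ) = v' ⬝ᵥ w + v (Fin.last n) * l := by
    simp only [dotProduct, Fin.sum_univ_castSucc, Fin.snoc_castSucc, Fin.snoc_last, hv']
  rw [e, hw, dotProduct_sub, dotProduct_smul, noisyGram_inv_comm hk hσ x' v' b, ← hμ', smul_eq_mul,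
    sq, mul_div_assoc, ← hl]
  ring

/-- The same Schur complement, now for determinants. Together with the preceding lemma it makes the
explained energy and the information gain grow by matching increments. -/
lemma noisyGram_det_succ (hk : IsPSDKernel k) (hσ : 0 < σ) (x : Fin (n + 1) → E) :
    (noisyGram k σ x).det = (noisyGram k σ fun i : Fin n => x i.castSucc).det
      * (postVar k σ (fun i : Fin n => x i.castSucc) (x (Fin.last n)) + σ ^ 2) := by
  set x' : Fin n → E := fun i => x i.castSucc with hx'
  set z := x (Fin.last n) with hz
  set A := noisyGram k σ x' with hA
  have hu : IsUnit A.det := (Matrix.isUnit_iff_isUnit_det _).1 (noisyGram_posDef hk hσ x').isUnit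
  let _ : Invertible A := A.invertibleOfIsUnitDet hu
  have hblk : (noisyGram k σ x).submatrix (finSumFinEquiv : Fin n ⊕ Fin 1 ≃ Fin (n + 1))
      (finSumFinEquiv : Fin n ⊕ Fin 1 ≃ Fin (n + 1))
      = fromBlocks A (of fun i _ => kvec k x' z i) (of fun _ i => kvec k x' z i)
          (of fun _ _ => k z z + σ ^ 2) := by
    have hlast : ∀ i : Fin 1, Fin.natAdd n i = Fin.last n := fun i => by
      rw [Subsingleton.elim i 0]; rfl
    have hne : ∀ i : Fin n, Fin.castAdd 1 i ≠ Fin.last n := fun i =>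
      (Fin.castSucc_lt_last i).ne
    ext i j
    rcases i with i | i <;> rcases j with j | j
    · have : (1 : Matrix (Fin (n + 1)) (Fin (n + 1)) ℝ) (Fin.castAdd 1 i) (Fin.castAdd 1 j)
          = (1 : Matrix (Fin n) (Fin n) ℝ) i j := by
        simp [Matrix.one_apply]
      simp [noisyGram, hA, gram, hx', this]
      rfl
    · have : (1 : Matrix (Fin (n + 1)) (Fin (n + 1)) ℝ) (Fin.castAdd 1 i) (Fin.last n) = 0 :=
        Matrix.one_apply_ne (hne i)
      simp [noisyGram, gram, hx', hlast, this, kvec, hz]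
      rfl
    · have : (1 : Matrix (Fin (n + 1)) (Fin (n + 1)) ℝ) (Fin.last n) (Fin.castAdd 1 j) = 0 :=
        Matrix.one_apply_ne (hne j).symm
      simp [noisyGram, gram, hx', hlast, this, kvec, hz]
      exact hk.symm _ _
    · simp [noisyGram, gram, hlast, hz]
  rw [← det_submatrix_equiv_self (finSumFinEquiv : Fin n ⊕ Fin 1 ≃ Fin (n + 1)), hblk,
    det_fromBlocks₁₁, det_fin_one]
  congr 1
  rw [invOf_eq_nonsing_inv]
  have : ((of fun (_ : Fin 1) i => kvec k x' z i) * A⁻¹ * of fun i (_ : Fin 1) => kvec k x' z i) 0 0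
      = kvec k x' z ⬝ᵥ A⁻¹ *ᵥ kvec k x' z := by
    rw [Matrix.mul_assoc, mul_apply]
    simp only [dotProduct, mulVec, of_apply, mul_apply]
  rw [Matrix.sub_apply, this]
  change k z z + σ ^ 2 - _ = k z z - kvec k x' z ⬝ᵥ A⁻¹ *ᵥ kvec k x' z + σ ^ 2
  ring

end PosteriorAlgebra

/-! ### Explained energy and information gain along a sequence -/

section InformationGain

open Matrix

variable {E : Type} {n : ℕ} {k : E → E → ℝ} {σ : ℝ}

lemma dotProduct_self_nonneg' (v : Fin n → ℝ) : 0 ≤ v ⬝ᵥ v := by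
  simpa using dotProduct_star_self_nonneg v

/-- With v = (K + σ²I)w the quantity equals |Kw|² + σ² wᵀKw. -/
lemma explained_nonneg (hk : IsPSDKernel k) (hσ : 0 < σ) (x : Fin n → E) (v : Fin n → ℝ) :
    0 ≤ explained k σ x v := by
  rw [explained]
  set w := (noisyGram k σ x)⁻¹ *ᵥ v
  have hv : v = gram k x *ᵥ w + σ ^ 2 • w := by
    rw [← noisyGram_mulVec, noisyGram_mul_inv hk hσ]
  have h1 := hk.nonneg x w
  have h2 := dotProduct_self_nonneg' (gram k x *ᵥ w)
  have h3 : v ⬝ᵥ v - σ ^ 2 * (v ⬝ᵥ w)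
      = gram k x *ᵥ w ⬝ᵥ gram k x *ᵥ w + σ ^ 2 * (w ⬝ᵥ gram k x *ᵥ w) := by
    conv_lhs => rw [hv]
    simp only [dotProduct_add, add_dotProduct, dotProduct_smul, smul_dotProduct, smul_eq_mul]
    ring
  rw [h3]; positivity

lemma noisyGram_inv_norm_le (hk : IsPSDKernel k) (hσ : 0 < σ) (x : Fin n → E) (v : Fin n → ℝ) :
    σ ^ 4 * ((noisyGram k σ x)⁻¹ *ᵥ v ⬝ᵥ (noisyGram k σ x)⁻¹ *ᵥ v) ≤ v ⬝ᵥ v := by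
  set w := (noisyGram k σ x)⁻¹ *ᵥ v
  have hv : v = gram k x *ᵥ w + σ ^ 2 • w := by
    rw [← noisyGram_mulVec, noisyGram_mul_inv hk hσ]
  have h1 := hk.nonneg x w
  have h2 := dotProduct_self_nonneg' (gram k x *ᵥ w)
  have h3 : v ⬝ᵥ v = gram k x *ᵥ w ⬝ᵥ gram k x *ᵥ w + 2 * σ ^ 2 * (w ⬝ᵥ gram k x *ᵥ w)
      + σ ^ 4 * (w ⬝ᵥ w) := by
    conv_lhs => rw [hv]
    simp only [dotProduct_add, add_dotProduct, dotProduct_smul, smul_dotProduct, smul_eq_mul,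
      dotProduct_comm (gram k x *ᵥ w) w]
    ring
  have : 0 ≤ 2 * σ ^ 2 * (w ⬝ᵥ gram k x *ᵥ w) := by positivity
  linarith

/-- The increment depends only on the new coordinate, its prediction and its posterior variance.
Divided by 2R², it is the exponent of `mixFactor`. -/
lemma explained_succ (hk : IsPSDKernel k) (hσ : 0 < σ) (x : Fin (n + 1) → E)
    (v : Fin (n + 1) → ℝ) :
    explained k σ x v
      = explained k σ (fun i : Fin n => x i.castSucc) (fun i : Fin n => v i.castSucc)
        + (v (Fin.last n) ^ 2 - σ ^ 2 * (v (Fin.last n) - postMean k σ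
            (fun i : Fin n => x i.castSucc) (fun i : Fin n => v i.castSucc) (x (Fin.last n))) ^ 2
          / (postVar k σ (fun i : Fin n => x i.castSucc) (x (Fin.last n)) + σ ^ 2)) := by
  rw [explained, explained, noisyGram_inv_quad_succ hk hσ x v]
  have : v ⬝ᵥ v = (fun i : Fin n => v i.castSucc) ⬝ᵥ (fun i : Fin n => v i.castSucc)
      + v (Fin.last n) ^ 2 := by
    simp only [dotProduct, Fin.sum_univ_castSucc, sq]
  rw [this]; ring

/-- Cauchy–Schwarz for the posterior mean of pure noise. -/
lemma abs_postMean_le (hk : IsPSDKernel k) (hσ : 0 < σ) (x : Fin n → E) (v : Fin n → ℝ) (z : E) :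
    |postMean k σ x v z| ≤ postStd k σ x z / σ * √(explained k σ x v) := by
  set μ := postMean k σ x v z with hμ
  set s := postVar k σ x z with hs
  set q := explained k σ x v with hq
  have hs0 : 0 ≤ s := postVar_nonneg hk hσ x z
  have hq0 : 0 ≤ q := explained_nonneg hk hσ x v
  -- A fictitious value t observed at z keeps the explained energy nonnegative. This gives a
  -- nonnegative polynomial of degree at most two in t; its discriminant condition is the claim.
  have key : ∀ t : ℝ, 0 ≤ q * (s + σ ^ 2) + t ^ 2 * (s + σ ^ 2) - σ ^ 2 * (t - μ) ^ 2 := by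
    intro t
    have h := explained_nonneg hk hσ (Fin.snoc x z : Fin (n + 1) → E) (Fin.snoc v t)
    rw [explained_succ hk hσ] at h
    simp only [Fin.snoc_castSucc, Fin.snoc_last] at h
    rw [← hμ, ← hs, ← hq] at h
    have hp : 0 < s + σ ^ 2 := by positivity
    have := mul_nonneg h hp.le
    have e : (q + (t ^ 2 - σ ^ 2 * (t - μ) ^ 2 / (s + σ ^ 2))) * (s + σ ^ 2)
        = q * (s + σ ^ 2) + t ^ 2 * (s + σ ^ 2) - σ ^ 2 * (t - μ) ^ 2 := by
      field_simp; ring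
    linarith
  have hmain : σ ^ 2 * μ ^ 2 ≤ s * q := by
    rcases hs0.eq_or_lt with h0 | h0
    · by_contra hcon
      have hμ0 : 0 < μ ^ 2 := by
        by_contra h
        have : μ ^ 2 = 0 := le_antisymm (not_lt.1 h) (sq_nonneg _)
        rw [this, ← h0] at hcon; simp at hcon
      -- For s = 0 the polynomial is linear in t, and at this t it equals -σ²μ².
      have := key (-(q / (2 * μ)))
      have hμne : μ ≠ 0 := fun h => by simp [h] at hμ0
      rw [← h0] at this
      have e : q * (0 + σ ^ 2) + (-(q / (2 * μ))) ^ 2 * (0 + σ ^ 2) - σ ^ 2 * (-(q / (2 * μ)) - μ) ^ 2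
          = - (σ ^ 2 * μ ^ 2) := by
        field_simp; ring
      rw [e] at this
      have : 0 < σ ^ 2 * μ ^ 2 := by positivity
      linarith
    -- The minimizer of the quadratic polynomial.
    · have h := key (-(σ ^ 2 * μ / s))
      have e : q * (s + σ ^ 2) + (-(σ ^ 2 * μ / s)) ^ 2 * (s + σ ^ 2)
          - σ ^ 2 * (-(σ ^ 2 * μ / s) - μ) ^ 2 = (s + σ ^ 2) / s * (s * q - σ ^ 2 * μ ^ 2) := by
        field_simp; ring
      rw [e] at h
      have := nonneg_of_mul_nonneg_right h (by positivity)
      linarith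
  rw [postStd, ← hs, div_mul_eq_mul_div, le_div_iff₀ hσ, ← Real.sqrt_mul hs0]
  have : |μ| * σ = |σ * μ| := by rw [abs_mul, abs_of_pos hσ, mul_comm]
  rw [this]
  exact Real.abs_le_sqrt (by nlinarith)

/-- Stability of the explained part under a perturbation of the kernel matrix. -/
lemma explained_le_of_gram_le {a : E → E → ℝ} (ha : IsPSDKernel a) (hk : IsPSDKernel k)
    (hσ : 0 < σ) (x : Fin n → E) {η : ℝ} (hη : 0 ≤ η)
    (h : ∀ c : Fin n → ℝ, c ⬝ᵥ gram a x *ᵥ c ≤ c ⬝ᵥ gram k x *ᵥ c + η * (c ⬝ᵥ c))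
    (v : Fin n → ℝ) :
    explained a σ x v ≤ explained k σ x v + η / σ ^ 2 * (v ⬝ᵥ v) := by
  set w := (noisyGram k σ x)⁻¹ *ᵥ v with hw
  set A := noisyGram a σ x with hA
  -- Variational bound vᵀA⁻¹v ≥ 2vᵀw - wᵀAw, used with the solution w for the other kernel. The loss
  -- is η|w|², and σ⁴|w|² ≤ |v|² turns it into a multiple of |v|².
  have h0 : 0 ≤ (w - A⁻¹ *ᵥ v) ⬝ᵥ A *ᵥ (w - A⁻¹ *ᵥ v) := by
    simpa using (noisyGram_posDef ha hσ x).posSemidef.dotProduct_mulVec_nonneg (w - A⁻¹ *ᵥ v)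
  rw [mulVec_sub, noisyGram_mul_inv ha hσ, sub_dotProduct, dotProduct_sub, dotProduct_sub,
    noisyGram_quad, dotProduct_comm (A⁻¹ *ᵥ v) v,
    dotProduct_mulVec_comm (noisyGram_posDef ha hσ x).1, noisyGram_mul_inv ha hσ] at h0
  have h1 := noisyGram_quad (k := k) (σ := σ) x w
  rw [hw, noisyGram_mul_inv hk hσ, ← hw] at h1
  have h2 := noisyGram_inv_norm_le hk hσ x v
  rw [← hw] at h2
  have h3 := h w
  rw [explained, explained, ← hw, ← hA]
  have h4 : σ ^ 2 * (η * (w ⬝ᵥ w)) ≤ η / σ ^ 2 * (v ⬝ᵥ v) := by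
    rw [div_mul_eq_mul_div, le_div_iff₀ (by positivity)]
    nlinarith
  have h5 : v ⬝ᵥ w ≤ v ⬝ᵥ A⁻¹ *ᵥ v + η * (w ⬝ᵥ w) := by
    rw [dotProduct_comm w v] at h1 h0
    linarith
  nlinarith [sq_nonneg σ]

lemma infoGain_eq (hσ : 0 < σ) (x : Fin n → E) :
    infoGain k σ x = 1 / 2 * Real.log ((σ ^ 2)⁻¹ ^ n * (noisyGram k σ x).det) := by
  have : (1 + (σ ^ 2)⁻¹ • gram k x) = (σ ^ 2)⁻¹ • noisyGram k σ x := by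
    rw [noisyGram, smul_add, smul_smul, inv_mul_cancel₀ (by positivity), one_smul, add_comm]
  rw [infoGain, this, det_smul, Fintype.card_fin]

lemma infoGain_succ (hk : IsPSDKernel k) (hσ : 0 < σ) (x : Fin (n + 1) → E) :
    infoGain k σ x = infoGain k σ (fun i : Fin n => x i.castSucc)
      + 1 / 2 * Real.log (1 + postVar k σ (fun i : Fin n => x i.castSucc) (x (Fin.last n)) / σ ^ 2)
    := by
  have hs := postVar_nonneg hk hσ (fun i : Fin n => x i.castSucc) (x (Fin.last n))
  have hd := (noisyGram_posDef hk hσ fun i : Fin n => x i.castSucc).det_pos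
  rw [infoGain_eq hσ, infoGain_eq hσ, noisyGram_det_succ hk hσ, ← mul_add, ← Real.log_mul]
  · set s := postVar k σ (fun i : Fin n => x i.castSucc) (x (Fin.last n))
    have e : 1 + s / σ ^ 2 = (σ ^ 2)⁻¹ * (s + σ ^ 2) := by field_simp; ring
    rw [e, pow_succ]
    congr 2
    ring
  · positivity
  · positivity

/-- Chain rule for the information gain along a sequence. -/
lemma infoGain_seq (hk : IsPSDKernel k) (hσ : 0 < σ) (x : ℕ → E) (n : ℕ) :
    infoGain k σ (fun i : Fin n => x i)
      = 1 / 2 * ∑ j ∈ Finset.range n,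
          Real.log (1 + postVar k σ (fun i : Fin j => x i) (x j) / σ ^ 2) := by
  induction n with
  | zero => simp [infoGain]
  | succ n ih =>
    rw [infoGain_succ hk hσ, Finset.sum_range_succ, mul_add]
    simp only [Fin.val_castSucc, Fin.val_last]
    rw [ih]

/-- Each point adds ½ log(1 + s/σ²) with 0 ≤ s ≤ 1 ≤ σ², hence between 0 and 1/2. The linear bound
is crude, but it makes the suprema over designs and over Θ finite; an unbounded real supremum would
be the default value 0. -/
lemma infoGain_nonneg_le (hk : IsPSDKernel k) (hk1 : ∀ z, k z z ≤ 1) (hσ : 1 ≤ σ)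
    (x : Fin n → E) : 0 ≤ infoGain k σ x ∧ infoGain k σ x ≤ n / 2 := by
  have hσ0 : 0 < σ := by linarith
  induction n with
  | zero => simp [infoGain]
  | succ n ih =>
    rw [infoGain_succ hk hσ0]
    have h := ih (fun i => x i.castSucc)
    set s := postVar k σ (fun i : Fin n => x i.castSucc) (x (Fin.last n))
    have hs : 0 ≤ s := postVar_nonneg hk hσ0 _ _
    have hs1 : s ≤ 1 := (postVar_le_diag hk hσ0 _ _).trans (hk1 _)
    have hd : s / σ ^ 2 ≤ 1 := by
      rw [div_le_one (by positivity)]; nlinarith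
    have hd0 : 0 ≤ s / σ ^ 2 := by positivity
    have h1 : Real.log (1 + s / σ ^ 2) ≤ s / σ ^ 2 := by
      have := Real.log_le_sub_one_of_pos (x := 1 + s / σ ^ 2) (by linarith)
      linarith
    have h2 : 0 ≤ Real.log (1 + s / σ ^ 2) := Real.log_nonneg (by linarith)
    push_cast
    constructor <;> linarith [h.1, h.2]

lemma bddAbove_infoGain (hk : IsPSDKernel k) (hk1 : ∀ z, k z z ≤ 1) (hσ : 1 ≤ σ) (X : Set E)
    (n : ℕ) : BddAbove (Set.range fun x : Fin n → X => infoGain k σ (fun i => (x i : E))) := by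
  refine ⟨n / 2, ?_⟩
  rintro _ ⟨x, rfl⟩
  exact (infoGain_nonneg_le hk hk1 hσ _).2

lemma infoGain_le_maxInfoGain (hk : IsPSDKernel k) (hk1 : ∀ z, k z z ≤ 1) (hσ : 1 ≤ σ) {X : Set E}
    (x : Fin n → E) (hx : ∀ i, x i ∈ X) : infoGain k σ x ≤ maxInfoGain k σ X n :=
  le_ciSup (bddAbove_infoGain hk hk1 hσ X n) fun i => ⟨x i, hx i⟩

lemma maxInfoGain_nonneg (hk : IsPSDKernel k) (hk1 : ∀ z, k z z ≤ 1) (hσ : 1 ≤ σ) (X : Set E)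
    (n : ℕ) : 0 ≤ maxInfoGain k σ X n :=
  Real.iSup_nonneg fun _ => (infoGain_nonneg_le hk hk1 hσ _).1

lemma maxInfoGain_le (hk : IsPSDKernel k) (hk1 : ∀ z, k z z ≤ 1) (hσ : 1 ≤ σ) (X : Set E)
    (n : ℕ) : maxInfoGain k σ X n ≤ n / 2 :=
  Real.iSup_le (fun _ => (infoGain_nonneg_le hk hk1 hσ _).2) (by positivity)

lemma maxInfoGain_mono (hk : IsPSDKernel k) (hk1 : ∀ z, k z z ≤ 1) (hσ : 1 ≤ σ) {X : Set E}
    (hX : X.Nonempty) : Monotone (maxInfoGain k σ X) := by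
  refine monotone_nat_of_le_succ fun n => ?_
  refine Real.iSup_le (fun x => ?_) (maxInfoGain_nonneg hk hk1 hσ X _)
  obtain ⟨z, hz⟩ := hX
  have h := infoGain_succ hk (σ := σ) (by linarith)
    (Fin.snoc (fun i => (x i : E)) z : Fin (n + 1) → E)
  simp only [Fin.snoc_castSucc, Fin.snoc_last] at h
  have h2 : 0 ≤ Real.log (1 + postVar k σ (fun i => (x i : E)) z / σ ^ 2) := by
    refine Real.log_nonneg ?_
    have := postVar_nonneg hk (σ := σ) (by linarith) (fun i => (x i : E)) z
    have : 0 ≤ postVar k σ (fun i => (x i : E)) z / σ ^ 2 := by positivity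
    linarith
  have h3 := infoGain_le_maxInfoGain hk hk1 hσ (X := X)
    (Fin.snoc (fun i => (x i : E)) z : Fin (n + 1) → E)
    (fun i => by refine Fin.lastCases ?_ (fun j => ?_) i <;> simp [hz])
  linarith

/-- The posterior variances along a sequence are summed up by the information gain. -/
lemma sum_postVar_le (hk : IsPSDKernel k) (hk1 : ∀ z, k z z ≤ 1) (hσ : 1 ≤ σ) (x : ℕ → E) (n : ℕ) :
    ∑ j ∈ Finset.range n, postVar k σ (fun i : Fin j => x i) (x j)
      ≤ 4 * σ ^ 2 * infoGain k σ (fun i : Fin n => x i) := by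
  have hσ0 : 0 < σ := by linarith
  rw [infoGain_seq hk hσ0, ← mul_assoc, Finset.mul_sum]
  refine Finset.sum_le_sum fun j _ => ?_
  set s := postVar k σ (fun i : Fin j => x i) (x j)
  have hs : 0 ≤ s := postVar_nonneg hk hσ0 _ _
  have hs1 : s ≤ 1 := (postVar_le_diag hk hσ0 _ _).trans (hk1 _)
  have hd : s / σ ^ 2 ≤ 1 := by
    rw [div_le_one (by positivity)]; nlinarith
  have hd0 : 0 ≤ s / σ ^ 2 := by positivity
  -- For 0 ≤ u ≤ 1, log(1 + u) ≥ u/(1 + u) ≥ u/2; the condition u = s/σ² ≤ 1 comes from σ ≥ 1.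
  have h1 := Real.one_sub_inv_le_log_of_pos (x := 1 + s / σ ^ 2) (by linarith)
  have h2 : s / σ ^ 2 / 2 ≤ 1 - (1 + s / σ ^ 2)⁻¹ := by
    rw [inv_eq_one_div, le_sub_iff_add_le, ← le_sub_iff_add_le', div_le_iff₀ (by linarith)]
    nlinarith
  have e : s = σ ^ 2 * (s / σ ^ 2) := by field_simp
  have : s / σ ^ 2 ≤ 2 * Real.log (1 + s / σ ^ 2) := by linarith
  calc s = σ ^ 2 * (s / σ ^ 2) := e
    _ ≤ σ ^ 2 * (2 * Real.log (1 + s / σ ^ 2)) := by gcongr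
    _ = _ := by ring

end InformationGain

/-! ### Gaussian kernels -/

section Gaussian

open Complex in
/-- Fourier representation of a product of one-dimensional Gaussians. -/
lemma integral_cexp_mul_gaussian {d : ℕ} {a : Fin d → ℝ} (ha : ∀ i, 0 < a i) (t : Fin d → ℝ) :
    ∫ w : Fin d → ℝ, ∏ i, (cexp (I * t i * w i) * cexp (-((4 * a i)⁻¹ : ℝ) * (w i : ℂ) ^ 2))
      = ((∏ i, √(4 * Real.pi * a i)) * Real.exp (-∑ i, a i * t i ^ 2) : ℝ) := by
  rw [integral_fintype_prod_volume_eq_prod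
    (fun i (w : ℝ) => cexp (I * t i * w) * cexp (-((4 * a i)⁻¹ : ℝ) * (w : ℂ) ^ 2))]
  rw [← Finset.sum_neg_distrib, Real.exp_sum, ← Finset.prod_mul_distrib, Complex.ofReal_prod]
  refine Finset.prod_congr rfl fun i _ => ?_
  have hai := ha i
  rw [fourierIntegral_gaussian (by rw [Complex.ofReal_re]; positivity)]
  have e1 : (Real.pi : ℂ) / ((4 * a i)⁻¹ : ℝ) = ((4 * Real.pi * a i : ℝ) : ℂ) := by
    push_cast; field_simp
  have e2 : -(t i : ℂ) ^ 2 / (4 * ((4 * a i)⁻¹ : ℝ)) = ((-(a i * t i ^ 2) : ℝ) : ℂ) := by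
    have : (a i : ℂ) ≠ 0 := by exact_mod_cast hai.ne'
    push_cast; field_simp
  have e3 : ((√(4 * Real.pi * a i) : ℝ) : ℂ) = ((4 * Real.pi * a i : ℝ) : ℂ) ^ (1 / 2 : ℂ) := by
    rw [Real.sqrt_eq_rpow, Complex.ofReal_cpow (by positivity)]
    norm_num
  rw [e1, e2, ← e3, ← Complex.ofReal_exp, ← Complex.ofReal_mul]

open Complex in
lemma integrable_cexp_mul_gaussian {d : ℕ} {a : Fin d → ℝ} (ha : ∀ i, 0 < a i) (t : Fin d → ℝ) :
    Integrable fun w : Fin d → ℝ =>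
      ∏ i, (cexp (I * t i * w i) * cexp (-((4 * a i)⁻¹ : ℝ) * (w i : ℂ) ^ 2)) := by
  refine Integrable.fintype_prod
    (f := fun i (w : ℝ) => cexp (I * t i * w) * cexp (-((4 * a i)⁻¹ : ℝ) * (w : ℂ) ^ 2)) fun i => ?_
  have hai := ha i
  have := integrable_cexp_quadratic (b := ((4 * a i)⁻¹ : ℝ))
    (by rw [Complex.ofReal_re]; positivity) (I * t i) 0
  refine this.congr (Eventually.of_forall fun w => ?_)
  simp only
  rw [← Complex.exp_add]
  ring_nf

open Complex in
/-- The quadratic form of a Gaussian kernel as an integral over frequencies. -/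
lemma gaussian_quad_eq {d n : ℕ} {a : Fin d → ℝ} (ha : ∀ i, 0 < a i) (y : Fin n → Fin d → ℝ)
    (c : Fin n → ℝ) :
    (∏ i, √(4 * Real.pi * a i)) *
        ∑ j, ∑ l, c j * c l * Real.exp (-∑ i, a i * (y j i - y l i) ^ 2)
      = ∫ w : Fin d → ℝ, ‖∑ j, (c j : ℂ) * cexp (I * ∑ i, (w i : ℂ) * y j i)‖ ^ 2
          * Real.exp (-∑ i, (4 * a i)⁻¹ * w i ^ 2) ∧
    Integrable fun w : Fin d → ℝ => ‖∑ j, (c j : ℂ) * cexp (I * ∑ i, (w i : ℂ) * y j i)‖ ^ 2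
          * Real.exp (-∑ i, (4 * a i)⁻¹ * w i ^ 2) := by
  have hpt : ∀ w : Fin d → ℝ,
      ((‖∑ j, (c j : ℂ) * cexp (I * ∑ i, (w i : ℂ) * y j i)‖ ^ 2
          * Real.exp (-∑ i, (4 * a i)⁻¹ * w i ^ 2) : ℝ) : ℂ)
      = ∑ j, ∑ l, (c j * c l : ℂ) * ∏ i, (cexp (I * ((y j i - y l i : ℝ) : ℂ) * w i)
          * cexp (-((4 * a i)⁻¹ : ℝ) * (w i : ℂ) ^ 2)) := by
    intro w
    rw [Complex.ofReal_mul, Complex.ofReal_pow, ← Complex.mul_conj', map_sum, Finset.sum_mul_sum,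
      Finset.sum_mul]
    refine Finset.sum_congr rfl fun j _ => ?_
    rw [Finset.sum_mul]
    refine Finset.sum_congr rfl fun l _ => ?_
    rw [map_mul, Complex.conj_ofReal, ← Complex.exp_conj, map_mul, Complex.conj_I, map_sum,
      Finset.prod_mul_distrib, ← Complex.exp_sum, ← Complex.exp_sum, Complex.ofReal_exp]
    simp only [map_mul, Complex.conj_ofReal]
    have e : cexp (∑ i, I * ((y j i - y l i : ℝ) : ℂ) * w i)
        = cexp (I * ∑ i, (w i : ℂ) * y j i) * cexp (-I * ∑ i, (w i : ℂ) * y l i) := by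
      rw [← Complex.exp_add]
      congr 1
      rw [Finset.mul_sum, Finset.mul_sum, ← Finset.sum_add_distrib]
      refine Finset.sum_congr rfl fun i _ => ?_
      push_cast; ring
    rw [e]
    have e' : ((-∑ i, (4 * a i)⁻¹ * w i ^ 2 : ℝ) : ℂ)
        = ∑ i, -((4 * a i)⁻¹ : ℝ) * (w i : ℂ) ^ 2 := by
      push_cast
      rw [← Finset.sum_neg_distrib]
      exact Finset.sum_congr rfl fun i _ => by ring
    rw [e']
    ring
  have hint : ∀ j l, Integrable fun w : Fin d → ℝ =>
      (c j * c l : ℂ) * ∏ i, (cexp (I * ((y j i - y l i : ℝ) : ℂ) * w i)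
          * cexp (-((4 * a i)⁻¹ : ℝ) * (w i : ℂ) ^ 2)) := fun j l =>
    (integrable_cexp_mul_gaussian ha fun i => y j i - y l i).const_mul _
  have hI : Integrable fun w : Fin d → ℝ =>
      ((‖∑ j, (c j : ℂ) * cexp (I * ∑ i, (w i : ℂ) * y j i)‖ ^ 2
          * Real.exp (-∑ i, (4 * a i)⁻¹ * w i ^ 2) : ℝ) : ℂ) := by
    simp_rw [hpt]
    exact integrable_finsetSum _ fun j _ => integrable_finsetSum _ fun l _ => hint j l
  refine ⟨?_, hI.re⟩
  apply Complex.ofReal_injective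
  rw [← integral_complex_ofReal]
  simp_rw [hpt]
  rw [integral_finsetSum _ fun j _ => integrable_finsetSum _ fun l _ => hint j l]
  simp_rw [integral_finsetSum _ fun l _ => hint _ l]
  rw [Complex.ofReal_mul, Complex.ofReal_sum, Finset.mul_sum]
  refine Finset.sum_congr rfl fun j _ => ?_
  rw [Complex.ofReal_sum, Finset.mul_sum]
  refine Finset.sum_congr rfl fun l _ => ?_
  rw [integral_const_mul, integral_cexp_mul_gaussian ha]
  push_cast
  ring

lemma gaussian_quad_nonneg {d n : ℕ} {a : Fin d → ℝ} (ha : ∀ i, 0 < a i) (y : Fin n → Fin d → ℝ)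
    (c : Fin n → ℝ) : 0 ≤ ∑ j, ∑ l, c j * c l * Real.exp (-∑ i, a i * (y j i - y l i) ^ 2) := by
  have h := (gaussian_quad_eq ha y c).1
  have h2 : 0 < ∏ i, √(4 * Real.pi * a i) := Finset.prod_pos fun i _ => by
    have := ha i; positivity
  refine nonneg_of_mul_nonneg_right (h ▸ integral_nonneg fun w => ?_) h2
  positivity

/-- Narrower Gaussian kernels dominate wider ones. -/
lemma gaussian_quad_mono {d n : ℕ} {a b : Fin d → ℝ} (ha : ∀ i, 0 < a i) (hab : ∀ i, a i ≤ b i)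
    (y : Fin n → Fin d → ℝ) (c : Fin n → ℝ) :
    (∏ i, √(4 * Real.pi * a i)) *
        ∑ j, ∑ l, c j * c l * Real.exp (-∑ i, a i * (y j i - y l i) ^ 2)
      ≤ (∏ i, √(4 * Real.pi * b i)) *
        ∑ j, ∑ l, c j * c l * Real.exp (-∑ i, b i * (y j i - y l i) ^ 2) := by
  have hb : ∀ i, 0 < b i := fun i => (ha i).trans_le (hab i)
  -- In frequency space both sides integrate the same squared modulus against exp(-∑ wᵢ²/(4aᵢ)),
  -- which increases with every aᵢ.
  rw [(gaussian_quad_eq ha y c).1, (gaussian_quad_eq hb y c).1]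
  refine integral_mono (gaussian_quad_eq ha y c).2 (gaussian_quad_eq hb y c).2 fun w => ?_
  dsimp only
  gcongr with i
  · have := ha i; positivity
  · exact hab i

end Gaussian

/-! ### The Matérn kernel as a mixture of Gaussian kernels -/

section Matern

/-- Density of the mixture, up to its normalization. -/
def mixDensity (ν u : ℝ) : ℝ := Real.exp (-u) * u ^ (ν - 1)

/-- Profile of the Matérn kernel as a function of the squared scaled distance. -/
def maternProfile (ν q : ℝ) : ℝ :=
  ∫ u in Set.Ioi (0 : ℝ), mixDensity ν u * Real.exp (-(ν / (2 * u) * q))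

variable {ν : ℝ}

lemma mixDensity_nonneg {u : ℝ} (hu : u ∈ Set.Ioi (0 : ℝ)) : 0 ≤ mixDensity ν u :=
  mul_nonneg (Real.exp_pos _).le (Real.rpow_nonneg (le_of_lt hu) _)

lemma integrableOn_mixDensity (hν : 0 < ν) : IntegrableOn (mixDensity ν) (Set.Ioi 0) :=
  Real.GammaIntegral_convergent hν

lemma integral_mixDensity (hν : 0 < ν) : ∫ u in Set.Ioi 0, mixDensity ν u = Real.Gamma ν :=
  (Real.Gamma_eq_integral hν).symm

lemma integrableOn_profile (hν : 0 < ν) {q : ℝ} (hq : 0 ≤ q) :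
    IntegrableOn (fun u => mixDensity ν u * Real.exp (-(ν / (2 * u) * q))) (Set.Ioi 0) := by
  refine Integrable.mono' (integrableOn_mixDensity hν) ?_ ?_
  · refine AEStronglyMeasurable.mul (integrableOn_mixDensity hν).aestronglyMeasurable ?_
    exact (by fun_prop : Measurable fun u : ℝ => Real.exp (-(ν / (2 * u) * q))).aestronglyMeasurable
  · refine (ae_restrict_mem measurableSet_Ioi).mono fun u hu => ?_
    have h0 := mixDensity_nonneg (ν := ν) hu
    rw [Real.norm_of_nonneg (mul_nonneg h0 (Real.exp_pos _).le)]
    refine mul_le_of_le_one_right h0 (Real.exp_le_one_iff.2 ?_)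
    have : (0 : ℝ) < u := hu
    rw [neg_nonpos]; positivity

lemma maternProfile_zero (hν : 0 < ν) : maternProfile ν 0 = Real.Gamma ν := by
  simp [maternProfile, integral_mixDensity hν]

variable {d m : ℕ}

lemma scaledDist_sq (grp : Fin d → Fin m) (θ : Fin m → ℝ) (x x' : EuclideanSpace ℝ (Fin d)) :
    scaledDist grp θ x x' ^ 2 = ∑ i, ((x i - x' i) / θ (grp i)) ^ 2 :=
  Real.sq_sqrt (Finset.sum_nonneg fun _ _ => sq_nonneg _)

/-- At z = √(2ν) r the integral defining K_ν has z²/(4u) = νr²/(2u), and the powers of z and of 2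
cancel. So the kernel is an average of Gaussians over a Gamma variable u of shape ν. Positivity, the
kernel order, dependence on lengthscales and the spectral law are all read off from this mixture.
Distance zero needs no separate treatment afterwards. -/
lemma matern_eq (hν : 0 < ν) (var : ℝ) (grp : Fin d → Fin m) (θ : Fin m → ℝ)
    (x x' : EuclideanSpace ℝ (Fin d)) :
    matern ν var grp θ x x'
      = var / Real.Gamma ν * maternProfile ν (∑ i, ((x i - x' i) / θ (grp i)) ^ 2) := by
  rw [← scaledDist_sq]
  have hΓ := Real.Gamma_pos_of_pos hν
  unfold matern
  split_ifs with h
  · rw [h, zero_pow two_ne_zero, maternProfile_zero hν]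
    field_simp
  · set r := scaledDist grp θ x x'
    have hr : 0 < r := lt_of_le_of_ne (Real.sqrt_nonneg _) (Ne.symm h)
    have hz : 0 < √(2 * ν) * r := by positivity
    have hint : ∫ u in Set.Ioi (0 : ℝ),
        Real.exp (-u - (√(2 * ν) * r) ^ 2 / (4 * u)) * u ^ (ν - 1) = maternProfile ν (r ^ 2) := by
      refine setIntegral_congr_fun measurableSet_Ioi fun u hu => ?_
      have hu' : (0 : ℝ) < u := hu
      have e : (√(2 * ν) * r) ^ 2 / (4 * u) = ν / (2 * u) * r ^ 2 := by
        rw [mul_pow, Real.sq_sqrt (by positivity)]; field_simp; norm_num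
      simp only [mixDensity]
      rw [e, sub_eq_add_neg, Real.exp_add]
      ring
    rw [besselK, hint, Real.div_rpow hz.le (by norm_num), Real.rpow_neg hz.le,
      Real.rpow_neg (by norm_num), Real.rpow_sub (by norm_num), Real.rpow_one]
    have h1 : 0 < (√(2 * ν) * r) ^ ν := Real.rpow_pos_of_pos hz _
    have h2 : (0 : ℝ) < 2 ^ ν := by positivity
    field_simp

lemma maternProfile_nonneg (q : ℝ) : 0 ≤ maternProfile ν q :=
  setIntegral_nonneg measurableSet_Ioi fun _ hu =>
    mul_nonneg (mixDensity_nonneg hu) (Real.exp_pos _).le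

/-- The profile varies slowly in the relative size of its argument. -/
lemma abs_maternProfile_sub_le (hν : 0 < ν) {q q' τ : ℝ} (hq : 0 ≤ q) (hq' : 0 ≤ q') (hτ : 0 ≤ τ)
    (h1 : q ≤ (1 + τ) * q') (h2 : q' ≤ (1 + τ) * q) :
    |maternProfile ν q - maternProfile ν q'| ≤ τ * Real.Gamma ν := by
  -- For A ≤ A' ≤ (1 + τ)A the difference is at most e^(-A)(A' - A) ≤ τ A e^(-A) ≤ τ. The bound is
  -- uniform in A, hence in the mixing variable u.
  have key : ∀ {A A' : ℝ}, 0 ≤ A → 0 ≤ A' → A' ≤ (1 + τ) * A →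
      Real.exp (-A) - Real.exp (-A') ≤ τ := by
    intro A A' hA hA' h
    rcases le_total A' A with hle | hle
    · have : Real.exp (-A) ≤ Real.exp (-A') := Real.exp_le_exp.2 (by linarith)
      linarith
    · have e : Real.exp (-A') = Real.exp (-A) * Real.exp (-(A' - A)) := by
        rw [← Real.exp_add]; ring_nf
      have h3 : 1 - (A' - A) ≤ Real.exp (-(A' - A)) := by
        have := Real.add_one_le_exp (-(A' - A)); linarith
      have h4 : Real.exp (-A) * A ≤ 1 := by
        have := Real.add_one_le_exp A
        rw [Real.exp_neg, inv_mul_le_iff₀ (Real.exp_pos _)]; linarith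
      have h5 := Real.exp_pos (-A)
      rw [e]
      nlinarith [mul_le_mul_of_nonneg_left h3 h5.le]
  have keyabs : ∀ {A A' : ℝ}, 0 ≤ A → 0 ≤ A' → A ≤ (1 + τ) * A' → A' ≤ (1 + τ) * A →
      |Real.exp (-A) - Real.exp (-A')| ≤ τ := fun hA hA' h h' =>
    abs_le.2 ⟨by linarith [key hA' hA h], key hA hA' h'⟩
  rw [maternProfile, maternProfile,
    ← integral_sub (integrableOn_profile hν hq) (integrableOn_profile hν hq'),
    ← integral_mixDensity hν, ← integral_const_mul, ← Real.norm_eq_abs]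
  refine norm_integral_le_of_norm_le ((integrableOn_mixDensity hν).const_mul τ) ?_
  refine (ae_restrict_mem measurableSet_Ioi).mono fun u hu => ?_
  have hu' : (0 : ℝ) < u := hu
  have h0 := mixDensity_nonneg (ν := ν) hu
  rw [← mul_sub, norm_mul, Real.norm_of_nonneg h0, mul_comm]
  refine mul_le_mul_of_nonneg_right (keyabs (by positivity) (by positivity) ?_ ?_) h0
  · calc _ ≤ ν / (2 * u) * ((1 + τ) * q') := by gcongr
      _ = _ := by ring
  · calc _ ≤ ν / (2 * u) * ((1 + τ) * q) := by gcongr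
      _ = _ := by ring

lemma maternProfile_le (hν : 0 < ν) {q : ℝ} (hq : 0 ≤ q) : maternProfile ν q ≤ Real.Gamma ν := by
  rw [← integral_mixDensity hν]
  refine setIntegral_mono_on (integrableOn_profile hν hq) (integrableOn_mixDensity hν)
    measurableSet_Ioi fun u hu => ?_
  have hu' : (0 : ℝ) < u := hu
  refine mul_le_of_le_one_right (mixDensity_nonneg hu) (Real.exp_le_one_iff.2 ?_)
  rw [neg_nonpos]; positivity

lemma measurable_maternProfile : Measurable (maternProfile ν) := by
  have h : StronglyMeasurable (Function.uncurry fun q u : ℝ =>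
      mixDensity ν u * Real.exp (-(ν / (2 * u) * q))) := by
    refine Measurable.stronglyMeasurable ?_
    unfold mixDensity Function.uncurry
    fun_prop
  exact (h.integral_prod_right (ν := volume.restrict (Set.Ioi (0 : ℝ)))).measurable

lemma measurable_matern (hν : 0 < ν) (var : ℝ) (grp : Fin d → Fin m) (θ : Fin m → ℝ) :
    Measurable fun p : EuclideanSpace ℝ (Fin d) × EuclideanSpace ℝ (Fin d) =>
      matern ν var grp θ p.1 p.2 := by
  simp_rw [matern_eq hν]
  refine Measurable.const_mul (measurable_maternProfile.comp ?_) _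
  refine Finset.measurable_sum _ fun i _ => ?_
  refine Measurable.pow_const (Measurable.div_const ?_ _) _
  have : Measurable fun y : EuclideanSpace ℝ (Fin d) => y i := by fun_prop
  exact (this.comp measurable_fst).sub (this.comp measurable_snd)

open Matrix in
lemma gram_quad {E : Type} {n : ℕ} (k : E → E → ℝ) (x : Fin n → E) (c : Fin n → ℝ) :
    c ⬝ᵥ gram k x *ᵥ c = ∑ j, ∑ l, c j * c l * k (x j) (x l) := by
  simp only [dotProduct, mulVec, gram, of_apply, Finset.mul_sum]
  exact Finset.sum_congr rfl fun j _ => Finset.sum_congr rfl fun l _ => by ring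

/-- Quadratic form of the Gaussian component `u` of the mixture. -/
def mixQuad (ν : ℝ) (grp : Fin d → Fin m) (θ : Fin m → ℝ) {n : ℕ}
    (x : Fin n → EuclideanSpace ℝ (Fin d)) (c : Fin n → ℝ) (u : ℝ) : ℝ :=
  ∑ j, ∑ l, c j * c l * Real.exp (-∑ i, ν / (2 * u * θ (grp i) ^ 2) * (x j i - x l i) ^ 2)

lemma mixQuad_eq (grp : Fin d → Fin m) (θ : Fin m → ℝ) {n : ℕ}
    (x : Fin n → EuclideanSpace ℝ (Fin d)) (c : Fin n → ℝ) (u : ℝ) :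
    mixDensity ν u * mixQuad ν grp θ x c u = ∑ j, ∑ l, c j * c l * (mixDensity ν u *
      Real.exp (-(ν / (2 * u) * ∑ i, ((x j i - x l i) / θ (grp i)) ^ 2))) := by
  rw [mixQuad, Finset.mul_sum]
  refine Finset.sum_congr rfl fun j _ => ?_
  rw [Finset.mul_sum]
  refine Finset.sum_congr rfl fun l _ => ?_
  have : ∑ i, ν / (2 * u * θ (grp i) ^ 2) * (x j i - x l i) ^ 2
      = ν / (2 * u) * ∑ i, ((x j i - x l i) / θ (grp i)) ^ 2 := by
    rw [Finset.mul_sum]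
    refine Finset.sum_congr rfl fun i _ => ?_
    rw [div_pow, div_mul_div_comm, div_mul_eq_mul_div]
  rw [this]; ring

lemma integrableOn_mixQuad (hν : 0 < ν) (grp : Fin d → Fin m) (θ : Fin m → ℝ) {n : ℕ}
    (x : Fin n → EuclideanSpace ℝ (Fin d)) (c : Fin n → ℝ) :
    IntegrableOn (fun u => mixDensity ν u * mixQuad ν grp θ x c u) (Set.Ioi 0) := by
  simp_rw [mixQuad_eq]
  exact integrable_finsetSum _ fun j _ => integrable_finsetSum _ fun l _ =>
    (integrableOn_profile hν (Finset.sum_nonneg fun _ _ => sq_nonneg _)).const_mul _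

open Matrix in
lemma matern_quad (hν : 0 < ν) (var : ℝ) (grp : Fin d → Fin m) (θ : Fin m → ℝ) {n : ℕ}
    (x : Fin n → EuclideanSpace ℝ (Fin d)) (c : Fin n → ℝ) :
    c ⬝ᵥ gram (matern ν var grp θ) x *ᵥ c = var / Real.Gamma ν *
      ∫ u in Set.Ioi (0 : ℝ), mixDensity ν u * mixQuad ν grp θ x c u := by
  have hint : ∀ j l, IntegrableOn (fun u => c j * c l * (mixDensity ν u *
      Real.exp (-(ν / (2 * u) * ∑ i, ((x j i - x l i) / θ (grp i)) ^ 2)))) (Set.Ioi 0) :=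
    fun j l => (integrableOn_profile hν (Finset.sum_nonneg fun _ _ => sq_nonneg _)).const_mul _
  simp_rw [gram_quad, mixQuad_eq]
  rw [integral_finsetSum _ fun j _ => integrable_finsetSum _ fun l _ => hint j l]
  simp_rw [integral_finsetSum _ fun l _ => hint _ l, integral_const_mul, matern_eq hν]
  rw [Finset.mul_sum]
  refine Finset.sum_congr rfl fun j _ => ?_
  rw [Finset.mul_sum]
  refine Finset.sum_congr rfl fun l _ => ?_
  rw [maternProfile, mul_left_comm]

lemma mixQuad_nonneg (hν : 0 < ν) (grp : Fin d → Fin m) {θ : Fin m → ℝ} (hθ : ∀ i, 0 < θ i)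
    {n : ℕ} (x : Fin n → EuclideanSpace ℝ (Fin d)) (c : Fin n → ℝ) {u : ℝ} (hu : 0 < u) :
    0 ≤ mixQuad ν grp θ x c u :=
  gaussian_quad_nonneg (a := fun i => ν / (2 * u * θ (grp i) ^ 2))
    (fun i => by have := hθ (grp i); positivity) (fun j i => x j i) c

lemma matern_psd (hν : 0 < ν) {var : ℝ} (hvar : 0 < var) (grp : Fin d → Fin m) {θ : Fin m → ℝ}
    (hθ : ∀ i, 0 < θ i) : IsPSDKernel (matern ν var grp θ) := by
  intro n x
  refine Matrix.PosSemidef.of_dotProduct_mulVec_nonneg ?_ fun c => ?_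
  · ext i j
    simp only [Matrix.conjTranspose_apply, gram, Matrix.of_apply, star_trivial, matern_eq hν]
    congr 2
    exact Finset.sum_congr rfl fun l _ => by ring
  · rw [star_trivial, matern_quad hν]
    have := Real.Gamma_pos_of_pos hν
    refine mul_nonneg (by positivity) (setIntegral_nonneg measurableSet_Ioi fun u hu => ?_)
    exact mul_nonneg (mixDensity_nonneg hu) (mixQuad_nonneg hν grp hθ x c hu)

/-- Matérn kernels with comparable lengthscales are comparable in the kernel order. -/
lemma matern_kernelLE (hν : 0 < ν) {var : ℝ} (hvar : 0 < var) (grp : Fin d → Fin m)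
    {θ θ' : Fin m → ℝ} (hθ : ∀ i, 0 < θ i) (hθ' : ∀ i, 0 < θ' i) {L : ℝ} (hL : 1 ≤ L)
    (h1 : ∀ i, θ i ≤ L * θ' i) (h2 : ∀ i, θ' i ≤ L * θ i) :
    KernelLE (matern ν var grp θ') (matern ν var grp θ) ((L ^ 2) ^ d * (L ^ 2) ^ ν) := by
  intro n x c
  have hL0 : 0 < L := by linarith
  -- Dividing u by L² makes each Gaussian of θ at least as narrow as the Gaussian of θ' at u, so
  -- that the two components can be compared.
  have hpt : ∀ u, 0 < u → mixQuad ν grp θ' x c u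
      ≤ (L ^ 2) ^ d * mixQuad ν grp θ x c ((L ^ 2)⁻¹ * u) := by
    intro u hu
    have hm := gaussian_quad_mono (a := fun i => ν / (2 * u * θ' (grp i) ^ 2))
      (b := fun i => ν / (2 * ((L ^ 2)⁻¹ * u) * θ (grp i) ^ 2))
      (fun i => by have := hθ' (grp i); positivity)
      (fun i => by
        have a1 := hθ' (grp i)
        have a2 := hθ (grp i)
        have a3 := h1 (grp i)
        refine div_le_div_of_nonneg_left hν.le (by positivity) ?_
        have : θ (grp i) ^ 2 ≤ (L * θ' (grp i)) ^ 2 := by gcongr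
        calc 2 * ((L ^ 2)⁻¹ * u) * θ (grp i) ^ 2 ≤ 2 * ((L ^ 2)⁻¹ * u) * (L * θ' (grp i)) ^ 2 := by
              gcongr
          _ = _ := by field_simp)
      (fun j i => x j i) c
    -- Per coordinate the squared ratio of the normalizations is L²θ'²/θ² ≤ L⁴, which accounts for
    -- the factor (L²)^d.
    have hp : ∏ i, √(4 * Real.pi * (ν / (2 * ((L ^ 2)⁻¹ * u) * θ (grp i) ^ 2)))
        ≤ (L ^ 2) ^ d * ∏ i : Fin d, √(4 * Real.pi * (ν / (2 * u * θ' (grp i) ^ 2))) := by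
      have : (L ^ 2) ^ d = ∏ _i : Fin d, L ^ 2 := by simp
      rw [this, ← Finset.prod_mul_distrib]
      refine Finset.prod_le_prod (fun i _ => Real.sqrt_nonneg _) fun i _ => ?_
      have a1 := hθ' (grp i)
      have a2 := hθ (grp i)
      have a3 := h2 (grp i)
      have e0 : ∀ z, L ^ 2 * √z = √((L ^ 2) ^ 2 * z) := fun z => by
        rw [Real.sqrt_mul (by positivity), Real.sqrt_sq (by positivity)]
      rw [e0]
      refine Real.sqrt_le_sqrt ?_
      have : θ' (grp i) ^ 2 ≤ (L * θ (grp i)) ^ 2 := by gcongr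
      have e1 : 4 * Real.pi * (ν / (2 * ((L ^ 2)⁻¹ * u) * θ (grp i) ^ 2))
          = 4 * Real.pi * ν / (2 * u) * (L ^ 2 / θ (grp i) ^ 2) := by
        field_simp
      have e2 : (L ^ 2) ^ 2 * (4 * Real.pi * (ν / (2 * u * θ' (grp i) ^ 2)))
          = 4 * Real.pi * ν / (2 * u) * ((L ^ 2) ^ 2 / θ' (grp i) ^ 2) := by
        field_simp
      rw [e1, e2]
      refine mul_le_mul_of_nonneg_left ?_ (by positivity)
      rw [div_le_div_iff₀ (by positivity) (by positivity)]
      nlinarith [sq_nonneg L]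
    have hq := mixQuad_nonneg hν grp hθ x c (u := (L ^ 2)⁻¹ * u) (by positivity)
    have hprod : 0 < ∏ i : Fin d, √(4 * Real.pi * (ν / (2 * u * θ' (grp i) ^ 2))) :=
      Finset.prod_pos fun i _ => by have := hθ' (grp i); positivity
    refine le_of_mul_le_mul_left ((hm.trans (mul_le_mul_of_nonneg_right hp hq)).trans_eq ?_) hprod
    rw [mixQuad]; ring
  have hsub : ∫ u in Set.Ioi (0 : ℝ), mixDensity ν u * mixQuad ν grp θ x c ((L ^ 2)⁻¹ * u)
      ≤ (L ^ 2) ^ ν * ∫ u in Set.Ioi (0 : ℝ), mixDensity ν u * mixQuad ν grp θ x c u := by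
    -- After substituting u = L²v, the power of the density gives (L²)^ν, and its exponential only
    -- decreases because L ≥ 1.
    have hdens : ∀ v, 0 < v → mixDensity ν (L ^ 2 * v) * L ^ 2 ≤ (L ^ 2) ^ ν * mixDensity ν v := by
      intro v hv
      have e : (L ^ 2 * v) ^ (ν - 1) * L ^ 2 = (L ^ 2) ^ ν * v ^ (ν - 1) := by
        rw [Real.mul_rpow (by positivity) hv.le, Real.rpow_sub_one (by positivity)]
        field_simp
      rw [mixDensity, mixDensity, mul_assoc, e]
      have h3 : Real.exp (-(L ^ 2 * v)) ≤ Real.exp (-v) := by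
        refine Real.exp_le_exp.2 (neg_le_neg ?_)
        exact le_mul_of_one_le_left hv.le (one_le_pow₀ hL)
      calc _ ≤ Real.exp (-v) * ((L ^ 2) ^ ν * v ^ (ν - 1)) := by gcongr
        _ = _ := by ring
    have hcv := integral_comp_mul_left_Ioi
      (fun u => mixDensity ν u * mixQuad ν grp θ x c ((L ^ 2)⁻¹ * u)) 0 (b := L ^ 2) (by positivity)
    rw [mul_zero, smul_eq_mul, eq_inv_mul_iff_mul_eq₀ (by positivity)] at hcv
    rw [← hcv, ← integral_const_mul, ← integral_const_mul]
    refine integral_mono_of_nonneg ?_ ((integrableOn_mixQuad hν grp θ x c).const_mul _) ?_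
    · refine (ae_restrict_mem measurableSet_Ioi).mono fun v hv => ?_
      have hv' : (0 : ℝ) < v := hv
      have h3 := mixDensity_nonneg (ν := ν) (u := L ^ 2 * v) (Set.mem_Ioi.2 (by positivity))
      have h4 := mixQuad_nonneg hν grp hθ x c (u := (L ^ 2)⁻¹ * (L ^ 2 * v)) (by positivity)
      simp only [Pi.zero_apply]
      positivity
    · refine (ae_restrict_mem measurableSet_Ioi).mono fun v hv => ?_
      have hv' : (0 : ℝ) < v := hv
      have e : (L ^ 2)⁻¹ * (L ^ 2 * v) = v := by field_simp
      have h4 := mixQuad_nonneg hν grp hθ x c hv'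
      simp only [e]
      calc _ = mixDensity ν (L ^ 2 * v) * L ^ 2 * mixQuad ν grp θ x c v := by ring
        _ ≤ (L ^ 2) ^ ν * mixDensity ν v * mixQuad ν grp θ x c v :=
            mul_le_mul_of_nonneg_right (hdens v hv') h4
        _ = _ := by ring
  -- Rescaling u by L⁻² is the same as dividing the lengthscales by L, so integrability needs no new
  -- estimate.
  have hsc : IntegrableOn (fun u => mixDensity ν u * mixQuad ν grp θ x c ((L ^ 2)⁻¹ * u))
      (Set.Ioi 0) := by
    have : ∀ u, mixQuad ν grp θ x c ((L ^ 2)⁻¹ * u) = mixQuad ν grp (fun i => θ i / L) x c u := by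
      intro u
      simp only [mixQuad]
      refine Finset.sum_congr rfl fun j _ => Finset.sum_congr rfl fun l _ => ?_
      congr 3
      refine Finset.sum_congr rfl fun i _ => ?_
      congr 2
      rw [div_pow]; field_simp
    simp_rw [this]
    exact integrableOn_mixQuad hν grp _ x c
  rw [matern_quad hν, matern_quad hν]
  have hΓ := Real.Gamma_pos_of_pos hν
  have hmono : ∫ u in Set.Ioi (0 : ℝ), mixDensity ν u * mixQuad ν grp θ' x c u
      ≤ (L ^ 2) ^ d * ∫ u in Set.Ioi (0 : ℝ),
          mixDensity ν u * mixQuad ν grp θ x c ((L ^ 2)⁻¹ * u) := by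
    rw [← integral_const_mul]
    refine setIntegral_mono_on (integrableOn_mixQuad hν grp θ' x c) (hsc.const_mul _)
      measurableSet_Ioi fun u hu => ?_
    calc _ ≤ mixDensity ν u * ((L ^ 2) ^ d * mixQuad ν grp θ x c ((L ^ 2)⁻¹ * u)) :=
          mul_le_mul_of_nonneg_left (hpt u hu) (mixDensity_nonneg hu)
      _ = _ := by ring
  calc _ ≤ var / Real.Gamma ν * ((L ^ 2) ^ d * ((L ^ 2) ^ ν *
        ∫ u in Set.Ioi (0 : ℝ), mixDensity ν u * mixQuad ν grp θ x c u)) := by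
        gcongr
        exact hmono.trans (mul_le_mul_of_nonneg_left hsub (by positivity))
    _ = _ := by ring

end Matern

/-! ### Uniform properties of the kernel family -/

section Family

variable {d m : ℕ} (P : Problem d m)

lemma Problem.exists_bounds :
    ∃ lo hi : ℝ, 0 < lo ∧ lo ≤ hi ∧ ∀ θ ∈ P.Θ, ∀ i, lo ≤ θ i ∧ θ i ≤ hi := by
  have h : ∀ i : Fin m, ∃ lo hi : ℝ, 0 < lo ∧ ∀ θ ∈ P.Θ, lo ≤ θ i ∧ θ i ≤ hi := by
    intro i
    have hc : ContinuousOn (fun θ : Fin m → ℝ => θ i) P.Θ := (continuous_apply i).continuousOn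
    obtain ⟨a, ha, hmin⟩ := P.Θ_compact.exists_isMinOn P.Θ_nonempty hc
    obtain ⟨b, hb, hmax⟩ := P.Θ_compact.exists_isMaxOn P.Θ_nonempty hc
    exact ⟨a i, b i, P.Θ_pos a ha i, fun θ hθ => ⟨hmin hθ, hmax hθ⟩⟩
  choose lo hi hlo hb using h
  obtain ⟨l, hl0, hl⟩ : ∃ l : ℝ, 0 < l ∧ ∀ i, l ≤ lo i := by
    rcases isEmpty_or_nonempty (Fin m) with he | he
    · exact ⟨1, one_pos, fun i => he.elim i⟩
    · obtain ⟨i, hi⟩ := Finite.exists_min lo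
      exact ⟨lo i, hlo i, hi⟩
  obtain ⟨u, hu⟩ : ∃ u : ℝ, ∀ i, hi i ≤ u := by
    obtain ⟨u, hu⟩ := (Set.finite_range hi).bddAbove
    exact ⟨u, fun i => hu ⟨i, rfl⟩⟩
  exact ⟨l, max l u, hl0, le_max_left _ _, fun θ hθ i =>
    ⟨(hl i).trans (hb i θ hθ).1, ((hb i θ hθ).2.trans (hu i)).trans (le_max_right _ _)⟩⟩

variable {P}

lemma Problem.ker_psd {θ : Fin m → ℝ} (hθ : θ ∈ P.Θ) : IsPSDKernel (P.ker θ) :=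
  matern_psd P.ν_pos P.var_pos P.grp (P.Θ_pos θ hθ)

lemma Problem.ker_nonneg (θ : Fin m → ℝ) (x x' : EuclideanSpace ℝ (Fin d)) :
    0 ≤ P.ker θ x x' := by
  have := Real.Gamma_pos_of_pos P.ν_pos
  have := P.var_pos
  rw [Problem.ker, matern_eq P.ν_pos]
  exact mul_nonneg (by positivity) (maternProfile_nonneg _)

lemma Problem.ker_le_one (θ : Fin m → ℝ) (x x' : EuclideanSpace ℝ (Fin d)) :
    P.ker θ x x' ≤ 1 := by
  have hΓ := Real.Gamma_pos_of_pos P.ν_pos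
  have hv := P.var_pos
  rw [Problem.ker, matern_eq P.ν_pos]
  calc _ ≤ P.var / Real.Gamma P.ν * Real.Gamma P.ν := by
        gcongr
        exact maternProfile_le P.ν_pos (Finset.sum_nonneg fun _ _ => sq_nonneg _)
    _ = P.var := by field_simp
    _ ≤ 1 := P.var_le_one

lemma Problem.measurable_ker (θ : Fin m → ℝ) :
    Measurable fun p : EuclideanSpace ℝ (Fin d) × EuclideanSpace ℝ (Fin d) => P.ker θ p.1 p.2 :=
  measurable_matern P.ν_pos P.var P.grp θ

variable (P) in
/-- Any two kernels of the family are comparable, with a common constant. -/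
lemma Problem.exists_kernelLE :
    ∃ b : ℝ, 1 ≤ b ∧ ∀ θ ∈ P.Θ, ∀ θ' ∈ P.Θ, KernelLE (P.ker θ') (P.ker θ) b := by
  obtain ⟨lo, hi, hlo, hle, hb⟩ := P.exists_bounds
  have hL : 1 ≤ hi / lo := (one_le_div hlo).2 hle
  have hcmp : ∀ θ ∈ P.Θ, ∀ θ' ∈ P.Θ, ∀ i, θ i ≤ hi / lo * θ' i := by
    intro θ hθ θ' hθ' i
    calc θ i ≤ hi := (hb θ hθ i).2
      _ = hi / lo * lo := by field_simp
      _ ≤ _ := by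
        have := (hb θ' hθ' i).1
        gcongr
  refine ⟨((hi / lo) ^ 2) ^ d * ((hi / lo) ^ 2) ^ P.ν, ?_, fun θ hθ θ' hθ' => ?_⟩
  · have h2 : 1 ≤ (hi / lo) ^ 2 := one_le_pow₀ hL
    exact one_le_mul_of_one_le_of_one_le (one_le_pow₀ h2) (Real.one_le_rpow h2 P.ν_pos.le)
  · exact matern_kernelLE P.ν_pos P.var_pos P.grp (P.Θ_pos θ hθ) (P.Θ_pos θ' hθ') hL
      (hcmp θ hθ θ' hθ') (hcmp θ' hθ' θ hθ)

variable (P) in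
/-- The kernels depend on the lengthscales in a Lipschitz way. -/
lemma Problem.exists_kdist_le :
    ∃ K : ℝ, 0 < K ∧ ∀ θ ∈ P.Θ, ∀ θ' ∈ P.Θ, ∀ h : ℝ, 0 ≤ h → (∀ i, |θ i - θ' i| ≤ h) →
      P.kdist θ θ' ≤ K * h := by
  obtain ⟨lo, hi, hlo, hle, hb⟩ := P.exists_bounds
  have hhi : 0 < hi := hlo.trans_le hle
  -- A change of h in a lengthscale changes its square by at most 2·hi·h, thus by the factor 1 + τ
  -- with τ = 2·hi·h/lo². Squared scaled distances change by at most the same factor, which is what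
  -- the profile estimate needs.
  refine ⟨2 * hi / lo ^ 2, by positivity, fun θ hθ θ' hθ' h hh hd => ?_⟩
  refine Real.iSup_le (fun q => ?_) (by positivity)
  have hΓ := Real.Gamma_pos_of_pos P.ν_pos
  have hv := P.var_pos
  set τ := 2 * hi / lo ^ 2 * h with hτ
  have hτ0 : 0 ≤ τ := by positivity
  have hterm : ∀ {θ θ' : Fin m → ℝ}, θ ∈ P.Θ → θ' ∈ P.Θ → (∀ i, |θ i - θ' i| ≤ h) →
      ∀ (t : Fin d → ℝ), ∑ i, (t i / θ (P.grp i)) ^ 2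
        ≤ (1 + τ) * ∑ i, (t i / θ' (P.grp i)) ^ 2 := by
    intro θ θ' hθ hθ' hd t
    rw [Finset.mul_sum]
    refine Finset.sum_le_sum fun i _ => ?_
    have a1 := hb θ hθ (P.grp i)
    have a2 := hb θ' hθ' (P.grp i)
    have a3 := hd (P.grp i)
    set u := θ (P.grp i)
    set v := θ' (P.grp i)
    have hu : 0 < u := by linarith
    have hv : 0 < v := by linarith
    have hvu : v ^ 2 ≤ (1 + τ) * u ^ 2 := by
      have h1 : v - u ≤ h := by have := (abs_le.1 a3).1; linarith
      have h2 : (v - u) * (v + u) ≤ h * (2 * hi) :=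
        mul_le_mul h1 (by linarith) (by linarith) hh
      have h3 : h * (2 * hi) = τ * lo ^ 2 := by rw [hτ]; field_simp
      have h4 : τ * lo ^ 2 ≤ τ * u ^ 2 := by gcongr; exact a1.1
      nlinarith
    rw [div_pow, div_pow, ← mul_div_assoc, div_le_div_iff₀ (by positivity) (by positivity)]
    nlinarith [mul_le_mul_of_nonneg_left hvu (sq_nonneg (t i))]
  rw [Problem.ker, Problem.ker, matern_eq P.ν_pos, matern_eq P.ν_pos, ← mul_sub, abs_mul,
    abs_of_pos (by positivity)]
  have := abs_maternProfile_sub_le P.ν_pos (Finset.sum_nonneg fun _ _ => sq_nonneg _)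
    (Finset.sum_nonneg fun _ _ => sq_nonneg _) hτ0
    (hterm hθ hθ' hd (fun i => (q.1 : EuclideanSpace ℝ (Fin d)) i - (q.2 : EuclideanSpace ℝ (Fin d)) i))
    (hterm hθ' hθ (fun i => by rw [abs_sub_comm]; exact hd i)
      (fun i => (q.1 : EuclideanSpace ℝ (Fin d)) i - (q.2 : EuclideanSpace ℝ (Fin d)) i))
  calc _ ≤ P.var / Real.Gamma P.ν * (τ * Real.Gamma P.ν) := by gcongr
    _ = P.var * τ := by field_simp
    _ ≤ 1 * τ := by gcongr; exact P.var_le_one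
    _ = τ := one_mul _

lemma Problem.abs_ker_sub_le (θ θ' : Fin m → ℝ) {x x' : EuclideanSpace ℝ (Fin d)} (hx : x ∈ P.X)
    (hx' : x' ∈ P.X) : |P.ker θ x x' - P.ker θ' x x'| ≤ P.kdist θ θ' := by
  refine le_ciSup (f := fun q : P.X × P.X => |P.ker θ q.1 q.2 - P.ker θ' q.1 q.2|) ⟨1, ?_⟩
    (⟨⟨x, hx⟩, ⟨x', hx'⟩⟩ : P.X × P.X)
  rintro _ ⟨q, rfl⟩
  have h1 := P.ker_nonneg θ q.1 q.2
  have h2 := P.ker_nonneg θ' q.1 q.2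
  have h3 := P.ker_le_one θ q.1 q.2
  have h4 := P.ker_le_one θ' q.1 q.2
  exact abs_le.2 ⟨by linarith, by linarith⟩

variable (P) in
/-- Covering numbers grow polynomially. -/
lemma Problem.exists_net :
    ∃ K : ℝ, 1 ≤ K ∧ ∀ ε : ℝ, 0 < ε → ε ≤ 1 →
      ∃ s : Finset (Fin m → ℝ), P.IsNet ε ↑s ∧ (s.card : ℝ) ≤ (K / ε) ^ m := by
  obtain ⟨lo, hi, hlo, hle, hb⟩ := P.exists_bounds
  obtain ⟨K, hK, hlip⟩ := P.exists_kdist_le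
  have hhi : 0 < hi := hlo.trans_le hle
  refine ⟨hi * K + 2, by nlinarith [mul_pos hhi hK], fun ε hε hε1 => ?_⟩
  set h := ε / K with hh
  have hh0 : 0 < h := by positivity
  set M := ⌈hi / h⌉₊ with hM
  -- Grid cells of side h = ε/K. The minimum with M only makes the index well typed; it is inactive
  -- on Θ.
  let cell : (Fin m → ℝ) → Fin m → Fin (M + 1) := fun θ i =>
    ⟨min ⌊θ i / h⌋₊ M, by omega⟩
  classical
  -- Net centres must lie in Θ, so each occupied cell is represented by one of its members; empty
  -- cells receive an arbitrary point of Θ.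
  let rep : (Fin m → Fin (M + 1)) → Fin m → ℝ := fun z =>
    if hz : ∃ θ ∈ P.Θ, cell θ = z then hz.choose else P.Θ_nonempty.some
  have hrep : ∀ z, rep z ∈ P.Θ := by
    intro z
    by_cases hz : ∃ θ ∈ P.Θ, cell θ = z
    · simp only [rep, dif_pos hz]; exact hz.choose_spec.1
    · simp only [rep, dif_neg hz]; exact P.Θ_nonempty.some_mem
  have hrep' : ∀ θ ∈ P.Θ, cell (rep (cell θ)) = cell θ := by
    intro θ hθ
    have hz : ∃ θ' ∈ P.Θ, cell θ' = cell θ := ⟨θ, hθ, rfl⟩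
    simp only [rep, dif_pos hz]; exact hz.choose_spec.2
  have hfl : ∀ θ ∈ P.Θ, ∀ i, ⌊θ i / h⌋₊ ≤ M := by
    intro θ hθ i
    have h1 : θ i / h ≤ hi / h := by gcongr; exact (hb θ hθ i).2
    have h2 : (⌊θ i / h⌋₊ : ℝ) ≤ M :=
      (Nat.floor_le (div_nonneg (hlo.le.trans (hb θ hθ i).1) hh0.le)).trans (h1.trans (Nat.le_ceil _))
    exact_mod_cast h2
  refine ⟨Finset.univ.image rep, ⟨?_, fun θ hθ => ⟨rep (cell θ), by simp, ?_⟩⟩, ?_⟩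
  · intro θ hθ
    simp only [Finset.coe_image, Finset.coe_univ, Set.image_univ, Set.mem_range] at hθ
    obtain ⟨z, rfl⟩ := hθ
    exact hrep z
  · have : K * h = ε := by rw [hh]; field_simp
    rw [← this]
    refine hlip θ hθ _ (hrep _) h hh0.le fun i => ?_
    have e := congrArg Fin.val (congrFun (hrep' θ hθ) i)
    simp only [cell] at e
    rw [min_eq_left (hfl _ (hrep _) i), min_eq_left (hfl θ hθ i)] at e
    set θ' := rep (cell θ)
    have p1 := hlo.trans_le (hb θ hθ i).1
    have p2 := hlo.trans_le (hb θ' (hrep _) i).1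
    have a1 := Nat.floor_le (show 0 ≤ θ i / h by positivity)
    have a2 := Nat.lt_floor_add_one (θ i / h)
    have a3 := Nat.floor_le (show 0 ≤ θ' i / h by positivity)
    have a4 := Nat.lt_floor_add_one (θ' i / h)
    rw [e] at a3 a4
    have b1 : |θ i / h - θ' i / h| ≤ 1 := abs_le.2 ⟨by linarith, by linarith⟩
    rwa [← sub_div, abs_div, abs_of_pos hh0, div_le_one hh0] at b1
  · have h1 : ((Finset.univ.image rep).card : ℝ) ≤ ((M : ℝ) + 1) ^ m := by
      have : (Finset.univ.image rep).card ≤ (M + 1) ^ m :=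
        Finset.card_image_le.trans (by simp)
      exact_mod_cast this
    refine h1.trans ?_
    have h2 : (M : ℝ) < hi / h + 1 := Nat.ceil_lt_add_one (by positivity)
    have h3 : hi / h = hi * K / ε := by rw [hh]; field_simp
    have h4 : (2 : ℝ) ≤ 2 / ε := by rw [le_div_iff₀ hε]; linarith
    gcongr
    rw [add_div]
    linarith

/-- Finite nets exist, so the infimum of cardinalities is attained rather than being the default
value of an empty set. -/
lemma Problem.exists_min_net {ε : ℝ} (hε : 0 < ε) (hε1 : ε ≤ 1) :
    ∃ s : Finset (Fin m → ℝ), P.IsNet ε ↑s ∧ s.card = P.covNum ε := by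
  obtain ⟨K, -, h⟩ := P.exists_net
  obtain ⟨s, hs, -⟩ := h ε hε hε1
  exact Nat.sInf_mem (s := {n : ℕ | ∃ s : Finset (Fin m → ℝ), P.IsNet ε ↑s ∧ s.card = n})
    ⟨s.card, s, hs, rfl⟩

lemma Problem.one_le_covNum {ε : ℝ} (hε : 0 < ε) (hε1 : ε ≤ 1) : 1 ≤ P.covNum ε := by
  obtain ⟨s, hs, hc⟩ := P.exists_min_net hε hε1
  obtain ⟨θ, hθ⟩ := P.Θ_nonempty
  obtain ⟨θ', hθ', -⟩ := hs.2 θ hθ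
  rw [← hc]
  exact Finset.card_pos.2 ⟨θ', hθ'⟩

variable (P) in
lemma Problem.exists_covNum_le :
    ∃ K : ℝ, 1 ≤ K ∧ ∀ ε : ℝ, 0 < ε → ε ≤ 1 → (P.covNum ε : ℝ) ≤ (K / ε) ^ m := by
  obtain ⟨K, hK, h⟩ := P.exists_net
  refine ⟨K, hK, fun ε hε hε1 => ?_⟩
  obtain ⟨s, hs, hc⟩ := h ε hε hε1
  refine le_trans ?_ hc
  exact_mod_cast Nat.sInf_le
    (show s.card ∈ {n : ℕ | ∃ s : Finset (Fin m → ℝ), P.IsNet ε ↑s ∧ s.card = n} from ⟨s, hs, rfl⟩)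

/-! ### Information gain of the family -/

variable {σ : ℝ}

lemma Problem.gain_le (hσ : 1 ≤ σ) (n : ℕ) {θ : Fin m → ℝ} (hθ : θ ∈ P.Θ) :
    P.gain σ n θ ≤ n / 2 :=
  maxInfoGain_le (P.ker_psd hθ) (fun _ => P.ker_le_one _ _ _) hσ _ _

lemma Problem.gain_nonneg (hσ : 1 ≤ σ) (n : ℕ) {θ : Fin m → ℝ} (hθ : θ ∈ P.Θ) :
    0 ≤ P.gain σ n θ :=
  maxInfoGain_nonneg (P.ker_psd hθ) (fun _ => P.ker_le_one _ _ _) hσ _ _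

lemma Problem.gain_le_supGain (hσ : 1 ≤ σ) (n : ℕ) {θ : Fin m → ℝ} (hθ : θ ∈ P.Θ) :
    P.gain σ n θ ≤ P.supGain σ n := by
  refine le_ciSup (f := fun θ : P.Θ => P.gain σ n θ) ⟨n / 2, ?_⟩ ⟨θ, hθ⟩
  rintro _ ⟨θ, rfl⟩
  exact P.gain_le hσ n θ.2

lemma Problem.infoGain_le_supGain (hσ : 1 ≤ σ) {n : ℕ} {θ : Fin m → ℝ} (hθ : θ ∈ P.Θ)
    (x : Fin n → EuclideanSpace ℝ (Fin d)) (hx : ∀ i, x i ∈ P.X) :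
    infoGain (P.ker θ) σ x ≤ P.supGain σ n :=
  (infoGain_le_maxInfoGain (P.ker_psd hθ) (fun _ => P.ker_le_one _ _ _) hσ x hx).trans
    (P.gain_le_supGain hσ n hθ)

lemma Problem.supGain_nonneg (hσ : 1 ≤ σ) (n : ℕ) : 0 ≤ P.supGain σ n :=
  Real.iSup_nonneg fun θ => P.gain_nonneg hσ n θ.2

lemma Problem.supGain_mono (hσ : 1 ≤ σ) : Monotone (P.supGain σ) := fun _ _ hnn' =>
  Real.iSup_le (fun θ => (maxInfoGain_mono (P.ker_psd θ.2) (fun _ => P.ker_le_one _ _ _) hσ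
    P.X_nonempty hnn').trans (P.gain_le_supGain hσ _ θ.2)) (P.supGain_nonneg hσ _)

end Family

/-! ### Functions in the ball of a reproducing kernel Hilbert space -/

-- Reproducing property and Cauchy–Schwarz against ∑ cⱼ k(xⱼ, ·). This finite-point inequality
-- carries all the information about the norm of f that the confidence bound needs.
open Matrix in
lemma InRKHSBall.sq_dotProduct_le {E : Type} {X : Set E} {k : E → E → ℝ} {B : ℝ} {f : E → ℝ}
    (hf : InRKHSBall X k B f) {n : ℕ} (x : Fin n → E) (hx : ∀ i, x i ∈ X)
    (c : Fin n → ℝ) :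
    (c ⬝ᵥ fun i => f (x i)) ^ 2 ≤ B ^ 2 * (c ⬝ᵥ gram k x *ᵥ c) := by
  obtain ⟨H, _, _, _, _, hker, h, hh, hn⟩ := hf
  let g : H := ∑ j, c j • RKHS.kerFun H (⟨x j, hx j⟩ : X) (1 : ℝ)
  have h1 : inner ℝ g h = c ⬝ᵥ fun i => f (x i) := by
    simp only [g, sum_inner, real_inner_smul_left, RKHS.kerFun_inner, dotProduct]
    refine Finset.sum_congr rfl fun j _ => ?_
    rw [hh]; simp
  have h2 : ‖g‖ ^ 2 = c ⬝ᵥ gram k x *ᵥ c := by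
    rw [← real_inner_self_eq_norm_sq, gram_quad]
    simp only [g, sum_inner, inner_sum, real_inner_smul_left, real_inner_smul_right,
      RKHS.kerFun_inner, RKHS.kerFun_apply]
    rw [Finset.sum_comm]
    refine Finset.sum_congr rfl fun j _ => Finset.sum_congr rfl fun l _ => ?_
    rw [hker]
    simp
    ring
  rw [← h1, ← h2]
  have h3 := abs_real_inner_le_norm g h
  rw [← sq_abs, ← mul_pow]
  gcongr
  calc _ ≤ ‖g‖ * ‖h‖ := h3
    _ ≤ ‖g‖ * B := by gcongr
    _ = _ := mul_comm _ _

/-! ### Conditionally sub-Gaussian noise -/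

section SubGaussian

open scoped ENNReal

variable {Ω : Type*} {m mΩ : MeasurableSpace Ω} {μ : Measure Ω}

/-- On the smaller σ-algebra the measure with density g is dominated by b·μ; integrating W against
both gives the claim. Working with extended nonnegative integrals spares any integrability of W·g.
-/
lemma lintegral_mul_exp_le [IsProbabilityMeasure μ] (hm : m ≤ mΩ) {g : Ω → ℝ} (hg : Measurable g) (hg0 : ∀ ω, 0 ≤ g ω)
    (hint : Integrable g μ) {b : ℝ} (hb : 0 ≤ b) (hle : μ[g | m] ≤ᵐ[μ] fun _ => b)
    {W : Ω → ℝ≥0∞} (hW : Measurable[m] W) :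
    ∫⁻ ω, W ω * ENNReal.ofReal (g ω) ∂μ ≤ ENNReal.ofReal b * ∫⁻ ω, W ω ∂μ := by
  have hgm : Measurable fun ω => ENNReal.ofReal (g ω) := hg.ennreal_ofReal
  have hmeas : (μ.withDensity fun ω => ENNReal.ofReal (g ω)).trim hm
      ≤ ENNReal.ofReal b • μ.trim hm := by
    refine Measure.le_iff.2 fun A hA => ?_
    rw [trim_measurableSet_eq hm hA, withDensity_apply _ (hm A hA), Measure.smul_apply,
      trim_measurableSet_eq hm hA, smul_eq_mul,
      ← ofReal_integral_eq_lintegral_ofReal hint.integrableOn (ae_of_all _ hg0),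
      ← setIntegral_condExp hm hint hA]
    have h1 : ∫ ω in A, (μ[g | m]) ω ∂μ ≤ ∫ _ in A, b ∂μ :=
      setIntegral_mono_ae integrable_condExp.integrableOn (integrable_const b).integrableOn hle
    refine (ENNReal.ofReal_le_ofReal h1).trans ?_
    rw [setIntegral_const, smul_eq_mul, mul_comm, ENNReal.ofReal_mul hb, measureReal_def,
      ENNReal.ofReal_toReal (measure_ne_top _ _)]
  have hW' : Measurable W := hW.mono hm le_rfl
  calc ∫⁻ ω, W ω * ENNReal.ofReal (g ω) ∂μ
      = ∫⁻ ω, W ω ∂(μ.withDensity fun ω => ENNReal.ofReal (g ω)) := by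
        rw [lintegral_withDensity_eq_lintegral_mul _ hgm hW']
        exact lintegral_congr fun ω => mul_comm _ _
    _ = ∫⁻ ω, W ω ∂((μ.withDensity fun ω => ENNReal.ofReal (g ω)).trim hm) :=
        (lintegral_trim hm hW).symm
    _ ≤ ∫⁻ ω, W ω ∂(ENNReal.ofReal b • μ.trim hm) := lintegral_mono' hmeas le_rfl
    _ = _ := by rw [lintegral_smul_measure, lintegral_trim hm hW, smul_eq_mul]

/-- The exponential moment bound with a random, conditionally constant parameter. -/
lemma lintegral_mul_exp_random_le [IsProbabilityMeasure μ] (hm : m ≤ mΩ) {e : Ω → ℝ} (he : Measurable e) {R : ℝ}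
    (hint : ∀ s : ℝ, Integrable (fun ω => Real.exp (s * e ω)) μ)
    (hle : ∀ s : ℝ, μ[fun ω => Real.exp (s * e ω) | m] ≤ᵐ[μ] fun _ => Real.exp (s ^ 2 * R ^ 2 / 2))
    {W : Ω → ℝ≥0∞} (hW : Measurable[m] W) {H : Ω → ℝ} (hH : Measurable[m] H) :
    ∫⁻ ω, W ω * ENNReal.ofReal (Real.exp (H ω * e ω - H ω ^ 2 * R ^ 2 / 2)) ∂μ
      ≤ ∫⁻ ω, W ω ∂μ := by
  have hW' : Measurable W := hW.mono hm le_rfl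
  -- H is rounded down to multiples of 1/(k + 1). On each of the countably many level sets the
  -- parameter is constant, so the fixed-parameter bound applies; Fatou then removes the rounding.
  let Z : ℕ → Ω → ℤ := fun k ω => ⌊(k + 1 : ℝ) * H ω⌋
  have hZ : ∀ k, Measurable[m] (Z k) := fun k => Int.measurable_floor.comp (hH.const_mul _)
  have hconst : ∀ (s : ℝ) {V : Ω → ℝ≥0∞}, Measurable[m] V →
      ∫⁻ ω, V ω * ENNReal.ofReal (Real.exp (s * e ω - s ^ 2 * R ^ 2 / 2)) ∂μ ≤ ∫⁻ ω, V ω ∂μ := by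
    intro s V hV
    have h1 := lintegral_mul_exp_le hm (he.const_mul s).exp (fun ω => (Real.exp_pos _).le)
      (hint s) (Real.exp_pos _).le (hle s) hV
    have e1 : ∀ ω, V ω * ENNReal.ofReal (Real.exp (s * e ω - s ^ 2 * R ^ 2 / 2))
        = ENNReal.ofReal (Real.exp (-(s ^ 2 * R ^ 2 / 2))) *
          (V ω * ENNReal.ofReal (Real.exp (s * e ω))) := by
      intro ω
      rw [sub_eq_add_neg, Real.exp_add, ENNReal.ofReal_mul (Real.exp_pos _).le]
      ring
    simp_rw [e1]
    rw [lintegral_const_mul' _ _ ENNReal.ofReal_ne_top]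
    calc _ ≤ ENNReal.ofReal (Real.exp (-(s ^ 2 * R ^ 2 / 2))) *
          (ENNReal.ofReal (Real.exp (s ^ 2 * R ^ 2 / 2)) * ∫⁻ ω, V ω ∂μ) := by gcongr
      _ = ∫⁻ ω, V ω ∂μ := by
        rw [← mul_assoc, ← ENNReal.ofReal_mul (Real.exp_pos _).le, ← Real.exp_add]
        simp
  have hstep : ∀ k : ℕ, ∫⁻ ω, W ω * ENNReal.ofReal (Real.exp
      (((Z k ω : ℝ) / (k + 1)) * e ω - ((Z k ω : ℝ) / (k + 1)) ^ 2 * R ^ 2 / 2)) ∂μ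
      ≤ ∫⁻ ω, W ω ∂μ := by
    intro k
    let V : ℤ → Ω → ℝ≥0∞ := fun z => (Z k ⁻¹' {z}).indicator W
    have hV : ∀ z, Measurable[m] (V z) := fun z =>
      hW.indicator (hZ k (measurableSet_singleton z))
    have hsingle : ∀ (F : ℤ → ℝ≥0∞) (ω : Ω), ∑' z, V z ω * F z = W ω * F (Z k ω) := by
      intro F ω
      rw [tsum_eq_single (Z k ω)]
      · simp [V]
      · intro z hz
        have : ω ∉ Z k ⁻¹' {z} := fun h => hz (by simpa using h.symm)
        simp [V, Set.indicator_of_notMem this]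
    have h1 : ∀ ω, W ω * ENNReal.ofReal (Real.exp
        (((Z k ω : ℝ) / (k + 1)) * e ω - ((Z k ω : ℝ) / (k + 1)) ^ 2 * R ^ 2 / 2))
        = ∑' z : ℤ, V z ω * ENNReal.ofReal (Real.exp
          (((z : ℝ) / (k + 1)) * e ω - ((z : ℝ) / (k + 1)) ^ 2 * R ^ 2 / 2)) := fun ω =>
      (hsingle (fun z => ENNReal.ofReal (Real.exp
          (((z : ℝ) / (k + 1)) * e ω - ((z : ℝ) / (k + 1)) ^ 2 * R ^ 2 / 2))) ω).symm
    have h2 : ∀ ω, W ω = ∑' z : ℤ, V z ω := fun ω => by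
      have := hsingle (fun _ => 1) ω
      simpa using this.symm
    simp_rw [h1]
    rw [lintegral_tsum, lintegral_congr h2, lintegral_tsum]
    · exact ENNReal.tsum_le_tsum fun z => hconst _ (hV z)
    · exact fun z => ((hV z).mono hm le_rfl).aemeasurable
    · refine fun z => (((hV z).mono hm le_rfl).mul ?_).aemeasurable
      exact ((he.const_mul _).sub_const _).exp.ennreal_ofReal
  have hlim : ∀ ω, Tendsto (fun k : ℕ => (Z k ω : ℝ) / (k + 1)) atTop (𝓝 (H ω)) := by
    intro ω
    have h0 : Tendsto (fun k : ℕ => 1 / ((k : ℝ) + 1)) atTop (𝓝 0) :=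
      tendsto_one_div_add_atTop_nhds_zero_nat
    refine tendsto_of_tendsto_of_tendsto_of_le_of_le (g := fun k : ℕ => H ω - 1 / ((k : ℝ) + 1))
      (h := fun _ => H ω) (by simpa using tendsto_const_nhds.sub h0) tendsto_const_nhds ?_ ?_
    · intro k
      have hk : (0 : ℝ) < k + 1 := by positivity
      have := Int.lt_floor_add_one ((k + 1 : ℝ) * H ω)
      dsimp only [Z]
      rw [sub_le_iff_le_add, ← add_div, le_div_iff₀ hk]
      linarith
    · intro k
      have hk : (0 : ℝ) < k + 1 := by positivity
      have := Int.floor_le ((k + 1 : ℝ) * H ω)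
      dsimp only [Z]
      rw [div_le_iff₀ hk]
      linarith
  have hfatou := lintegral_liminf_le (μ := μ) (u := atTop) (f := fun (k : ℕ) ω => W ω * ENNReal.ofReal (Real.exp
      (((Z k ω : ℝ) / (k + 1)) * e ω - ((Z k ω : ℝ) / (k + 1)) ^ 2 * R ^ 2 / 2))) (by
    intro k
    have hzk : Measurable fun ω => (Z k ω : ℝ) / (k + 1) :=
      ((measurable_from_top (f := fun z : ℤ => (z : ℝ))).comp ((hZ k).mono hm le_rfl)).div_const _
    exact hW'.mul (((hzk.mul he).sub (((hzk.pow_const 2).mul_const _).div_const _)).exp.ennreal_ofReal))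
  calc _ = ∫⁻ ω, liminf (fun k : ℕ => W ω * ENNReal.ofReal (Real.exp
      (((Z k ω : ℝ) / (k + 1)) * e ω - ((Z k ω : ℝ) / (k + 1)) ^ 2 * R ^ 2 / 2))) atTop ∂μ := by
        refine lintegral_congr fun ω => (Tendsto.liminf_eq ?_).symm
        refine ENNReal.Tendsto.const_mul ?_ (Or.inl ?_)
        · refine ENNReal.tendsto_ofReal ((Real.continuous_exp.tendsto _).comp ?_)
          exact ((hlim ω).mul_const _).sub ((((hlim ω).pow 2).mul_const _).div_const _)
        · simp [Real.exp_pos]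
    _ ≤ _ := hfatou
    _ ≤ ∫⁻ ω, W ω ∂μ := by
        refine liminf_le_of_le (by isBoundedDefault) fun b hb => ?_
        obtain ⟨k, hk⟩ := hb.exists
        exact hk.trans (hstep k)

/-- The likelihood ratio factor of the method of mixtures. -/
def mixFactor (σ R e a v : ℝ) : ℝ :=
  Real.exp ((e ^ 2 - σ ^ 2 * (e - a) ^ 2 / (v + σ ^ 2)) / (2 * R ^ 2)) * (√(1 + v / σ ^ 2))⁻¹

/-- The exponential tilt is drawn from a normal law with mean a/R² and variance v/(σR)². Completing
the square in z leaves the density of another normal law, of integral one, times the factor. For the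
posterior mean a and variance v of the noise, this is a one-step version of the mixture over a
Gaussian process, so no n-dimensional Gaussian integral is needed. -/
lemma mixFactor_eq_lintegral {σ R : ℝ} (hσ : 0 < σ) (hR : 0 < R) (e a : ℝ) {v : ℝ} (hv : 0 ≤ v) :
    ENNReal.ofReal (mixFactor σ R e a v) = ∫⁻ z, ENNReal.ofReal (Real.exp
      ((a / R ^ 2 + √v / (σ * R) * z) * e - (a / R ^ 2 + √v / (σ * R) * z) ^ 2 * R ^ 2 / 2))
        * gaussianPDF 0 1 z := by
  set τ := √v / σ with hτ
  have hv' : v = σ ^ 2 * τ ^ 2 := by rw [hτ, div_pow, Real.sq_sqrt hv]; field_simp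
  have hs : 0 < 1 + τ ^ 2 := by positivity
  set q : NNReal := Real.toNNReal (1 + τ ^ 2)⁻¹ with hq
  have hqc : (q : ℝ) = (1 + τ ^ 2)⁻¹ := Real.coe_toNNReal _ (by positivity)
  have hq0 : q ≠ 0 := (Real.toNNReal_pos.2 (by positivity)).ne'
  have hF : mixFactor σ R e a v = Real.exp ((e ^ 2 - (e - a) ^ 2 / (1 + τ ^ 2)) / (2 * R ^ 2))
      * (√(1 + τ ^ 2))⁻¹ := by
    rw [mixFactor, hv']
    congr 3
    · field_simp; ring
    · congr 1; field_simp
  have hpt : ∀ z, ENNReal.ofReal (Real.exp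
      ((a / R ^ 2 + √v / (σ * R) * z) * e - (a / R ^ 2 + √v / (σ * R) * z) ^ 2 * R ^ 2 / 2))
        * gaussianPDF 0 1 z = ENNReal.ofReal (mixFactor σ R e a v)
          * gaussianPDF (τ * (e - a) / (R * (1 + τ ^ 2))) q z := by
    intro z
    have hτR : √v / (σ * R) = τ / R := by rw [hτ]; field_simp
    rw [gaussianPDF, gaussianPDF, ← ENNReal.ofReal_mul (Real.exp_pos _).le,
      ← ENNReal.ofReal_mul (by unfold mixFactor; positivity), hF, hτR]
    congr 1
    simp only [gaussianPDFReal, hqc, NNReal.coe_one]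
    have e1 : √(2 * Real.pi * (1 + τ ^ 2)⁻¹) = √(2 * Real.pi) * (√(1 + τ ^ 2))⁻¹ := by
      rw [Real.sqrt_mul (by positivity), Real.sqrt_inv]
    have h3 : 0 < √(1 + τ ^ 2) := Real.sqrt_pos.2 hs
    have h4 : 0 < √(2 * Real.pi) := by positivity
    rw [e1, mul_one, mul_one]
    have e2 : ((a / R ^ 2 + τ / R * z) * e - (a / R ^ 2 + τ / R * z) ^ 2 * R ^ 2 / 2)
        + -(z - 0) ^ 2 / 2 = (e ^ 2 - (e - a) ^ 2 / (1 + τ ^ 2)) / (2 * R ^ 2)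
        + -(z - τ * (e - a) / (R * (1 + τ ^ 2))) ^ 2 / (2 * (1 + τ ^ 2)⁻¹) := by
      field_simp
      ring
    calc _ = (√(2 * Real.pi))⁻¹ * Real.exp (((a / R ^ 2 + τ / R * z) * e
            - (a / R ^ 2 + τ / R * z) ^ 2 * R ^ 2 / 2) + -(z - 0) ^ 2 / 2) := by
          rw [Real.exp_add]; ring
      _ = _ := by
          rw [e2, Real.exp_add]
          field_simp
  simp_rw [hpt]
  rw [lintegral_const_mul _ (measurable_gaussianPDF _ _), lintegral_gaussianPDF_eq_one _ hq0,
    mul_one]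

/-- One step of the mixture supermartingale. -/
lemma lintegral_mul_mixFactor_le [IsProbabilityMeasure μ] (hm : m ≤ mΩ) {e : Ω → ℝ} (he : Measurable e) {R σ : ℝ}
    (hR : 0 < R) (hσ : 0 < σ)
    (hint : ∀ s : ℝ, Integrable (fun ω => Real.exp (s * e ω)) μ)
    (hle : ∀ s : ℝ, μ[fun ω => Real.exp (s * e ω) | m] ≤ᵐ[μ] fun _ => Real.exp (s ^ 2 * R ^ 2 / 2))
    {W : Ω → ℝ≥0∞} (hW : Measurable[m] W) {a v : Ω → ℝ} (ha : Measurable[m] a)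
    (hv : Measurable[m] v) (hv0 : ∀ ω, 0 ≤ v ω) :
    ∫⁻ ω, W ω * ENNReal.ofReal (mixFactor σ R (e ω) (a ω) (v ω)) ∂μ ≤ ∫⁻ ω, W ω ∂μ := by
  have hW' : Measurable W := hW.mono hm le_rfl
  have ha' : Measurable a := ha.mono hm le_rfl
  have hv' : Measurable v := hv.mono hm le_rfl
  let H : Ω → ℝ → ℝ := fun ω z => a ω / R ^ 2 + √(v ω) / (σ * R) * z
  have hHm : Measurable fun p : Ω × ℝ => H p.1 p.2 :=
    ((ha'.comp measurable_fst).div_const _).add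
      ((((hv'.comp measurable_fst).sqrt).div_const _).mul measurable_snd)
  let G : Ω → ℝ → ℝ≥0∞ := fun ω z => W ω * (ENNReal.ofReal (Real.exp
      (H ω z * e ω - H ω z ^ 2 * R ^ 2 / 2)) * gaussianPDF 0 1 z)
  have hE : Measurable fun p : Ω × ℝ => ENNReal.ofReal (Real.exp
      (H p.1 p.2 * e p.1 - H p.1 p.2 ^ 2 * R ^ 2 / 2)) :=
    ((hHm.mul (he.comp measurable_fst)).sub
      (((hHm.pow_const 2).mul_const _).div_const _)).exp.ennreal_ofReal
  have hG : Measurable (Function.uncurry G) :=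
    (hW'.comp measurable_fst).mul (hE.mul ((measurable_gaussianPDF 0 1).comp measurable_snd))
  calc _ = ∫⁻ ω, ∫⁻ z, G ω z ∂volume ∂μ := by
        refine lintegral_congr fun ω => ?_
        rw [mixFactor_eq_lintegral hσ hR _ _ (hv0 ω), lintegral_const_mul]
        exact (hE.comp measurable_prodMk_left).mul (measurable_gaussianPDF 0 1)
    -- By Tonelli z may be frozen first; the tilt is then measurable for the past and the one-step
    -- moment bound applies.
    _ = ∫⁻ z, ∫⁻ ω, G ω z ∂μ ∂volume := lintegral_lintegral_swap hG.aemeasurable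
    _ ≤ ∫⁻ z, gaussianPDF 0 1 z * ∫⁻ ω, W ω ∂μ ∂volume := by
        refine lintegral_mono fun z => ?_
        have e1 : ∀ ω, G ω z = gaussianPDF 0 1 z * (W ω * ENNReal.ofReal (Real.exp
            (H ω z * e ω - H ω z ^ 2 * R ^ 2 / 2))) := fun ω => by simp only [G]; ring
        simp_rw [e1]
        rw [lintegral_const_mul' _ _ gaussianPDF_ne_top]
        refine mul_le_mul' le_rfl ?_
        exact lintegral_mul_exp_random_le hm he hint hle hW (H := fun ω => H ω z)
          ((ha.div_const _).add (((hv.sqrt).div_const _).mul_const _))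
    _ = ∫⁻ ω, W ω ∂μ := by
        rw [lintegral_mul_const _ (measurable_gaussianPDF 0 1),
          lintegral_gaussianPDF_eq_one _ one_ne_zero, one_mul]

/-- Ville's maximal inequality on a finite horizon. -/
lemma mul_measure_exists_ge_le {ℱ : Filtration ℕ mΩ} {M : ℕ → Ω → ℝ≥0∞} {T : ℕ}
    (hM : ∀ n ≤ T, Measurable[ℱ n] (M n)) (h0 : ∫⁻ ω, M 0 ω ∂μ ≤ 1)
    (hstep : ∀ n < T, ∀ A, MeasurableSet[ℱ n] A →
      ∫⁻ ω in A, M (n + 1) ω ∂μ ≤ ∫⁻ ω in A, M n ω ∂μ) (b : ℝ≥0∞) :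
    b * μ {ω | ∃ n ≤ T, b ≤ M n ω} ≤ 1 := by
  let A : ℕ → Set Ω := fun n => {ω | ∃ j ≤ n, b ≤ M j ω}
  have hA : ∀ n ≤ T, MeasurableSet[ℱ n] (A n) := by
    intro n hn
    have : A n = ⋃ j ∈ Finset.range (n + 1), {ω | b ≤ M j ω} := by
      ext ω; simp [A]
    rw [this]
    refine Finset.measurableSet_biUnion _ fun j hj => ?_
    have hj' : j ≤ n := by simpa [Nat.lt_succ_iff] using hj
    have : Measurable[ℱ n] (M j) := (hM j (hj'.trans hn)).mono (ℱ.mono hj') le_rfl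
    exact this measurableSet_Ici
  -- The process stopped at its first crossing of b: mass at least b is retained on paths that have
  -- crossed, and the current value is kept on the others. This total never increases.
  have key : ∀ n ≤ T, b * μ (A n) + ∫⁻ ω in (A n)ᶜ, M n ω ∂μ ≤ 1 := by
    intro n
    induction n with
    | zero =>
      intro hn
      have hA0 := ℱ.le 0 _ (hA 0 hn)
      refine le_trans ?_ h0
      rw [← lintegral_add_compl (μ := μ) (M 0) hA0]
      refine add_le_add ?_ le_rfl
      have : A 0 ⊆ {ω | b ≤ M 0 ω} := fun ω ⟨j, hj, h⟩ => by
        rw [Nat.le_zero.1 hj] at h; exact h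
      calc b * μ (A 0) = ∫⁻ _ in A 0, b ∂μ := by rw [setLIntegral_const]
        _ ≤ _ := setLIntegral_mono' hA0 fun ω hω => this hω
    | succ n ih =>
      intro hn
      have ih := ih (by omega)
      have hAn := hA n (by omega)
      have hAn' := ℱ.le n _ hAn
      have hAs := ℱ.le _ _ (hA (n + 1) hn)
      have hsub : A n ⊆ A (n + 1) := fun ω ⟨j, hj, h⟩ => ⟨j, by omega, h⟩
      have hnew : ∀ ω ∈ A (n + 1) \ A n, b ≤ M (n + 1) ω := by
        rintro ω ⟨⟨j, hj, h⟩, hnot⟩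
        rcases Nat.lt_or_ge n j with h' | h'
        · rwa [show j = n + 1 by omega] at h
        · exact absurd ⟨j, h', h⟩ hnot
      have h1 := hstep n (by omega) _ hAn.compl
      have hsplit : (A n)ᶜ = (A (n + 1) \ A n) ∪ (A (n + 1))ᶜ := by
        ext ω
        simp only [Set.mem_compl_iff, Set.mem_union, Set.mem_sdiff]
        constructor
        · intro h
          by_cases h' : ω ∈ A (n + 1)
          · exact Or.inl ⟨h', h⟩
          · exact Or.inr h'
        · rintro (h | h)
          · exact h.2
          · exact fun h' => h (hsub h')
      have h2 : ∫⁻ ω in (A n)ᶜ, M (n + 1) ω ∂μ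
          = ∫⁻ ω in A (n + 1) \ A n, M (n + 1) ω ∂μ + ∫⁻ ω in (A (n + 1))ᶜ, M (n + 1) ω ∂μ := by
        rw [hsplit]
        refine lintegral_union hAs.compl ?_
        exact Set.disjoint_left.2 fun ω h h' => h' h.1
      have h3 : b * μ (A (n + 1) \ A n) ≤ ∫⁻ ω in A (n + 1) \ A n, M (n + 1) ω ∂μ := by
        rw [← setLIntegral_const]
        exact setLIntegral_mono' (hAs.diff hAn') hnew
      have h4 : μ (A (n + 1)) = μ (A n) + μ (A (n + 1) \ A n) := by
        rw [measure_add_sdiff hAn'.nullMeasurableSet, Set.union_eq_self_of_subset_left hsub]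
      calc _ = b * μ (A n) + (b * μ (A (n + 1) \ A n)
            + ∫⁻ ω in (A (n + 1))ᶜ, M (n + 1) ω ∂μ) := by rw [h4, mul_add, add_assoc]
        _ ≤ b * μ (A n) + ∫⁻ ω in (A n)ᶜ, M (n + 1) ω ∂μ := by rw [h2]; gcongr
        _ ≤ b * μ (A n) + ∫⁻ ω in (A n)ᶜ, M n ω ∂μ := by gcongr
        _ ≤ 1 := ih
  exact le_self_add.trans (key T le_rfl)

/-- Two-sided tail of a sub-Gaussian variable. -/
lemma measure_abs_gt_le {e : Ω → ℝ} (he : Measurable e) {R : ℝ} (hR : 0 < R)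
    (h : ∀ s : ℝ, ∫⁻ ω, ENNReal.ofReal (Real.exp (s * e ω)) ∂μ
      ≤ ENNReal.ofReal (Real.exp (s ^ 2 * R ^ 2 / 2))) {l : ℝ} (hl : 0 ≤ l) :
    μ {ω | R * √(2 * l) < |e ω|} ≤ ENNReal.ofReal (2 * Real.exp (-l)) := by
  set a := R * √(2 * l) with ha
  have ha0 : 0 ≤ a := by positivity
  have ha2 : a ^ 2 = R ^ 2 * (2 * l) := by rw [ha, mul_pow, Real.sq_sqrt (by positivity)]
  -- Chernoff's bound at its optimal parameter a/R²; t = ±1 selects the tail.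
  have one : ∀ t : ℝ, t ^ 2 = 1 → μ {ω | a ≤ t * e ω} ≤ ENNReal.ofReal (Real.exp (-l)) := by
    intro t ht
    have hsub : {ω | a ≤ t * e ω} ⊆ {ω | ENNReal.ofReal (Real.exp (a / R ^ 2 * a))
        ≤ ENNReal.ofReal (Real.exp (a / R ^ 2 * t * e ω))} := by
      intro ω hω
      refine ENNReal.ofReal_le_ofReal (Real.exp_le_exp.2 ?_)
      rw [mul_assoc]
      exact mul_le_mul_of_nonneg_left hω (by positivity)
    have h1 := mul_meas_ge_le_lintegral (μ := μ)
      ((he.const_mul (a / R ^ 2 * t)).exp.ennreal_ofReal) (ENNReal.ofReal (Real.exp (a / R ^ 2 * a)))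
    have h2 := (mul_le_mul_right (measure_mono (μ := μ) hsub)
      (ENNReal.ofReal (Real.exp (a / R ^ 2 * a)))).trans (h1.trans (h (a / R ^ 2 * t)))
    have e1 : a / R ^ 2 * a = 2 * l := by
      rw [div_mul_eq_mul_div, ← sq, ha2]; field_simp
    have e2 : (a / R ^ 2 * t) ^ 2 * R ^ 2 / 2 = l := by
      rw [mul_pow, ht, div_pow, ha2]; field_simp
    rw [e1, e2] at h2
    have e3 : ENNReal.ofReal (Real.exp l) = ENNReal.ofReal (Real.exp (2 * l)) *
        ENNReal.ofReal (Real.exp (-l)) := by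
      rw [← ENNReal.ofReal_mul (Real.exp_pos _).le, ← Real.exp_add]; ring_nf
    rw [e3] at h2
    exact (ENNReal.mul_le_mul_iff_right (by simp [Real.exp_pos]) ENNReal.ofReal_ne_top).1 h2
  have hsub : {ω | a < |e ω|} ⊆ {ω | a ≤ 1 * e ω} ∪ {ω | a ≤ -1 * e ω} := by
    intro ω hω
    rcases lt_abs.1 (show a < |e ω| from hω) with h' | h'
    · left; simpa using h'.le
    · right; simpa using h'.le
  calc _ ≤ μ {ω | a ≤ 1 * e ω} + μ {ω | a ≤ -1 * e ω} :=
        (measure_mono hsub).trans (measure_union_le _ _)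
    _ ≤ ENNReal.ofReal (Real.exp (-l)) + ENNReal.ofReal (Real.exp (-l)) :=
        add_le_add (one 1 (by norm_num)) (one (-1) (by norm_num))
    _ = _ := by rw [← ENNReal.ofReal_add (Real.exp_pos _).le (Real.exp_pos _).le, two_mul]

end SubGaussian

/-! ### Measurability of the posterior -/

section Measurability

variable {E Ω : Type*} {mΩ : MeasurableSpace Ω}

lemma measurable_det {n : ℕ} {A : Ω → Matrix (Fin n) (Fin n) ℝ}
    (hA : ∀ i j, Measurable fun ω => A ω i j) : Measurable fun ω => (A ω).det := by
  simp_rw [Matrix.det_apply]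
  exact Finset.measurable_sum _ fun p _ =>
    (Finset.measurable_prod _ fun i _ => hA _ _).const_smul _

lemma measurable_inv_apply {n : ℕ} {A : Ω → Matrix (Fin n) (Fin n) ℝ}
    (hA : ∀ i j, Measurable fun ω => A ω i j) (i j : Fin n) :
    Measurable fun ω => (A ω)⁻¹ i j := by
  simp_rw [Matrix.inv_def, Matrix.smul_apply, Ring.inverse_eq_inv', smul_eq_mul,
    Matrix.adjugate_apply]
  refine (measurable_det hA).inv.mul (measurable_det fun k l => ?_)
  by_cases hk : k = j
  · subst hk; simp
  · simp only [Matrix.updateRow_ne hk]; exact hA k l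

variable {E : Type} [MeasurableSpace E] {n : ℕ} {k : E → E → ℝ} {σ : ℝ}

lemma measurable_noisyGram_inv (hk : Measurable fun p : E × E => k p.1 p.2) {x : Fin n → Ω → E}
    (hx : ∀ i, Measurable (x i)) (i j : Fin n) :
    Measurable fun ω => (noisyGram k σ fun l => x l ω)⁻¹ i j := by
  refine measurable_inv_apply (fun i j => ?_) i j
  simp only [noisyGram, gram, Matrix.add_apply, Matrix.of_apply]
  exact (hk.comp ((hx i).prodMk (hx j))).add_const _

lemma measurable_postMean (hk : Measurable fun p : E × E => k p.1 p.2) {x : Fin n → Ω → E}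
    (hx : ∀ i, Measurable (x i)) {y : Fin n → Ω → ℝ} (hy : ∀ i, Measurable (y i)) {z : Ω → E}
    (hz : Measurable z) :
    Measurable fun ω => postMean k σ (fun i => x i ω) (fun i => y i ω) (z ω) := by
  have h : ∀ ω, postMean k σ (fun i => x i ω) (fun i => y i ω) (z ω)
      = ∑ i, k (x i ω) (z ω) * ∑ j, (noisyGram k σ fun l => x l ω)⁻¹ i j * y j ω := fun ω => rfl
  simp_rw [h]
  exact Finset.measurable_sum _ fun i _ => (hk.comp ((hx i).prodMk hz)).mul
    (Finset.measurable_sum _ fun j _ => (measurable_noisyGram_inv hk hx i j).mul (hy j))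

lemma measurable_postVar (hk : Measurable fun p : E × E => k p.1 p.2) {x : Fin n → Ω → E}
    (hx : ∀ i, Measurable (x i)) {z : Ω → E} (hz : Measurable z) :
    Measurable fun ω => postVar k σ (fun i => x i ω) (z ω) := by
  have h : ∀ ω, postVar k σ (fun i => x i ω) (z ω)
      = k (z ω) (z ω) - postMean k σ (fun i => x i ω) (fun i => k (x i ω) (z ω)) (z ω) :=
    fun ω => rfl
  simp_rw [h]
  exact (hk.comp (hz.prodMk hz)).sub
    (measurable_postMean hk hx (fun i => hk.comp ((hx i).prodMk hz)) hz)

end Measurability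

/-! ### Self-normalized concentration -/

section Concentration

open scoped ENNReal

variable {Ω : Type*} {mΩ : MeasurableSpace Ω} {μ : Measure Ω} [IsProbabilityMeasure μ]
  {E : Type} [MeasurableSpace E]

/-- The process M = exp(explained/(2R²) - information gain) starts at one, and each step multiplies
it by a `mixFactor` formed from the current posterior. Its integrals over past events do not
increase, so Ville's inequality bounds all times n ≤ T at once, for adaptively chosen points. -/
lemma measure_explained_gt_le {ℱ : Filtration ℕ mΩ} {k : E → E → ℝ} (hk : IsPSDKernel k)
    (hkm : Measurable fun p : E × E => k p.1 p.2) {σ R : ℝ} (hσ : 0 < σ) (hR : 0 < R) {T : ℕ}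
    {x : ℕ → Ω → E} {e : ℕ → Ω → ℝ} (hx : ∀ n < T, Measurable[ℱ n] (x n))
    (he : ∀ n < T, Measurable[ℱ (n + 1)] (e n))
    (hint : ∀ n < T, ∀ s : ℝ, Integrable (fun ω => Real.exp (s * e n ω)) μ)
    (hle : ∀ n < T, ∀ s : ℝ,
      μ[fun ω => Real.exp (s * e n ω) | ℱ n] ≤ᵐ[μ] fun _ => Real.exp (s ^ 2 * R ^ 2 / 2))
    {b : ℝ} (hb : 0 < b) :
    μ {ω | ∃ n ≤ T, 2 * R ^ 2 * (infoGain k σ (fun i : Fin n => x i ω) + Real.log b)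
      < explained k σ (fun i : Fin n => x i ω) (fun i : Fin n => e i ω)} ≤ ENNReal.ofReal b⁻¹ := by
  let M : ℕ → Ω → ℝ≥0∞ := fun n ω => ENNReal.ofReal (Real.exp
    (explained k σ (fun i : Fin n => x i ω) (fun i : Fin n => e i ω) / (2 * R ^ 2)
      - infoGain k σ (fun i : Fin n => x i ω)))
  let a : ℕ → Ω → ℝ := fun n ω =>
    postMean k σ (fun i : Fin n => x i ω) (fun i : Fin n => e i ω) (x n ω)
  let v : ℕ → Ω → ℝ := fun n ω => postVar k σ (fun i : Fin n => x i ω) (x n ω)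
  have hv0 : ∀ n ω, 0 ≤ v n ω := fun n ω => postVar_nonneg hk hσ _ _
  have hsucc : ∀ n ω, M (n + 1) ω = M n ω * ENNReal.ofReal (mixFactor σ R (e n ω) (a n ω) (v n ω)) := by
    intro n ω
    have hpos : 0 < 1 + v n ω / σ ^ 2 := by have := hv0 n ω; positivity
    have h1 := explained_succ hk hσ (fun i : Fin (n + 1) => x i ω) (fun i : Fin (n + 1) => e i ω)
    have h2 := infoGain_succ hk hσ (fun i : Fin (n + 1) => x i ω)
    simp only [Fin.val_castSucc, Fin.val_last] at h1 h2
    have h3 : (√(1 + v n ω / σ ^ 2))⁻¹ = Real.exp (-(1 / 2 * Real.log (1 + v n ω / σ ^ 2))) := by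
      rw [Real.exp_neg, Real.sqrt_eq_rpow, Real.rpow_def_of_pos hpos, mul_comm (1 / 2 : ℝ)]
    simp only [M]
    rw [h1, h2, mixFactor, h3, ← Real.exp_add, ← ENNReal.ofReal_mul (Real.exp_pos _).le,
      ← Real.exp_add]
    congr 2
    simp only [a, v]
    ring
  have hxm : ∀ n ≤ T, ∀ i : Fin n, Measurable[ℱ n] (x i) := fun n hn i =>
    (hx i (i.2.trans_le hn)).mono (ℱ.mono i.2.le) le_rfl
  have hem : ∀ n ≤ T, ∀ i : Fin n, Measurable[ℱ n] (e i) := fun n hn i =>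
    (he i (i.2.trans_le hn)).mono (ℱ.mono i.2) le_rfl
  have ham : ∀ n < T, Measurable[ℱ n] (a n) := fun n hn =>
    measurable_postMean hkm (hxm n hn.le) (hem n hn.le) (hx n hn)
  have hvm : ∀ n < T, Measurable[ℱ n] (v n) := fun n hn =>
    measurable_postVar hkm (hxm n hn.le) (hx n hn)
  have hM0 : ∀ ω, M 0 ω = 1 := fun ω => by simp [M, explained, infoGain]
  have hM : ∀ n ≤ T, Measurable[ℱ n] (M n) := by
    intro n
    induction n with
    | zero =>
      intro _
      have : M 0 = fun _ => 1 := funext hM0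
      rw [this]; exact measurable_const
    | succ n ih =>
      intro hn
      have hn' : n < T := hn
      have h1 : Measurable[ℱ (n + 1)] (M n) := (ih hn'.le).mono (ℱ.mono n.le_succ) le_rfl
      have h2 : Measurable[ℱ (n + 1)] (a n) := (ham n hn').mono (ℱ.mono n.le_succ) le_rfl
      have h3 : Measurable[ℱ (n + 1)] (v n) := (hvm n hn').mono (ℱ.mono n.le_succ) le_rfl
      have h4 := he n hn'
      have : M (n + 1) = fun ω => M n ω * ENNReal.ofReal (mixFactor σ R (e n ω) (a n ω) (v n ω)) :=
        funext (hsucc n)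
      rw [this]
      refine h1.mul (Measurable.ennreal_ofReal ?_)
      unfold mixFactor
      refine Measurable.mul (Measurable.exp (Measurable.div_const ((h4.pow_const 2).sub ?_) _)) ?_
      · exact (((h4.sub h2).pow_const 2).const_mul _).div (h3.add_const _)
      · exact ((h3.div_const _).const_add 1).sqrt.inv
  have hville := mul_measure_exists_ge_le (μ := μ) (ℱ := ℱ) (M := M) (T := T) hM
    (by simp [hM0]) (by
      intro n hn A hA
      have hA' := ℱ.le n A hA
      rw [← lintegral_indicator hA', ← lintegral_indicator hA']
      have h1 := lintegral_mul_mixFactor_le (ℱ.le n) ((he n hn).mono (ℱ.le _) le_rfl) hR hσ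
        (hint n hn) (hle n hn) ((hM n hn.le).indicator hA) (ham n hn) (hvm n hn) (hv0 n)
      refine le_trans (le_of_eq (lintegral_congr fun ω => ?_)) h1
      by_cases hω : ω ∈ A
      · simp [hω, hsucc]
      · simp [hω]) (ENNReal.ofReal b)
  have hsub : {ω | ∃ n ≤ T, 2 * R ^ 2 * (infoGain k σ (fun i : Fin n => x i ω) + Real.log b)
      < explained k σ (fun i : Fin n => x i ω) (fun i : Fin n => e i ω)}
      ⊆ {ω | ∃ n ≤ T, ENNReal.ofReal b ≤ M n ω} := by
    rintro ω ⟨n, hn, h⟩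
    refine ⟨n, hn, ENNReal.ofReal_le_ofReal ?_⟩
    rw [← Real.exp_log hb]
    refine Real.exp_le_exp.2 ?_
    rw [le_sub_iff_add_le, le_div_iff₀ (by positivity)]
    linarith
  refine (measure_mono hsub).trans ?_
  rw [ENNReal.ofReal_inv_of_pos hb, ← one_div, ENNReal.le_div_iff_mul_le
    (Or.inl (by simpa using hb)) (Or.inl ENNReal.ofReal_ne_top), mul_comm]
  exact hville

variable {d m : ℕ}

/-- On this event the confidence bounds of all hyperparameters in the net `s` hold. -/
def GoodNoise (P : Problem d m) (σ R δ : ℝ) (T : ℕ) (s : Finset (Fin m → ℝ))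
    (x : ℕ → EuclideanSpace ℝ (Fin d)) (e : ℕ → ℝ) : Prop :=
  (∀ θ ∈ s, ∀ n ≤ T, explained (P.ker θ) σ (fun i : Fin n => x i) (fun i : Fin n => e i)
    ≤ 2 * R ^ 2 * (infoGain (P.ker θ) σ (fun i : Fin n => x i) + Real.log (6 * s.card / δ))) ∧
  ∀ n < T, |e n| ≤ R * √(2 * Real.log (4 * T / δ))

/-- Union bound: each net point fails with probability at most δ/(6|s|) and each noise variable is
large with probability at most δ/(2T), in total 2δ/3. A constant R > 0 above `c.R` is allowed
because the mixture divides by R while `c.R` may vanish. -/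
lemma Run.measure_goodNoise_ge {P : Problem d m} {c : Config} {a : Tuning}
    {f : EuclideanSpace ℝ (Fin d) → ℝ} (r : Run μ P c a f) (hR0 : 0 ≤ c.R) {R : ℝ} (hR : 0 < R)
    (hcR : c.R ≤ R) (hσ : 0 < c.σ) (hδ : 0 < c.δ) (hδ1 : c.δ < 1) (hT : 1 ≤ c.T)
    {s : Finset (Fin m → ℝ)} (hs : ∀ θ ∈ s, θ ∈ P.Θ) (hs0 : 1 ≤ s.card) :
    ENNReal.ofReal (1 - c.δ)
      ≤ μ {ω | GoodNoise P c.σ R c.δ c.T s (fun n => r.x n ω) (fun n => r.noise n ω)} := by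
  have hsub : ∀ n < c.T, ∀ t : ℝ, μ[fun ω => Real.exp (t * r.noise n ω) | r.ℱ n]
      ≤ᵐ[μ] fun _ => Real.exp (t ^ 2 * R ^ 2 / 2) := by
    intro n hn t
    filter_upwards [r.noise_subG n hn t] with ω hω
    refine hω.trans (Real.exp_le_exp.2 ?_)
    gcongr
  have hcard : (1 : ℝ) ≤ s.card := by exact_mod_cast hs0
  have hTr : (1 : ℝ) ≤ c.T := by exact_mod_cast hT
  let A : (Fin m → ℝ) → Set Ω := fun θ => {ω | ∃ n ≤ c.T,
    2 * R ^ 2 * (infoGain (P.ker θ) c.σ (fun i : Fin n => r.x i ω) + Real.log (6 * s.card / c.δ))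
      < explained (P.ker θ) c.σ (fun i : Fin n => r.x i ω) (fun i : Fin n => r.noise i ω)}
  let D : ℕ → Set Ω := fun n => {ω | R * √(2 * Real.log (4 * c.T / c.δ)) < |r.noise n ω|}
  have hA : ∀ θ ∈ s, μ (A θ) ≤ ENNReal.ofReal (6 * s.card / c.δ)⁻¹ := fun θ hθ =>
    measure_explained_gt_le (P.ker_psd (hs θ hθ)) (P.measurable_ker θ) hσ hR r.x_meas r.noise_meas
      r.noise_integrable hsub (by positivity)
  have hD : ∀ n ∈ Finset.range c.T, μ (D n) ≤ ENNReal.ofReal (2 * (4 * c.T / c.δ)⁻¹) := by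
    intro n hn
    have hn' : n < c.T := Finset.mem_range.1 hn
    have hme : Measurable (r.noise n) := (r.noise_meas n hn').mono (r.ℱ.le _) le_rfl
    have h1 : (1 : ℝ) ≤ 4 * c.T / c.δ := by rw [le_div_iff₀ hδ]; linarith
    have := measure_abs_gt_le (μ := μ) hme hR (fun t => by
      have := lintegral_mul_exp_le (μ := μ) (r.ℱ.le n) (hme.const_mul t).exp
        (fun ω => (Real.exp_pos _).le) (r.noise_integrable n hn' t) (Real.exp_pos _).le
        (hsub n hn' t) (W := fun _ => 1) measurable_const
      simpa using this) (l := Real.log (4 * c.T / c.δ)) (Real.log_nonneg h1)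
    rwa [Real.exp_neg, Real.exp_log (by linarith)] at this
  have hbad : μ ((⋃ θ ∈ s, A θ) ∪ ⋃ n ∈ Finset.range c.T, D n) ≤ ENNReal.ofReal c.δ := by
    have h1 : μ (⋃ θ ∈ s, A θ) ≤ ENNReal.ofReal (c.δ / 6) := by
      refine (measure_biUnion_finset_le s A).trans ((Finset.sum_le_sum hA).trans ?_)
      rw [Finset.sum_const, nsmul_eq_mul, ← ENNReal.ofReal_natCast,
        ← ENNReal.ofReal_mul (by positivity)]
      refine ENNReal.ofReal_le_ofReal (le_of_eq ?_)
      field_simp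
    have h2 : μ (⋃ n ∈ Finset.range c.T, D n) ≤ ENNReal.ofReal (c.δ / 2) := by
      refine (measure_biUnion_finset_le _ D).trans ((Finset.sum_le_sum hD).trans ?_)
      rw [Finset.sum_const, nsmul_eq_mul, Finset.card_range, ← ENNReal.ofReal_natCast,
        ← ENNReal.ofReal_mul (by positivity)]
      refine ENNReal.ofReal_le_ofReal (le_of_eq ?_)
      field_simp
      norm_num
    refine (measure_union_le _ _).trans ((add_le_add h1 h2).trans ?_)
    rw [← ENNReal.ofReal_add (by positivity) (by positivity)]
    exact ENNReal.ofReal_le_ofReal (by linarith)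
  set G := {ω | GoodNoise P c.σ R c.δ c.T s (fun n => r.x n ω) (fun n => r.noise n ω)}
  -- Subadditivity of the outer measure on this cover gives the lower bound without measurability of
  -- G.
  have hcover : (Set.univ : Set Ω) ⊆ G ∪ ((⋃ θ ∈ s, A θ) ∪ ⋃ n ∈ Finset.range c.T, D n) := by
    intro ω _
    by_contra hω
    simp only [Set.mem_union, Set.mem_iUnion, not_or, not_exists] at hω
    refine hω.1 ⟨fun θ hθ n hn => ?_, fun n hn => ?_⟩
    · have := hω.2.1 θ hθ
      simp only [A, Set.mem_ofPred_eq, not_exists, not_and, not_lt] at this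
      exact this n hn
    · have := hω.2.2 n (Finset.mem_range.2 hn)
      simpa only [D, Set.mem_ofPred_eq, not_lt] using this
  have htot : (1 : ℝ≥0∞) ≤ μ G + ENNReal.ofReal c.δ := by
    rw [← measure_univ (μ := μ)]
    exact (measure_mono hcover).trans ((measure_union_le _ _).trans (by gcongr))
  rw [ENNReal.ofReal_sub _ hδ.le, ENNReal.ofReal_one]
  exact tsub_le_iff_right.2 htot

end Concentration

/-! ### Confidence bounds and regret -/

section Regret

open Matrix

variable {d m : ℕ} {P : Problem d m}

lemma postMean_add {E : Type} {n : ℕ} (k : E → E → ℝ) (σ : ℝ) (x : Fin n → E) (y y' : Fin n → ℝ)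
    (z : E) : postMean k σ x (fun i => y i + y' i) z = postMean k σ x y z + postMean k σ x y' z := by
  have : (fun i => y i + y' i) = y + y' := rfl
  rw [postMean, this, mulVec_add, dotProduct_add]; rfl

/-- Gram matrices of kernels at distance `ε` differ by at most `n ε` as quadratic forms. -/
lemma Problem.gram_quad_le {θ θ' : Fin m → ℝ} {ε : ℝ} (hε : 0 ≤ ε) (h : P.kdist θ θ' ≤ ε) {n : ℕ}
    (x : Fin n → EuclideanSpace ℝ (Fin d)) (hx : ∀ i, x i ∈ P.X) (c : Fin n → ℝ) :
    c ⬝ᵥ gram (P.ker θ) x *ᵥ c ≤ c ⬝ᵥ gram (P.ker θ') x *ᵥ c + n * ε * (c ⬝ᵥ c) := by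
  have h1 : ∀ j l, c j * c l * P.ker θ (x j) (x l)
      ≤ c j * c l * P.ker θ' (x j) (x l) + ε * (|c j| * |c l|) := by
    intro j l
    have h2 := (P.abs_ker_sub_le θ θ' (hx j) (hx l)).trans h
    have h3 : c j * c l * (P.ker θ (x j) (x l) - P.ker θ' (x j) (x l)) ≤ |c j| * |c l| * ε := by
      refine (le_abs_self _).trans ?_
      rw [abs_mul, abs_mul]
      gcongr
    linarith
  rw [gram_quad, gram_quad]
  calc _ ≤ ∑ j, ∑ l, (c j * c l * P.ker θ' (x j) (x l) + ε * (|c j| * |c l|)) :=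
        Finset.sum_le_sum fun j _ => Finset.sum_le_sum fun l _ => h1 j l
    _ = ∑ j, ∑ l, c j * c l * P.ker θ' (x j) (x l) + ε * (∑ j, |c j|) ^ 2 := by
        simp_rw [Finset.sum_add_distrib, ← Finset.mul_sum]
        rw [sq, Finset.sum_mul]
    _ ≤ _ := by
        have h4 := sq_sum_le_card_mul_sum_sq (s := Finset.univ) (f := fun j => |c j|)
        simp only [Finset.card_univ, Fintype.card_fin, sq_abs] at h4
        have h5 : c ⬝ᵥ c = ∑ j, c j ^ 2 := by simp [dotProduct, sq]
        rw [h5]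
        have := mul_le_mul_of_nonneg_left h4 hε
        linarith

/-- Transfer from the nearest net point to an arbitrary θ in Θ. The Gram matrices differ by nε_T as
quadratic forms and |e|² ≤ 2nR² log(4T/δ), so the error is of order T²ε_T log(4T/δ); with ε_T = T⁻⁴
it is negligible. -/
lemma GoodNoise.explained_le {σ R δ : ℝ} {T : ℕ} {s : Finset (Fin m → ℝ)}
    {x : ℕ → EuclideanSpace ℝ (Fin d)} {e : ℕ → ℝ} (hg : GoodNoise P σ R δ T s x e)
    (hσ : 1 ≤ σ) (hT : 1 ≤ T) (hδ : 0 < δ) (hδ1 : δ < 1)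
    (hs : P.IsNet (epsT T) ↑s) {n : ℕ} (hn : n < T) (hx : ∀ i < n, x i ∈ P.X) {θ : Fin m → ℝ}
    (hθ : θ ∈ P.Θ) :
    explained (P.ker θ) σ (fun i : Fin n => x i) (fun i : Fin n => e i)
      ≤ 2 * R ^ 2 * (P.supGain σ n + Real.log (6 * s.card / δ)
          + ((T : ℝ) ^ 2)⁻¹ * Real.log (4 * T / δ)) := by
  obtain ⟨θ', hθ', hd⟩ := hs.2 θ hθ
  have hσ0 : 0 < σ := by linarith
  have hTr : (1 : ℝ) ≤ T := by exact_mod_cast hT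
  have hT0 : (0 : ℝ) < T := by linarith
  have hnT : (n : ℝ) ≤ T := by exact_mod_cast hn.le
  have hε : 0 ≤ epsT T := by unfold epsT; positivity
  have hl : 0 ≤ Real.log (4 * T / δ) :=
    Real.log_nonneg (by rw [le_div_iff₀ hδ]; linarith)
  have h1 := explained_le_of_gram_le (P.ker_psd hθ) (P.ker_psd (hs.1 hθ')) hσ0
    (fun i : Fin n => x i) (η := n * epsT T) (by positivity)
    (P.gram_quad_le hε hd (fun i : Fin n => x i) fun i => hx i i.2) (fun i : Fin n => e i)
  have h2 := hg.1 θ' hθ' n hn.le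
  have h3 := P.infoGain_le_supGain hσ (hs.1 hθ') (fun i : Fin n => x i) fun i => hx i i.2
  have h4 : (fun i : Fin n => e i) ⬝ᵥ (fun i : Fin n => e i)
      ≤ n * (R ^ 2 * (2 * Real.log (4 * T / δ))) := by
    have : ∀ i : Fin n, e i * e i ≤ R ^ 2 * (2 * Real.log (4 * T / δ)) := by
      intro i
      have h := hg.2 i (i.2.trans hn)
      have h' := pow_le_pow_left₀ (abs_nonneg _) h 2
      rw [sq_abs, mul_pow, Real.sq_sqrt (by positivity)] at h'
      rwa [← sq]
    calc _ ≤ ∑ _i : Fin n, R ^ 2 * (2 * Real.log (4 * T / δ)) := Finset.sum_le_sum fun i _ => this i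
      _ = _ := by simp
  have h5 : n * epsT T / σ ^ 2 * ((fun i : Fin n => e i) ⬝ᵥ fun i : Fin n => e i)
      ≤ ((T : ℝ) ^ 2)⁻¹ * (R ^ 2 * (2 * Real.log (4 * T / δ))) := by
    calc _ ≤ n * epsT T / 1 * (n * (R ^ 2 * (2 * Real.log (4 * T / δ)))) := by
          gcongr
          · exact dotProduct_self_nonneg' _
          · exact one_le_pow₀ hσ
      _ ≤ T * epsT T / 1 * (T * (R ^ 2 * (2 * Real.log (4 * T / δ)))) := by gcongr
      _ = _ := by unfold epsT; field_simp
  have h6 : 2 * R ^ 2 * infoGain (P.ker θ') σ (fun i : Fin n => x i)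
      ≤ 2 * R ^ 2 * P.supGain σ n := by gcongr
  linarith

/-- The posterior mean is linear in the data. Its signal part errs by at most B standard deviations,
and its noise part is bounded through the explained energy, with σ ≥ 1 absorbing the division by σ.
-/
lemma GoodNoise.abs_sub_postMean_le {σ R δ B : ℝ} {T : ℕ} {s : Finset (Fin m → ℝ)}
    {x : ℕ → EuclideanSpace ℝ (Fin d)} {e : ℕ → ℝ} (hg : GoodNoise P σ R δ T s x e) (hR : 0 ≤ R)
    (hσ : 1 ≤ σ) (hT : 1 ≤ T) (hδ : 0 < δ) (hδ1 : δ < 1) (hs0 : 1 ≤ s.card)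
    (hs : P.IsNet (epsT T) ↑s) {n : ℕ} (hn : n < T) (hx : ∀ i < n, x i ∈ P.X) {θ : Fin m → ℝ}
    (hθ : θ ∈ P.Θ) {f : EuclideanSpace ℝ (Fin d) → ℝ} (hB : 0 ≤ B)
    (hf : InRKHSBall P.X (P.ker θ) B f) {z : EuclideanSpace ℝ (Fin d)} (hz : z ∈ P.X) :
    |f z - postMean (P.ker θ) σ (fun i : Fin n => x i) (fun i : Fin n => f (x i) + e i) z|
      ≤ (B + R * (√(2 * (P.supGain σ n + Real.log (6 * s.card / δ)))
          + (T : ℝ)⁻¹ * √(2 * Real.log (4 * T / δ)))) *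
        postStd (P.ker θ) σ (fun i : Fin n => x i) z := by
  have hσ0 : 0 < σ := by linarith
  have hTr : (1 : ℝ) ≤ T := by exact_mod_cast hT
  have hcard : (1 : ℝ) ≤ s.card := by exact_mod_cast hs0
  have hk := P.ker_psd hθ
  have hl : 0 ≤ Real.log (4 * T / δ) := Real.log_nonneg (by rw [le_div_iff₀ hδ]; linarith)
  have hl' : 0 ≤ Real.log (6 * s.card / δ) := Real.log_nonneg (by rw [le_div_iff₀ hδ]; linarith)
  have hΓ := P.supGain_nonneg hσ n
  rw [postMean_add]
  set S := postStd (P.ker θ) σ (fun i : Fin n => x i) z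
  have hS : 0 ≤ S := Real.sqrt_nonneg _
  have h1 := OSCBO.abs_sub_postMean_le hk hσ0 hB (fun n x hx c => hf.sq_dotProduct_le x hx c)
    (fun i : Fin n => x i) (fun i => hx i i.2) hz
  have h2 := abs_postMean_le hk hσ0 (fun i : Fin n => x i) (fun i : Fin n => e i) z
  have h3 := hg.explained_le hσ hT hδ hδ1 hs hn hx hθ
  have h4 : √(explained (P.ker θ) σ (fun i : Fin n => x i) (fun i : Fin n => e i))
      ≤ R * (√(2 * (P.supGain σ n + Real.log (6 * s.card / δ)))
          + (T : ℝ)⁻¹ * √(2 * Real.log (4 * T / δ))) := by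
    refine Real.sqrt_le_iff.2 ⟨by positivity, h3.trans ?_⟩
    set u := √(2 * (P.supGain σ n + Real.log (6 * s.card / δ))) with hu
    set v := √(2 * Real.log (4 * T / δ)) with hv
    have eu : u ^ 2 = 2 * (P.supGain σ n + Real.log (6 * s.card / δ)) := Real.sq_sqrt (by positivity)
    have ev : v ^ 2 = 2 * Real.log (4 * T / δ) := Real.sq_sqrt (by positivity)
    have e1 : 2 * R ^ 2 * (P.supGain σ n + Real.log (6 * s.card / δ)
          + ((T : ℝ) ^ 2)⁻¹ * Real.log (4 * T / δ)) = R ^ 2 * (u ^ 2 + ((T : ℝ)⁻¹ * v) ^ 2) := by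
      rw [mul_pow, eu, ev, inv_pow]; ring
    rw [e1, mul_pow R]
    have h5 : 0 ≤ u := Real.sqrt_nonneg _
    have h6 : 0 ≤ (T : ℝ)⁻¹ * v := mul_nonneg (by positivity) (Real.sqrt_nonneg _)
    refine mul_le_mul_of_nonneg_left ?_ (sq_nonneg R)
    nlinarith [mul_nonneg h5 h6]
  have h5 : S / σ ≤ S := div_le_self hS hσ
  have h6 : S / σ * √(explained (P.ker θ) σ (fun i : Fin n => x i) (fun i : Fin n => e i))
      ≤ S * (R * (√(2 * (P.supGain σ n + Real.log (6 * s.card / δ)))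
          + (T : ℝ)⁻¹ * √(2 * Real.log (4 * T / δ)))) :=
    mul_le_mul h5 h4 (Real.sqrt_nonneg _) hS
  set pf := postMean (P.ker θ) σ (fun i : Fin n => x i) (fun i : Fin n => f (x i)) z
  set pe := postMean (P.ker θ) σ (fun i : Fin n => x i) (fun i : Fin n => e i) z
  calc |f z - (pf + pe)| = |(f z - pf) - pe| := by ring_nf
    _ ≤ |f z - pf| + |pe| := abs_sub _ _
    _ ≤ B * S + S * (R * (√(2 * (P.supGain σ n + Real.log (6 * s.card / δ)))
          + (T : ℝ)⁻¹ * √(2 * Real.log (4 * T / δ)))) := add_le_add h1 (h2.trans h6)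
    _ = _ := by ring

/-- The confidence width exceeds `β` by at most this quantity. -/
def slack (P : Problem d m) (c : Config) : ℝ :=
  (c.T : ℝ)⁻¹ * (√(2 * (P.supGain c.σ (c.T - 1) + Real.log (6 * P.covNum (epsT c.T) / c.δ)))
    + (c.R + 1) * √(2 * Real.log (4 * c.T / c.δ)))

variable {c : Config}

lemma slack_nonneg (hR : 0 ≤ c.R) : 0 ≤ slack P c := by unfold slack; positivity

/-- Writing u and v for the two square roots on the left, (R + 1/T)(u + v/T) = Ru + u/T + (R +
1/T)v/T. The first term is covered by β, the others by the slack, since u grows with n and 1/T ≤ 1.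
-/
lemma width_le_betaSqrt_add_slack (hR : 0 ≤ c.R) (hσ : 1 ≤ c.σ) (hT : 1 ≤ c.T) {n : ℕ}
    (hn : n < c.T) :
    c.B + (c.R + (c.T : ℝ)⁻¹) *
        (√(2 * (P.supGain c.σ n + Real.log (6 * P.covNum (epsT c.T) / c.δ)))
          + (c.T : ℝ)⁻¹ * √(2 * Real.log (4 * c.T / c.δ)))
      ≤ betaSqrt P c n + slack P c := by
  have hTr : (1 : ℝ) ≤ c.T := by exact_mod_cast hT
  have hΓ := P.supGain_mono hσ (show n ≤ c.T - 1 by omega)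
  rw [betaSqrt, slack]
  set l := Real.log (6 * P.covNum (epsT c.T) / c.δ)
  set v := √(2 * Real.log (4 * c.T / c.δ)) with hv
  have hv0 : 0 ≤ v := Real.sqrt_nonneg _
  have h1 : √(2 * (P.supGain c.σ n + l)) ≤ √(2 * (P.supGain c.σ n + 1 + l)) :=
    Real.sqrt_le_sqrt (by linarith)
  have h2 : √(2 * (P.supGain c.σ n + l)) ≤ √(2 * (P.supGain c.σ (c.T - 1) + l)) :=
    Real.sqrt_le_sqrt (by linarith)
  have h3 : (c.T : ℝ)⁻¹ ≤ 1 := inv_le_one_of_one_le₀ hTr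
  have h4 : 0 ≤ (c.T : ℝ)⁻¹ := by positivity
  have h5 := mul_le_mul_of_nonneg_left h1 hR
  have h6 := mul_le_mul_of_nonneg_left h2 h4
  have h7 : (c.R + (c.T : ℝ)⁻¹) * ((c.T : ℝ)⁻¹ * v) ≤ (c.R + 1) * ((c.T : ℝ)⁻¹ * v) := by
    gcongr
  nlinarith

variable {a : Tuning} {f : EuclideanSpace ℝ (Fin d) → ℝ} {Ω : Type*} [MeasurableSpace Ω]
  {μ : Measure Ω}

/-- Instantaneous regret of the upper confidence bound rule. -/
lemma Run.instant_regret_le (r : Run μ P c a f) (hR : 0 ≤ c.R) (hσ : 1 ≤ c.σ) (hB : 0 < c.B)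
    (hδ : 0 < c.δ) (hδ1 : c.δ < 1) (hT : 1 ≤ c.T)
    (hf : ∀ θ' ∈ P.Θ, InRKHSBall P.X (P.ker θ') c.B f)
    {xstar : EuclideanSpace ℝ (Fin d)} (hxs : xstar ∈ P.X)
    {s : Finset (Fin m → ℝ)} (hs : P.IsNet (epsT c.T) ↑s) (hcard : s.card = P.covNum (epsT c.T))
    (hs0 : 1 ≤ s.card) {ω : Ω}
    (hg : GoodNoise P c.σ (c.R + (c.T : ℝ)⁻¹) c.δ c.T s (fun n => r.x n ω) (fun n => r.noise n ω))
    {n : ℕ} (hn : n < c.T) :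
    f xstar - f (r.x n ω) ≤ 2 * betaSqrt P c n *
        postStd (P.ker (r.th n ω)) c.σ (fun i : Fin n => r.x i ω) (r.x n ω) + 2 * slack P c := by
  set θ := r.th n ω with hθd
  have hθ : θ ∈ P.Θ := r.act_net.1 (r.th_mem n hn ω)
  have hσ0 : 0 < c.σ := by linarith
  have hTr : (1 : ℝ) ≤ c.T := by exact_mod_cast hT
  have hwidth := width_le_betaSqrt_add_slack (P := P) (c := c) hR hσ hT hn
  rw [← hcard] at hwidth
  have hsl := slack_nonneg (P := P) (c := c) hR
  have hy : (fun i : Fin n => r.y i ω) = fun i : Fin n => f (r.x i ω) + r.noise i ω :=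
    funext fun i => r.obs i (i.2.trans hn) ω
  -- The confidence bound is uniform over Θ, so the random hyperparameter of this round may be
  -- inserted.
  have hconf : ∀ z ∈ P.X, |f z - mean P c (pathOf r.x r.y r.th r.lam ω) n θ z|
      ≤ (betaSqrt P c n + slack P c) * postStd (P.ker θ) c.σ (fun i : Fin n => r.x i ω) z := by
    intro z hz
    have h := hg.abs_sub_postMean_le (by positivity) hσ hT hδ hδ1 hs0 hs hn
      (fun i hi => r.x_mem i (hi.trans hn) ω) hθ hB.le (hf θ hθ) hz
    have e : mean P c (pathOf r.x r.y r.th r.lam ω) n θ z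
        = postMean (P.ker θ) c.σ (fun i : Fin n => r.x i ω)
            (fun i : Fin n => f (r.x i ω) + r.noise i ω) z := by
      rw [← hy]; rfl
    rw [e]
    exact h.trans (mul_le_mul_of_nonneg_right hwidth (Real.sqrt_nonneg _))
  have hstd : ∀ z, postStd (P.ker θ) c.σ (fun i : Fin n => r.x i ω) z ≤ 1 := fun z =>
    Real.sqrt_le_one.2 ((postVar_le_diag (P.ker_psd hθ) hσ0 _ z).trans (P.ker_le_one _ _ _))
  have hxn := r.x_mem n hn ω
  have h1 := (abs_le.1 (hconf xstar hxs)).2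
  have h2 := (abs_le.1 (hconf (r.x n ω) hxn)).1
  have h3 : ucb P c (pathOf r.x r.y r.th r.lam ω) n xstar
      ≤ ucb P c (pathOf r.x r.y r.th r.lam ω) n (r.x n ω) := r.x_max n hn ω hxs
  simp only [ucb, pathOf, ← hθd] at h3
  simp only [pathOf] at h1 h2
  have h4 := mul_le_mul_of_nonneg_left (hstd xstar) hsl
  have h5 := mul_le_mul_of_nonneg_left (hstd (r.x n ω)) hsl
  linarith

lemma one_le_log_six_mul {N : ℕ} (hN : 1 ≤ N) {δ : ℝ} (hδ : 0 < δ) (hδ1 : δ < 1) :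
    1 ≤ Real.log (6 * N / δ) := by
  have hN' : (1 : ℝ) ≤ N := by exact_mod_cast hN
  have h : Real.exp 1 ≤ 6 * N / δ := by
    rw [le_div_iff₀ hδ]
    nlinarith [Real.exp_one_lt_d9, Real.exp_one_gt_d9]
  exact (Real.le_log_iff_exp_le (by positivity)).2 h

lemma epsT_pos {T : ℕ} (hT : 1 ≤ T) : 0 < epsT T := by
  have : (0 : ℝ) < T := by exact_mod_cast hT
  unfold epsT; positivity

lemma epsT_le_one {T : ℕ} (hT : 1 ≤ T) : epsT T ≤ 1 :=
  inv_le_one_of_one_le₀ (one_le_pow₀ (by exact_mod_cast hT))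

lemma one_le_rpow_three_quarters {T : ℕ} (hT : 1 ≤ T) : 1 ≤ (T : ℝ) ^ (3 / 4 : ℝ) :=
  Real.one_le_rpow (by exact_mod_cast hT) (by norm_num)

/-- The accumulated slack is of the order of the rate. -/
lemma mul_slack_le (hR : 0 ≤ c.R) (hσ : 1 ≤ c.σ) (hδ : 0 < c.δ) (hδ1 : c.δ < 1) (hT : 1 ≤ c.T) :
    c.T * slack P c ≤ 2 * (c.R + 2) *
      √(P.supGain c.σ (c.T - 1) + Real.log (6 * P.covNum (epsT c.T) / c.δ))
        * (c.T : ℝ) ^ (3 / 4 : ℝ) := by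
  have hTr : (1 : ℝ) ≤ c.T := by exact_mod_cast hT
  have hT0 : (0 : ℝ) < c.T := by linarith
  have hN := P.one_le_covNum (epsT_pos hT) (epsT_le_one hT)
  have hN' : (1 : ℝ) ≤ P.covNum (epsT c.T) := by exact_mod_cast hN
  have hl := one_le_log_six_mul hN hδ hδ1
  have hΓ := P.supGain_nonneg hσ (c.T - 1)
  set l := Real.log (6 * P.covNum (epsT c.T) / c.δ) with hld
  set S := √(P.supGain c.σ (c.T - 1) + l) with hS
  have hT34 := one_le_rpow_three_quarters hT
  have h1 : √(2 * (P.supGain c.σ (c.T - 1) + l)) ≤ 2 * S := by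
    rw [Real.sqrt_mul (by norm_num)]
    have : √2 ≤ 2 := by rw [Real.sqrt_le_left (by norm_num)]; norm_num
    gcongr
  -- Crude: log(4/δ) ≤ l and log T ≤ T - 1, and l + T - 1 ≤ lT because l and T are at least one.
  have h2 : Real.log (4 * c.T / c.δ) ≤ l * c.T := by
    have e : Real.log (4 * c.T / c.δ) = Real.log (4 / c.δ) + Real.log c.T := by
      rw [← Real.log_mul (by positivity) (by positivity)]; congr 1; ring
    have h3 : Real.log (4 / c.δ) ≤ l := by
      refine Real.log_le_log (by positivity) ?_
      gcongr
      nlinarith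
    have h4 := Real.log_le_sub_one_of_pos hT0
    rw [e]
    nlinarith
  have h5 : √(2 * Real.log (4 * c.T / c.δ)) ≤ 2 * S * (c.T : ℝ) ^ (3 / 4 : ℝ) := by
    have h6 : √(2 * Real.log (4 * c.T / c.δ)) ≤ √(2 * (S ^ 2 * c.T)) := by
      refine Real.sqrt_le_sqrt ?_
      have : S ^ 2 = P.supGain c.σ (c.T - 1) + l := Real.sq_sqrt (by positivity)
      rw [this]
      nlinarith
    refine h6.trans (Real.sqrt_le_iff.2 ⟨by positivity, ?_⟩)
    have h7 : (c.T : ℝ) ≤ ((c.T : ℝ) ^ (3 / 4 : ℝ)) ^ 2 := by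
      rw [← Real.rpow_natCast, ← Real.rpow_mul hT0.le]
      calc (c.T : ℝ) = (c.T : ℝ) ^ (1 : ℝ) := (Real.rpow_one _).symm
        _ ≤ _ := Real.rpow_le_rpow_of_exponent_le hTr (by norm_num)
    calc 2 * (S ^ 2 * c.T) ≤ 4 * (S ^ 2 * ((c.T : ℝ) ^ (3 / 4 : ℝ)) ^ 2) := by
          have : S ^ 2 * c.T ≤ S ^ 2 * ((c.T : ℝ) ^ (3 / 4 : ℝ)) ^ 2 := by gcongr
          have : 0 ≤ S ^ 2 * c.T := by positivity
          linarith
      _ = _ := by ring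
  have hS0 : 0 ≤ S := Real.sqrt_nonneg _
  rw [slack, ← mul_assoc, mul_inv_cancel₀ hT0.ne', one_mul]
  calc _ ≤ 2 * S + (c.R + 1) * (2 * S * (c.T : ℝ) ^ (3 / 4 : ℝ)) := by gcongr
    _ ≤ 2 * S * (c.T : ℝ) ^ (3 / 4 : ℝ) + (c.R + 1) * (2 * S * (c.T : ℝ) ^ (3 / 4 : ℝ)) := by
        refine add_le_add ?_ le_rfl
        exact le_mul_of_one_le_right (by positivity) hT34
    _ = _ := by ring

/-- Regret on the good event. -/
lemma Run.regret_le (r : Run μ P c a f) (hR : 0 ≤ c.R) (hσ : 1 ≤ c.σ) (hB : 0 < c.B)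
    (hδ : 0 < c.δ) (hδ1 : c.δ < 1) (hT : 1 ≤ c.T)
    (hf : ∀ θ' ∈ P.Θ, InRKHSBall P.X (P.ker θ') c.B f)
    {xstar : EuclideanSpace ℝ (Fin d)} (hxs : xstar ∈ P.X) {b : ℝ} (hb : 1 ≤ b)
    (hcmp : ∀ θ ∈ P.Θ, ∀ θ' ∈ P.Θ, KernelLE (P.ker θ') (P.ker θ) b)
    {θ : Fin m → ℝ} (hθ : θ ∈ P.Θ)
    {s : Finset (Fin m → ℝ)} (hs : P.IsNet (epsT c.T) ↑s) (hcard : s.card = P.covNum (epsT c.T))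
    {ω : Ω}
    (hg : GoodNoise P c.σ (c.R + (c.T : ℝ)⁻¹) c.δ c.T s (fun n => r.x n ω)
      (fun n => r.noise n ω)) :
    r.regret xstar ω ≤ (4 * (1 + 2 * c.R) * (√b * c.σ) + 4 * (c.R + 2)) *
      regretRate P c.σ c.B c.δ c.T θ := by
  have hσ0 : 0 < c.σ := by linarith
  have hTr : (1 : ℝ) ≤ c.T := by exact_mod_cast hT
  have hT0 : (0 : ℝ) < c.T := by linarith
  have hN := P.one_le_covNum (epsT_pos hT) (epsT_le_one hT)
  have hl := one_le_log_six_mul hN hδ hδ1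
  have hΓ := P.supGain_nonneg hσ (c.T - 1)
  have hγ := P.gain_nonneg hσ c.T hθ
  have hslack := mul_slack_le (P := P) hR hσ hδ hδ1 hT
  let sd : ℕ → ℝ := fun n =>
    postStd (P.ker (r.th n ω)) c.σ (fun i : Fin n => r.x i ω) (r.x n ω)
  have hsd0 : ∀ n, 0 ≤ sd n := fun n => Real.sqrt_nonneg _
  -- The variances belong to a different kernel in every round. Comparing each with the one for the
  -- fixed θ, at the cost of b, allows a single application of the chain rule.
  have hsq : ∑ n ∈ Finset.range c.T, sd n ^ 2 ≤ b * (4 * c.σ ^ 2 * P.gain c.σ c.T θ) := by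
    have h1 : ∀ n ∈ Finset.range c.T, sd n ^ 2
        ≤ b * postVar (P.ker θ) c.σ (fun i : Fin n => r.x i ω) (r.x n ω) := by
      intro n hn
      have hθn : r.th n ω ∈ P.Θ := r.act_net.1 (r.th_mem n (Finset.mem_range.1 hn) ω)
      simp only [sd, postStd]
      rw [Real.sq_sqrt (postVar_nonneg (P.ker_psd hθn) hσ0 _ _)]
      exact postVar_le_of_kernelLE (P.ker_psd hθn) (P.ker_psd hθ) (hcmp θ hθ _ hθn) hb hσ0 _ _
    refine (Finset.sum_le_sum h1).trans ?_
    rw [← Finset.mul_sum]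
    gcongr
    refine (sum_postVar_le (P.ker_psd hθ) (fun _ => P.ker_le_one _ _ _) hσ
      (fun n => r.x n ω) c.T).trans ?_
    gcongr
    exact infoGain_le_maxInfoGain (P.ker_psd hθ) (fun _ => P.ker_le_one _ _ _) hσ _
      fun i => r.x_mem i i.2 ω
  have hsum : ∑ n ∈ Finset.range c.T, sd n ≤ 2 * (√b * c.σ) * √(c.T * P.gain c.σ c.T θ) := by
    have h1 := sq_sum_le_card_mul_sum_sq (s := Finset.range c.T) (f := sd)
    rw [Finset.card_range] at h1
    have h2 : ∑ n ∈ Finset.range c.T, sd n ≤ √(c.T * (b * (4 * c.σ ^ 2 * P.gain c.σ c.T θ))) :=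
      Real.le_sqrt_of_sq_le (h1.trans (by gcongr))
    refine h2.trans (le_of_eq ?_)
    have e : c.T * (b * (4 * c.σ ^ 2 * P.gain c.σ c.T θ))
        = (2 * (√b * c.σ)) ^ 2 * (c.T * P.gain c.σ c.T θ) := by
      rw [mul_pow, mul_pow, Real.sq_sqrt (by linarith)]; ring
    rw [e, Real.sqrt_mul (sq_nonneg _), Real.sqrt_sq (by positivity)]
  set l := Real.log (6 * P.covNum (epsT c.T) / c.δ) with hld
  set S := √(P.supGain c.σ (c.T - 1) + l) with hS
  have hS0 : 0 ≤ S := Real.sqrt_nonneg _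
  -- The additive one inside β is absorbed because l ≥ 1: 2(Γ + 1 + l) ≤ 4(Γ + l).
  have hβ : ∀ n ∈ Finset.range c.T, betaSqrt P c n ≤ (1 + 2 * c.R) * (c.B + S) := by
    intro n hn
    have hn' : n ≤ c.T - 1 := by have := Finset.mem_range.1 hn; omega
    have h1 := P.supGain_mono hσ hn'
    have h2 : √(2 * (P.supGain c.σ n + 1 + l)) ≤ 2 * S := by
      refine Real.sqrt_le_iff.2 ⟨by positivity, ?_⟩
      rw [mul_pow, hS, Real.sq_sqrt (by positivity)]
      linarith
    rw [betaSqrt]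
    have h3 := mul_le_mul_of_nonneg_left h2 hR
    nlinarith [mul_nonneg hR hB.le]
  have hreg : r.regret xstar ω ≤ 2 * ((1 + 2 * c.R) * (c.B + S)) * ∑ n ∈ Finset.range c.T, sd n
      + 2 * (c.T * slack P c) := by
    have h1 : ∀ n ∈ Finset.range c.T, f xstar - f (r.x n ω)
        ≤ 2 * ((1 + 2 * c.R) * (c.B + S)) * sd n + 2 * slack P c := by
      intro n hn
      refine (r.instant_regret_le hR hσ hB hδ hδ1 hT hf hxs hs hcard (hcard ▸ hN) hg
        (Finset.mem_range.1 hn)).trans ?_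
      have := hβ n hn
      have := hsd0 n
      gcongr
    refine (Finset.sum_le_sum h1).trans (le_of_eq ?_)
    rw [Finset.sum_add_distrib, ← Finset.mul_sum, Finset.sum_const, Finset.card_range, nsmul_eq_mul]
    ring
  rw [regretRate, ← hld, ← hS]
  have hT34 := one_le_rpow_three_quarters hT
  set Q := √(c.T * P.gain c.σ c.T θ)
  have hQ : 0 ≤ Q := Real.sqrt_nonneg _
  set U := (c.T : ℝ) ^ (3 / 4 : ℝ)
  have hBS : 0 ≤ c.B + S := by positivity
  have hsb : 0 ≤ √b * c.σ := by positivity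
  calc _ ≤ 2 * ((1 + 2 * c.R) * (c.B + S)) * (2 * (√b * c.σ) * Q)
        + 2 * (2 * (c.R + 2) * S * U) := by
        refine hreg.trans ?_
        gcongr
    _ ≤ 4 * (1 + 2 * c.R) * (√b * c.σ) * ((c.B + S) * (U + Q))
        + 4 * (c.R + 2) * ((c.B + S) * (U + Q)) := by
        refine add_le_add ?_ ?_
        · have : (c.B + S) * Q ≤ (c.B + S) * (U + Q) := by gcongr; linarith
          calc _ = 4 * (1 + 2 * c.R) * (√b * c.σ) * ((c.B + S) * Q) := by ring
            _ ≤ _ := by gcongr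
        · have : S * U ≤ (c.B + S) * (U + Q) := by
            gcongr <;> linarith
          calc _ = 4 * (c.R + 2) * (S * U) := by ring
            _ ≤ _ := by gcongr
    _ = _ := by ring

end Regret

/-! ### Determinants of perturbed low-rank matrices -/

section LogDet

open Matrix

variable {n : ℕ}

lemma prod_le_pow_card_ne {ι : Type*} [Fintype ι] {l : ι → ℝ} {t : ℝ} (hl : ∀ i, 0 ≤ l i)
    (ht : ∀ i, l i ≤ t) : ∏ i, (1 + l i) ≤ (1 + t) ^ (Fintype.card {i // l i ≠ 0}) := by
  classical
  rw [Fintype.card_subtype, ← Finset.prod_const, Finset.prod_filter]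
  refine Finset.prod_le_prod (fun i _ => by linarith [hl i]) fun i _ => ?_
  split_ifs with h
  · linarith [ht i]
  · rw [not_not] at h; rw [h]; simp

/-- The characteristic polynomial evaluated at -1, with the signs cancelled. -/
lemma det_one_add_eq_prod {M : Matrix (Fin n) (Fin n) ℝ} (hM : M.IsHermitian) :
    (1 + M).det = ∏ i, (1 + hM.eigenvalues i) := by
  have h := congrArg (Polynomial.eval (-1)) hM.charpoly_eq
  rw [eval_charpoly, Polynomial.eval_prod] at h
  simp only [Polynomial.eval_sub, Polynomial.eval_X, Polynomial.eval_C, RCLike.ofReal_real_eq_id,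
    id] at h
  have e1 : (scalar (Fin n) (-1 : ℝ) - M) = -(1 + M) := by
    simp only [map_neg, map_one]; abel
  have e2 : ∀ i, (-1 - hM.eigenvalues i) = -(1 + hM.eigenvalues i) := fun i => by ring
  rw [e1, det_neg, Fintype.card_fin] at h
  simp_rw [e2] at h
  rw [Finset.prod_neg, Finset.card_univ, Fintype.card_fin] at h
  exact mul_left_cancel₀ (pow_ne_zero n (by norm_num)) h

/-- At most rank-many eigenvalues differ from zero, and each is at most the trace. -/
lemma det_one_add_le {M : Matrix (Fin n) (Fin n) ℝ} (hM : M.PosSemidef) {D : ℕ}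
    (hD : M.rank ≤ D) : (1 + M).det ≤ (1 + M.trace) ^ D := by
  have hsum : M.trace = ∑ i, hM.1.eigenvalues i := by
    simpa using hM.1.trace_eq_sum_eigenvalues
  have hl := hM.eigenvalues_nonneg
  have ht : 0 ≤ M.trace := hM.trace_nonneg
  rw [det_one_add_eq_prod hM.1]
  refine (prod_le_pow_card_ne hl fun i => ?_).trans
    (pow_le_pow_right₀ (by linarith) (hM.1.rank_eq_card_non_zero_eigs ▸ hD))
  rw [hsum]
  exact Finset.single_le_sum (fun j _ => hl j) (Finset.mem_univ i)

lemma log_det_le_trace_sub {M : Matrix (Fin n) (Fin n) ℝ} (hM : M.PosDef) :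
    Real.log M.det ≤ M.trace - n := by
  have h1 : M.det = ∏ i, hM.1.eigenvalues i := by simpa using hM.1.det_eq_prod_eigenvalues
  have h2 : M.trace = ∑ i, hM.1.eigenvalues i := by simpa using hM.1.trace_eq_sum_eigenvalues
  rw [h1, h2, Real.log_prod fun i _ => (hM.eigenvalues_pos i).ne']
  calc _ ≤ ∑ i, (hM.1.eigenvalues i - 1) :=
        Finset.sum_le_sum fun i _ => Real.log_le_sub_one_of_pos (hM.eigenvalues_pos i)
    _ = _ := by simp

open scoped MatrixOrder in
lemma exists_eq_conjTranspose_mul_self {M : Matrix (Fin n) (Fin n) ℝ} (hM : M.PosSemidef) :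
    ∃ Y : Matrix (Fin n) (Fin n) ℝ, M = Yᴴ * Y :=
  CStarAlgebra.nonneg_iff_eq_star_mul_self.mp hM.nonneg

lemma trace_mul_nonneg {M Z : Matrix (Fin n) (Fin n) ℝ} (hM : M.PosSemidef) (hZ : Z.PosSemidef) :
    0 ≤ (M * Z).trace := by
  obtain ⟨Y, rfl⟩ := exists_eq_conjTranspose_mul_self hM
  rw [Matrix.mul_assoc, trace_mul_comm]
  exact (hZ.mul_mul_conjTranspose_same Y).trace_nonneg

/-- Concavity of log det: the tangent at S lies above the graph. Conjugation by a factor Y with S⁻¹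
= YᴴY reduces it to S = 1, where it is log λ ≤ λ - 1 on eigenvalues. -/
lemma log_det_le_log_det_add {X S : Matrix (Fin n) (Fin n) ℝ} (hX : X.PosDef) (hS : S.PosDef) :
    Real.log X.det ≤ Real.log S.det + ((S⁻¹ * X).trace - n) := by
  obtain ⟨Y, hY⟩ := exists_eq_conjTranspose_mul_self hS.inv.posSemidef
  have hdetS := hS.det_pos
  have hdet : (Y * X * Yᴴ).det = S.det⁻¹ * X.det := by
    rw [det_mul, det_mul, mul_comm, ← mul_assoc, ← det_mul, ← hY, det_nonsing_inv,
      Ring.inverse_eq_inv']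
  have hpos : 0 < (Y * X * Yᴴ).det := by
    rw [hdet]; exact mul_pos (inv_pos.2 hdetS) hX.det_pos
  have hpd : (Y * X * Yᴴ).PosDef :=
    ((hX.posSemidef.mul_mul_conjTranspose_same Y).posDef_iff_det_ne_zero).2 hpos.ne'
  have h := log_det_le_trace_sub hpd
  rw [hdet, Real.log_mul (inv_pos.2 hdetS).ne' hX.det_pos.ne', Real.log_inv] at h
  have ht : (Y * X * Yᴴ).trace = (S⁻¹ * X).trace := by
    rw [trace_mul_comm, ← Matrix.mul_assoc, ← hY]
  rw [ht] at h
  linarith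

/-- Since 1 - (1 + M)⁻¹ = (1 + M)⁻¹(M + M²)(1 + M)⁻¹. -/
lemma one_sub_inv_posSemidef {M : Matrix (Fin n) (Fin n) ℝ} (hM : M.PosSemidef) :
    (1 - (1 + M)⁻¹).PosSemidef := by
  have hS : (1 + M).PosDef := PosDef.one.add_posSemidef hM
  have hu : IsUnit (1 + M).det := (isUnit_iff_isUnit_det _).1 hS.isUnit
  have hMM : (M * M).PosSemidef := by
    have := posSemidef_conjTranspose_mul_self M
    rwa [hM.1.eq] at this
  have h := (hM.add hMM).conjTranspose_mul_mul_same (1 + M)⁻¹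
  rw [hS.inv.1.eq] at h
  have e : (1 + M)⁻¹ * (M + M * M) * (1 + M)⁻¹ = 1 - (1 + M)⁻¹ := by
    have e1 : M + M * M = (1 + M) * ((1 + M) - 1) := by noncomm_ring
    rw [e1, ← Matrix.mul_assoc, nonsing_inv_mul _ hu, Matrix.one_mul, Matrix.sub_mul,
      mul_nonsing_inv _ hu, Matrix.one_mul]
  rwa [e] at h

/-- If `A ≤ M + Q` then `log det (1 + A) ≤ log det (1 + M) + tr Q`. -/
lemma log_det_one_add_le {A M Q : Matrix (Fin n) (Fin n) ℝ} (hA : A.PosSemidef)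
    (hM : M.PosSemidef) (hQ : Q.PosSemidef) (h : (M + Q - A).PosSemidef) :
    Real.log (1 + A).det ≤ Real.log (1 + M).det + Q.trace := by
  have hS : (1 + M).PosDef := PosDef.one.add_posSemidef hM
  have hX : (1 + A).PosDef := PosDef.one.add_posSemidef hA
  have hu : IsUnit (1 + M).det := (isUnit_iff_isUnit_det _).1 hS.isUnit
  -- Tangent at 1 + M. The trace of (1 + M)⁻¹(1 + A) is at most n + tr((1 + M)⁻¹Q), and (1 + M)⁻¹ ≤
  -- 1 leaves n + tr Q.
  have h1 := log_det_le_log_det_add hX hS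
  have h2 := trace_mul_nonneg hS.inv.posSemidef h
  have h3 := trace_mul_nonneg (one_sub_inv_posSemidef hM) hQ
  have e1 : (1 + M)⁻¹ * (1 + A) = 1 + (1 + M)⁻¹ * Q - (1 + M)⁻¹ * (M + Q - A) := by
    have : 1 + A = (1 + M) + Q - (M + Q - A) := by abel
    conv_lhs => rw [this]
    rw [Matrix.mul_sub, Matrix.mul_add, nonsing_inv_mul _ hu]
  rw [e1, trace_sub, trace_add, trace_one, Fintype.card_fin] at h1
  rw [Matrix.sub_mul, Matrix.one_mul, trace_sub] at h3
  linarith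

end LogDet

/-! ### Gram matrices of random features -/

section Features

open Matrix ComplexConjugate

variable {S : Type*} [MeasurableSpace S] (μ : Measure S) {n : ℕ}

/-- Gram matrix of complex features under the measure `μ`. -/
def featGram {ι : Type*} (φ : ι → S → ℂ) : Matrix ι ι ℝ :=
  of fun i j => ∫ s, (φ i s * conj (φ j s)).re ∂μ

/-- Bounded measurable features. -/
def BddFeat {ι : Type*} (φ : ι → S → ℂ) : Prop :=
  ∀ i, Measurable (φ i) ∧ ∃ b, ∀ s, ‖φ i s‖ ≤ b

variable {μ}

lemma BddFeat.integrable [IsProbabilityMeasure μ] {ι : Type*} {φ : ι → S → ℂ} (h : BddFeat φ) (i j : ι) :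
    Integrable (fun s => φ i s * conj (φ j s)) μ := by
  obtain ⟨b, hb⟩ := (h i).2
  obtain ⟨b', hb'⟩ := (h j).2
  refine Integrable.of_bound (C := b * b') ?_ (ae_of_all _ fun s => ?_)
  · exact ((h i).1.mul (Complex.continuous_conj.measurable.comp (h j).1)).aestronglyMeasurable
  · rw [norm_mul, RCLike.norm_conj]
    exact mul_le_mul (hb s) (hb' s) (norm_nonneg _) ((norm_nonneg _).trans (hb s))

lemma BddFeat.integrable_re [IsProbabilityMeasure μ] {ι : Type*} {φ : ι → S → ℂ} (h : BddFeat φ) (i j : ι) :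
    Integrable (fun s => (φ i s * conj (φ j s)).re) μ := (h.integrable i j).re

lemma normSq_sum_eq {φ : Fin n → ℂ} (c : Fin n → ℝ) :
    ‖∑ i, (c i : ℂ) * φ i‖ ^ 2 = ∑ i, ∑ j, c i * c j * (φ i * conj (φ j)).re := by
  apply Complex.ofReal_injective
  have h : ((‖∑ i, (c i : ℂ) * φ i‖ ^ 2 : ℝ) : ℂ)
      = ∑ i, ∑ j, ((c i * c j : ℝ) : ℂ) * (φ i * conj (φ j)) := by
    rw [Complex.ofReal_pow, ← Complex.mul_conj', map_sum, Finset.sum_mul_sum]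
    refine Finset.sum_congr rfl fun i _ => Finset.sum_congr rfl fun j _ => ?_
    rw [map_mul, Complex.conj_ofReal]; push_cast; ring
  have h' := congrArg Complex.re h
  rw [Complex.ofReal_re] at h'
  rw [h']
  congr 1
  simp only [Complex.re_sum, Complex.re_ofReal_mul]

lemma featGram_quad [IsProbabilityMeasure μ] {φ : Fin n → S → ℂ} (h : BddFeat φ) (c : Fin n → ℝ) :
    c ⬝ᵥ featGram μ φ *ᵥ c = ∫ s, ‖∑ i, (c i : ℂ) * φ i s‖ ^ 2 ∂μ ∧
      Integrable (fun s => ‖∑ i, (c i : ℂ) * φ i s‖ ^ 2) μ := by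
  have hint : ∀ i j, Integrable (fun s => c i * c j * (φ i s * conj (φ j s)).re) μ := fun i j =>
    (h.integrable_re i j).const_mul _
  have e : (fun s => ‖∑ i, (c i : ℂ) * φ i s‖ ^ 2)
      = fun s => ∑ i, ∑ j, c i * c j * (φ i s * conj (φ j s)).re :=
    funext fun s => normSq_sum_eq c
  rw [e]
  refine ⟨?_, integrable_finsetSum _ fun i _ => integrable_finsetSum _ fun j _ => hint i j⟩
  rw [integral_finsetSum _ fun i _ => integrable_finsetSum _ fun j _ => hint i j]
  simp only [dotProduct, mulVec, featGram, of_apply, Finset.mul_sum]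
  refine Finset.sum_congr rfl fun i _ => ?_
  rw [integral_finsetSum _ fun j _ => hint i j]
  refine Finset.sum_congr rfl fun j _ => ?_
  rw [integral_const_mul]; ring

lemma featGram_psd [IsProbabilityMeasure μ] {φ : Fin n → S → ℂ} (h : BddFeat φ) : (featGram μ φ).PosSemidef := by
  refine PosSemidef.of_dotProduct_mulVec_nonneg ?_ fun c => ?_
  · ext i j
    simp only [conjTranspose_apply, featGram, of_apply, star_trivial]
    refine integral_congr_ae (ae_of_all _ fun s => ?_)
    simp only [Complex.mul_re, Complex.conj_re, Complex.conj_im]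
    ring
  · rw [star_trivial, (featGram_quad h c).1]
    exact integral_nonneg fun s => by positivity

lemma featGram_diag {φ : Fin n → S → ℂ} (i : Fin n) :
    featGram μ φ i i = ∫ s, ‖φ i s‖ ^ 2 ∂μ := by
  simp only [featGram, of_apply]
  refine integral_congr_ae (ae_of_all _ fun s => ?_)
  have : (φ i s * conj (φ i s)) = ((‖φ i s‖ ^ 2 : ℝ) : ℂ) := by
    rw [Complex.mul_conj']; push_cast; rfl
  simp only
  rw [this, Complex.ofReal_re]

/-- The Gram matrix factors through the Gram matrix of the finitely many spanning features. -/
lemma featGram_rank_le [IsProbabilityMeasure μ] {ι : Type*} [Fintype ι] {φ : Fin n → S → ℂ} {g : ι → S → ℂ}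
    (hg : BddFeat g) (V : Matrix (Fin n) ι ℝ) (h : ∀ i s, φ i s = ∑ α, (V i α : ℂ) * g α s) :
    (featGram μ φ).rank ≤ Fintype.card ι := by
  have e : featGram μ φ = V * (featGram μ g * Vᵀ) := by
    ext i j
    have hint : ∀ α β, Integrable (fun s => V i α * V j β * (g α s * conj (g β s)).re) μ :=
      fun α β => (hg.integrable_re α β).const_mul _
    have hpt : ∀ s, (φ i s * conj (φ j s)).re
        = ∑ α, ∑ β, V i α * V j β * (g α s * conj (g β s)).re := by
      intro s
      rw [h, h, map_sum, Finset.sum_mul_sum, Complex.re_sum]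
      refine Finset.sum_congr rfl fun α _ => ?_
      rw [Complex.re_sum]
      refine Finset.sum_congr rfl fun β _ => ?_
      rw [map_mul, Complex.conj_ofReal, ← Complex.re_ofReal_mul]
      congr 1
      push_cast
      ring
    simp only [featGram, of_apply]
    simp_rw [hpt]
    rw [integral_finsetSum _ fun α _ => integrable_finsetSum _ fun β _ => hint α β]
    simp only [mul_apply, of_apply, transpose_apply, Finset.mul_sum]
    refine Finset.sum_congr rfl fun α _ => ?_
    rw [integral_finsetSum _ fun β _ => hint α β]
    refine Finset.sum_congr rfl fun β _ => ?_
    rw [integral_const_mul]; ring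
  rw [e]
  exact (rank_mul_le_left _ _).trans (rank_le_card_width _)

/-- Log-determinant of a feature Gram matrix that is close to a low-rank one. -/
lemma log_det_featGram_le [IsProbabilityMeasure μ] {ι : Type*} [Fintype ι] {φ p : Fin n → S → ℂ} {g : ι → S → ℂ}
    (hφ : BddFeat φ) (hp : BddFeat p) (hg : BddFeat g) (V : Matrix (Fin n) ι ℝ)
    (h : ∀ i s, p i s = ∑ α, (V i α : ℂ) * g α s) {b η κ : ℝ} (hκ0 : 0 ≤ κ) (hκ : κ ≤ 1)
    (hb : ∀ i s, ‖p i s‖ ≤ b) (hη : ∀ i, ∫ s, ‖φ i s - p i s‖ ^ 2 ∂μ ≤ η) :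
    Real.log (1 + κ • featGram μ φ).det
      ≤ Fintype.card ι * Real.log (1 + n * (2 * b ^ 2)) + n * (2 * η) := by
  have hq : BddFeat fun i s => φ i s - p i s := fun i => by
    obtain ⟨b₁, h₁⟩ := (hφ i).2
    exact ⟨(hφ i).1.sub (hp i).1, b₁ + b, fun s => (norm_sub_le _ _).trans
      (add_le_add (h₁ s) (hb i s))⟩
  set M := (2 : ℝ) • featGram μ p with hM
  set Q := (2 : ℝ) • featGram μ (fun i s => φ i s - p i s) with hQ
  have hMp : M.PosSemidef := (featGram_psd hp).smul (by norm_num)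
  have hQp : Q.PosSemidef := (featGram_psd hq).smul (by norm_num)
  have hAp : (κ • featGram μ φ).PosSemidef := (featGram_psd hφ).smul hκ0
  -- Pointwise |u + v|² ≤ 2|u|² + 2|v|², with u from the approximating features and v from the
  -- remainder; this explains the factors 2 in M and Q.
  have hle : (M + Q - κ • featGram μ φ).PosSemidef := by
    refine PosSemidef.of_dotProduct_mulVec_nonneg ((hMp.1.add hQp.1).sub hAp.1) fun c => ?_
    rw [star_trivial, sub_mulVec, add_mulVec, dotProduct_sub, dotProduct_add, hM, hQ, smul_mulVec,
      smul_mulVec, smul_mulVec, dotProduct_smul, dotProduct_smul, dotProduct_smul,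
      (featGram_quad hp c).1, (featGram_quad hq c).1, (featGram_quad hφ c).1, smul_eq_mul,
      smul_eq_mul, smul_eq_mul, ← integral_const_mul, ← integral_const_mul, ← integral_const_mul,
      ← integral_add ((featGram_quad hp c).2.const_mul _) ((featGram_quad hq c).2.const_mul _),
      sub_nonneg]
    refine integral_mono ((featGram_quad hφ c).2.const_mul _)
      (((featGram_quad hp c).2.const_mul _).add ((featGram_quad hq c).2.const_mul _)) fun s => ?_
    have e : ∑ i, (c i : ℂ) * φ i s = ∑ i, (c i : ℂ) * p i s
        + ∑ i, (c i : ℂ) * (φ i s - p i s) := by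
      rw [← Finset.sum_add_distrib]
      exact Finset.sum_congr rfl fun i _ => by ring
    simp only
    rw [e]
    set u := ∑ i, (c i : ℂ) * p i s
    set v := ∑ i, (c i : ℂ) * (φ i s - p i s)
    have h1 : ‖u + v‖ ^ 2 ≤ (‖u‖ + ‖v‖) ^ 2 := by gcongr; exact norm_add_le _ _
    have h2 : κ * ‖u + v‖ ^ 2 ≤ ‖u + v‖ ^ 2 := mul_le_of_le_one_left (by positivity) hκ
    nlinarith [sq_nonneg (‖u‖ - ‖v‖)]
  have h1 := log_det_one_add_le hAp hMp hQp hle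
  have htrM : M.trace ≤ n * (2 * b ^ 2) := by
    rw [hM, trace_smul, trace, smul_eq_mul]
    have : ∀ i, (featGram μ p).diag i ≤ b ^ 2 := by
      intro i
      rw [diag_apply, featGram_diag]
      have h2 : ∫ s, ‖p i s‖ ^ 2 ∂μ ≤ ∫ _, b ^ 2 ∂μ := by
        refine integral_mono_of_nonneg (ae_of_all _ fun s => by positivity) (integrable_const _)
          (ae_of_all _ fun s => ?_)
        exact pow_le_pow_left₀ (norm_nonneg _) (hb i s) 2
      simpa using h2
    calc _ ≤ 2 * ∑ _i : Fin n, b ^ 2 := by gcongr with i; exact this i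
      _ = _ := by simp; ring
  have htrQ : Q.trace ≤ n * (2 * η) := by
    rw [hQ, trace_smul, trace, smul_eq_mul]
    have : ∀ i, (featGram μ fun i s => φ i s - p i s).diag i ≤ η := by
      intro i
      rw [diag_apply, featGram_diag]
      exact hη i
    calc _ ≤ 2 * ∑ _i : Fin n, η := by gcongr with i; exact this i
      _ = _ := by simp; ring
  have hrank : M.rank ≤ Fintype.card ι := by
    have e : M = featGram μ p * ((2 : ℝ) • (1 : Matrix (Fin n) (Fin n) ℝ)) := by
      rw [hM, Matrix.mul_smul, Matrix.mul_one]
    rw [e]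
    exact (rank_mul_le_left _ _).trans (featGram_rank_le hg V h)
  have hdet := det_one_add_le hMp hrank
  have hpos : 0 < (1 + M).det := (PosDef.one.add_posSemidef hMp).det_pos
  have h2 : Real.log (1 + M).det ≤ Fintype.card ι * Real.log (1 + n * (2 * b ^ 2)) := by
    have ht := hMp.trace_nonneg
    calc _ ≤ Real.log ((1 + M.trace) ^ Fintype.card ι) := Real.log_le_log hpos hdet
      _ = Fintype.card ι * Real.log (1 + M.trace) := Real.log_pow _ _
      _ ≤ _ := by
        gcongr
  linarith

end Features

/-! ### Spectral features of the Matérn kernel -/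

section Spectral

open Complex ComplexConjugate

variable {ν : ℝ} {d m : ℕ}

/-- The Gamma distribution of shape `ν` and rate one, which mixes the Gaussian kernels. -/
def mixMeasure (ν : ℝ) : Measure ℝ :=
  (volume.restrict (Set.Ioi 0)).withDensity fun u =>
    ENNReal.ofReal ((Real.Gamma ν)⁻¹ * mixDensity ν u)

lemma measurable_mixDensity : Measurable (mixDensity ν) := by
  unfold mixDensity; fun_prop

lemma toReal_ofReal_mixDensity (hν : 0 < ν) {u : ℝ} (hu : u ∈ Set.Ioi (0 : ℝ)) :
    (ENNReal.ofReal ((Real.Gamma ν)⁻¹ * mixDensity ν u)).toReal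
      = (Real.Gamma ν)⁻¹ * mixDensity ν u :=
  ENNReal.toReal_ofReal
    (mul_nonneg (inv_nonneg.2 (Real.Gamma_pos_of_pos hν).le) (mixDensity_nonneg hu))

lemma integral_mixMeasure (hν : 0 < ν) (h : ℝ → ℝ) :
    ∫ u, h u ∂mixMeasure ν = (Real.Gamma ν)⁻¹ * ∫ u in Set.Ioi 0, mixDensity ν u * h u := by
  rw [mixMeasure, integral_withDensity_eq_integral_toReal_smul
    (measurable_mixDensity.const_mul _).ennreal_ofReal (by simp), ← integral_const_mul]
  refine setIntegral_congr_fun measurableSet_Ioi fun u hu => ?_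
  rw [toReal_ofReal_mixDensity hν hu, smul_eq_mul, mul_assoc]

lemma integrable_mixMeasure_iff (hν : 0 < ν) {h : ℝ → ℝ} : Integrable h (mixMeasure ν) ↔
    IntegrableOn (fun u => mixDensity ν u * h u) (Set.Ioi 0) := by
  have hΓ := Real.Gamma_pos_of_pos hν
  rw [mixMeasure, integrable_withDensity_iff_integrable_smul'
    (measurable_mixDensity.const_mul _).ennreal_ofReal (by simp),
    IntegrableOn, ← integrable_const_mul_iff (f := fun u => mixDensity ν u * h u)
      (IsUnit.mk0 (Real.Gamma ν)⁻¹ (by positivity))]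
  refine integrable_congr ((ae_restrict_mem measurableSet_Ioi).mono fun u hu => ?_)
  simp only
  rw [toReal_ofReal_mixDensity hν hu, smul_eq_mul, mul_assoc]

lemma isProbabilityMeasure_mixMeasure (hν : 0 < ν) : IsProbabilityMeasure (mixMeasure ν) := by
  have hΓ := Real.Gamma_pos_of_pos hν
  refine ⟨?_⟩
  rw [mixMeasure, withDensity_apply _ MeasurableSet.univ, Measure.restrict_univ,
    ← ofReal_integral_eq_lintegral_ofReal ((integrableOn_mixDensity hν).const_mul _)
      ((ae_restrict_mem measurableSet_Ioi).mono fun u hu =>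
        mul_nonneg (inv_nonneg.2 hΓ.le) (mixDensity_nonneg hu)),
    integral_const_mul, integral_mixDensity hν, inv_mul_cancel₀ hΓ.ne', ENNReal.ofReal_one]

lemma mixMeasure_pos : ∀ᵐ u ∂mixMeasure ν, 0 < u :=
  (withDensity_absolutelyContinuous _ _).ae_le (ae_restrict_mem measurableSet_Ioi)

/-- The weight u^(-κ) turns a Gamma density of shape ν into one of shape ν - κ, still integrable.
This limits the tail exponent of the frequencies to κ < ν. -/
lemma integrable_rpow_neg_mixMeasure {κ : ℝ} (hν : 0 < ν) (hκ : κ < ν) :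
    Integrable (fun u => (ν / u) ^ κ) (mixMeasure ν) := by
  rw [integrable_mixMeasure_iff hν]
  refine ((integrableOn_mixDensity (sub_pos.2 hκ)).const_mul (ν ^ κ)).congr
    ((ae_restrict_mem measurableSet_Ioi).mono fun u hu => ?_)
  have hu' : (0 : ℝ) < u := hu
  simp only [mixDensity]
  rw [Real.div_rpow hν.le hu'.le, show ν - κ - 1 = ν - 1 - κ by ring, Real.rpow_sub hu']
  ring

/-- The law of the frequencies: a Gamma variable and independent standard Gaussians. -/
def specMeasure (ν : ℝ) (d : ℕ) : Measure (ℝ × (Fin d → ℝ)) :=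
  (mixMeasure ν).prod (Measure.pi fun _ => gaussianReal 0 1)

lemma isProbabilityMeasure_specMeasure (hν : 0 < ν) : IsProbabilityMeasure (specMeasure ν d) := by
  have := isProbabilityMeasure_mixMeasure hν
  rw [specMeasure]; infer_instance

/-- The frequency in direction `i`. -/
def freq (ν : ℝ) (s : ℝ × (Fin d → ℝ)) (i : Fin d) : ℝ := √(ν / s.1) * s.2 i

lemma measurable_freq (i : Fin d) : Measurable fun s => freq ν s i := by
  unfold freq; fun_prop

/-- The plane wave with frequency `s` at the point `ξ`. -/
def wave (ν : ℝ) (ξ : Fin d → ℝ) (s : ℝ × (Fin d → ℝ)) : ℂ := ∏ i, cexp (freq ν s i * ξ i * I)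

lemma measurable_wave (ξ : Fin d → ℝ) : Measurable (wave ν ξ) := by
  unfold wave
  refine Finset.measurable_prod _ fun i _ => ?_
  have := measurable_freq (ν := ν) i
  fun_prop

lemma norm_wave (ξ : Fin d → ℝ) (s : ℝ × (Fin d → ℝ)) : ‖wave ν ξ s‖ = 1 := by
  rw [wave, norm_prod]
  refine Finset.prod_eq_one fun i _ => ?_
  rw [← Complex.ofReal_mul, Complex.norm_exp_ofReal_mul_I]

lemma wave_mul_conj (ξ ξ' : Fin d → ℝ) (s : ℝ × (Fin d → ℝ)) :
    wave ν ξ s * conj (wave ν ξ' s) = wave ν (ξ - ξ') s := by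
  rw [wave, wave, wave, map_prod, ← Finset.prod_mul_distrib]
  refine Finset.prod_congr rfl fun i _ => ?_
  rw [← Complex.exp_conj, ← Complex.exp_add]
  congr 1
  simp only [map_mul, Complex.conj_ofReal, Complex.conj_I, Pi.sub_apply]
  push_cast; ring

/-- Given u the frequencies are independent centred Gaussians of variance ν/u, so the inner integral
is a characteristic function. Averaging over u recovers the Gaussian mixture. Lengthscales enter
only through ξ, so one spectral law serves all of Θ. -/
lemma integral_wave (hν : 0 < ν) (ξ : Fin d → ℝ) :
    ∫ s, (wave ν ξ s).re ∂specMeasure ν d = (Real.Gamma ν)⁻¹ * maternProfile ν (∑ i, ξ i ^ 2) := by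
  have := isProbabilityMeasure_mixMeasure hν
  have hint : Integrable (wave ν ξ) ((mixMeasure ν).prod (Measure.pi fun _ => gaussianReal 0 1)) :=
    Integrable.of_bound (C := 1) (measurable_wave ξ).aestronglyMeasurable
      (ae_of_all _ fun s => (norm_wave ξ s).le)
  have hin : ∀ u, 0 < u → ∫ z, (wave ν ξ (u, z)).re ∂(Measure.pi fun _ => gaussianReal 0 1)
      = Real.exp (-(ν / (2 * u) * ∑ i, ξ i ^ 2)) := by
    intro u hu
    have hi : Integrable (fun z => wave ν ξ (u, z)) (Measure.pi fun _ => gaussianReal 0 1) :=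
      Integrable.of_bound (C := 1)
        ((measurable_wave ξ).comp measurable_prodMk_left).aestronglyMeasurable
        (ae_of_all _ fun s => (norm_wave ξ _).le)
    have h2 : ∫ z, wave ν ξ (u, z) ∂(Measure.pi fun _ => gaussianReal 0 1)
        = (Real.exp (-(ν / (2 * u) * ∑ i, ξ i ^ 2)) : ℂ) := by
      have e : ∀ z, wave ν ξ (u, z)
          = ∏ i, (fun i (w : ℝ) => cexp (((√(ν / u) * ξ i : ℝ) : ℂ) * w * I)) i (z i) := by
        intro z
        refine Finset.prod_congr rfl fun i _ => ?_
        simp only [freq]; push_cast; ring_nf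
      simp_rw [e]
      rw [integral_fintype_prod_eq_prod
        (fun i (w : ℝ) => cexp (((√(ν / u) * ξ i : ℝ) : ℂ) * w * I))]
      simp_rw [← charFun_apply_real, charFun_gaussianReal]
      rw [← Complex.exp_sum, Complex.ofReal_exp, Finset.mul_sum, ← Finset.sum_neg_distrib]
      push_cast
      congr 1
      refine Finset.sum_congr rfl fun i _ => ?_
      have h3 : ((√(ν / u) : ℝ) : ℂ) ^ 2 = (ν : ℂ) / u := by
        rw [← Complex.ofReal_pow, Real.sq_sqrt (by positivity)]; push_cast; rfl
      rw [mul_pow, h3]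
      have : (u : ℂ) ≠ 0 := by exact_mod_cast hu.ne'
      field_simp
      ring
    have h3 := integral_re hi
    simp only [RCLike.re_eq_complex_re] at h3
    rw [h3, h2]
    exact Complex.ofReal_re _
  rw [specMeasure, integral_prod (fun s => (wave ν ξ s).re) hint.re]
  rw [integral_congr_ae (mixMeasure_pos.mono fun u hu => hin u hu), integral_mixMeasure hν]
  rfl

/-- The Gram matrix of a Matérn kernel is the Gram matrix of its plane waves. -/
lemma gram_matern_eq (hν : 0 < ν) (var : ℝ) (grp : Fin d → Fin m) (θ : Fin m → ℝ) {n : ℕ}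
    (x : Fin n → EuclideanSpace ℝ (Fin d)) :
    gram (matern ν var grp θ) x
      = var • featGram (specMeasure ν d) fun j => wave ν fun i => x j i / θ (grp i) := by
  ext j l
  simp only [gram, Matrix.of_apply, Matrix.smul_apply, featGram, wave_mul_conj, smul_eq_mul]
  rw [integral_wave hν, matern_eq hν]
  simp only [Pi.sub_apply, sub_div]
  ring

/-- Polynomial tails of the frequencies. -/
lemma exists_specMeasure_tail_le {κ : ℝ} (hν : 0 < ν) (hκ0 : 0 < κ) (hκ : κ < ν) :
    ∃ C : ℝ, 0 ≤ C ∧ ∀ Ω : ℝ, 0 < Ω →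
      (specMeasure ν d).real {s | Ω < ∑ i, |freq ν s i|} ≤ C * Ω ^ (-(2 * κ)) := by
  have := isProbabilityMeasure_mixMeasure hν
  have := isProbabilityMeasure_specMeasure (d := d) hν
  have hz : Integrable (fun z : Fin d → ℝ => (∑ i, |z i|) ^ (2 * κ))
      (Measure.pi fun _ => gaussianReal 0 1) := by
    have hp : MemLp (fun z : Fin d → ℝ => ∑ i, |z i|) (ENNReal.ofReal (2 * κ))
        (Measure.pi fun _ => gaussianReal 0 1) := by
      refine memLp_finsetSum _ fun i _ => ?_
      have h1 := (memLp_id_gaussianReal' (μ := 0) (v := 1) (ENNReal.ofReal (2 * κ))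
        ENNReal.ofReal_ne_top).comp_measurePreserving
        (measurePreserving_eval (fun _ : Fin d => gaussianReal 0 1) i)
      exact h1.norm
    have h2 := hp.integrable_norm_rpow (by simpa using hκ0) ENNReal.ofReal_ne_top
    rw [ENNReal.toReal_ofReal (by positivity)] at h2
    refine h2.congr (ae_of_all _ fun z => ?_)
    simp only
    rw [Real.norm_of_nonneg (Finset.sum_nonneg fun i _ => abs_nonneg _)]
  -- Markov's inequality for the 2κ-th moment of ∑|freq|; by independence it splits into a Gamma
  -- moment and a Gaussian moment.
  have hH := (integrable_rpow_neg_mixMeasure hν hκ).mul_prod hz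
  set H : ℝ × (Fin d → ℝ) → ℝ := fun s => (ν / s.1) ^ κ * (∑ i, |s.2 i|) ^ (2 * κ) with hHdef
  have hpos : ∀ᵐ s ∂specMeasure ν d, 0 < s.1 :=
    Measure.quasiMeasurePreserving_fst.ae (mixMeasure_pos (ν := ν))
  have hH0 : 0 ≤ᵐ[specMeasure ν d] H := by
    filter_upwards [hpos] with s hs
    have : 0 ≤ ∑ i, |s.2 i| := Finset.sum_nonneg fun i _ => abs_nonneg _
    simp only [hHdef, Pi.zero_apply]
    positivity
  refine ⟨∫ s, H s ∂specMeasure ν d, integral_nonneg_of_ae hH0, fun Ω hΩ => ?_⟩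
  have h1 := mul_meas_ge_le_integral_of_nonneg hH0 hH (Ω ^ (2 * κ))
  have h2 : (specMeasure ν d).real {s | Ω < ∑ i, |freq ν s i|}
      ≤ (specMeasure ν d).real {s | Ω ^ (2 * κ) ≤ H s} := by
    refine ENNReal.toReal_mono (measure_ne_top _ _) (measure_mono_ae ?_)
    filter_upwards [hpos] with s hs h
    have h : Ω < ∑ i, |freq ν s i| := h
    change Ω ^ (2 * κ) ≤ H s
    have hq : 0 ≤ ν / s.1 := by positivity
    have e : ∑ i, |freq ν s i| = √(ν / s.1) * ∑ i, |s.2 i| := by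
      rw [Finset.mul_sum]
      refine Finset.sum_congr rfl fun i _ => ?_
      rw [freq, abs_mul, abs_of_nonneg (Real.sqrt_nonneg _)]
    have e2 : H s = (∑ i, |freq ν s i|) ^ (2 * κ) := by
      have : 0 ≤ ∑ i, |s.2 i| := Finset.sum_nonneg fun i _ => abs_nonneg _
      rw [e, Real.mul_rpow (Real.sqrt_nonneg _) this, Real.sqrt_eq_rpow, ← Real.rpow_mul hq,
        show 1 / 2 * (2 * κ) = κ by ring]
    rw [e2]
    exact Real.rpow_le_rpow hΩ.le h.le (by positivity)
  rw [Real.rpow_neg hΩ.le, ← div_eq_mul_inv, le_div_iff₀ (by positivity)]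
  calc _ ≤ (specMeasure ν d).real {s | Ω ^ (2 * κ) ≤ H s} * Ω ^ (2 * κ) := by gcongr
    _ ≤ _ := by rw [mul_comm]; exact h1

end Spectral

/-! ### Low-rank approximation of the spectral features -/

section LowRank

open Complex

variable {ν : ℝ} {d m : ℕ}

/-- Truncated exponential series at `t * I`. -/
def expTaylor (N : ℕ) (t : ℂ) : ℂ := ∑ a : Fin N, (t * I) ^ (a : ℕ) / (a : ℕ).factorial

/-- The remainder is at most 2|t|^N/N!. From (3y)^N/N! ≤ e^(3y) and e^N ≤ 3^N it is at most 2e^(3y -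
N), so an order linear in y suffices. -/
lemma norm_exp_sub_expTaylor_le {N : ℕ} {y ε t : ℝ} (hε : 0 < ε) (hε1 : ε ≤ 1) (ht : |t| ≤ y)
    (hN : 3 * y + Real.log (2 / ε) ≤ N) : ‖cexp (t * I) - expTaylor N t‖ ≤ ε := by
  have hy : 0 ≤ y := (abs_nonneg t).trans ht
  have hlog : 0 ≤ Real.log (2 / ε) :=
    Real.log_nonneg (by rw [le_div_iff₀ hε]; linarith)
  have hnorm : ‖(t : ℂ) * I‖ = |t| := by simp
  have h1 : ‖(t : ℂ) * I‖ / (N.succ : ℕ) ≤ 1 / 2 := by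
    rw [hnorm, div_le_iff₀ (by positivity)]
    push_cast
    linarith
  rw [expTaylor, Fin.sum_univ_eq_sum_range fun a => ((t : ℂ) * I) ^ a / (a.factorial : ℂ)]
  refine (Complex.exp_bound' h1).trans ?_
  rw [hnorm]
  have h2 := Real.pow_div_factorial_le_exp (x := 3 * y) (by positivity) N
  have h3 : Real.exp N ≤ 3 ^ N := by
    rw [← Real.exp_one_pow]
    gcongr
    exact Real.exp_one_lt_three.le
  have h4 : |t| ^ N / N.factorial * Real.exp N ≤ Real.exp (3 * y) := by
    refine le_trans ?_ h2
    rw [mul_pow, div_mul_eq_mul_div]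
    have : |t| ^ N ≤ y ^ N := pow_le_pow_left₀ (abs_nonneg _) ht N
    gcongr ?_ / _
    rw [mul_comm]
    gcongr
  have h5 : Real.exp (3 * y) * (2 / ε) ≤ Real.exp N := by
    rw [← Real.exp_log (x := 2 / ε) (by positivity), ← Real.exp_add]
    exact Real.exp_le_exp.2 hN
  have h6 : |t| ^ N / N.factorial * Real.exp N * (2 / ε) ≤ Real.exp N :=
    (mul_le_mul_of_nonneg_right h4 (by positivity)).trans h5
  have h7 : |t| ^ N / N.factorial * (2 / ε) ≤ 1 := by
    refine le_of_mul_le_mul_right ?_ (Real.exp_pos N)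
    linarith
  rw [← mul_div_assoc, div_le_one hε] at h7
  exact h7

lemma norm_prod_sub_prod_le {ι : Type*} (S : Finset ι) {A D : ι → ℂ} {ε : ℝ}
    (hε : 0 ≤ ε) (hε1 : ε ≤ 1) (hA : ∀ i, ‖A i‖ = 1) (h : ∀ i, ‖A i - D i‖ ≤ ε) :
    ‖∏ i ∈ S, D i‖ ≤ 2 ^ S.card ∧ ‖∏ i ∈ S, A i - ∏ i ∈ S, D i‖ ≤ 2 ^ S.card * ε := by
  classical
  induction S using Finset.induction_on with
  | empty => simpa using hε
  | insert i S hi ih =>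
    have hD : ‖D i‖ ≤ 2 := by
      have := norm_sub_norm_le (D i) (A i)
      rw [norm_sub_rev, hA] at this
      linarith [h i]
    rw [Finset.prod_insert hi, Finset.prod_insert hi, Finset.card_insert_of_notMem hi, pow_succ]
    refine ⟨?_, ?_⟩
    · rw [norm_mul, mul_comm]
      exact mul_le_mul ih.1 hD (norm_nonneg _) (by positivity)
    · have e : A i * ∏ j ∈ S, A j - D i * ∏ j ∈ S, D j
          = A i * (∏ j ∈ S, A j - ∏ j ∈ S, D j) + (A i - D i) * ∏ j ∈ S, D j := by ring
      rw [e]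
      refine (norm_add_le _ _).trans ?_
      rw [norm_mul, norm_mul, hA, one_mul]
      have := mul_le_mul (h i) ih.1 (norm_nonneg _) hε
      linarith [ih.2]

/-- The set of frequencies of size at most `Ω`. -/
def lowFreq (ν : ℝ) (d : ℕ) (Ω : ℝ) : Set (ℝ × (Fin d → ℝ)) := {s | ∑ i, |freq ν s i| ≤ Ω}

lemma measurableSet_lowFreq (Ω : ℝ) : MeasurableSet (lowFreq ν d Ω) := by
  refine measurableSet_le (Finset.measurable_sum _ fun i _ => ?_) measurable_const
  exact (measurable_freq i).abs

lemma abs_freq_le {Ω : ℝ} {s : ℝ × (Fin d → ℝ)} (hs : s ∈ lowFreq ν d Ω) (i : Fin d) :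
    |freq ν s i| ≤ Ω :=
  (Finset.single_le_sum (f := fun i => |freq ν s i|) (fun _ _ => abs_nonneg _)
    (Finset.mem_univ i)).trans hs

/-- Plane wave with low frequencies, expanded to order `N` in each coordinate. -/
def taylorWave (ν : ℝ) (N : ℕ) (Ω : ℝ) (ξ : Fin d → ℝ) : ℝ × (Fin d → ℝ) → ℂ :=
  (lowFreq ν d Ω).indicator fun s => ∏ i, expTaylor N (freq ν s i * ξ i)

/-- Monomial in the low frequencies. -/
def freqMonomial (ν : ℝ) (N : ℕ) (Ω : ℝ) (α : Fin d → Fin N) : ℝ × (Fin d → ℝ) → ℂ :=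
  (lowFreq ν d Ω).indicator fun s =>
    ∏ i, ((freq ν s i : ℂ) * I) ^ (α i : ℕ) / (α i : ℕ).factorial

/-- Expanding the product separates the point from the frequency: all truncated waves lie in the
span of N^d fixed functions, which bounds the rank of their Gram matrix. -/
lemma taylorWave_eq (N : ℕ) (Ω : ℝ) (ξ : Fin d → ℝ) (s : ℝ × (Fin d → ℝ)) :
    taylorWave ν N Ω ξ s
      = ∑ α : Fin d → Fin N, ((∏ i, ξ i ^ (α i : ℕ) : ℝ) : ℂ) * freqMonomial ν N Ω α s := by
  by_cases hs : s ∈ lowFreq ν d Ω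
  · simp only [taylorWave, freqMonomial, Set.indicator_of_mem hs, expTaylor]
    rw [Finset.prod_univ_sum, Fintype.piFinset_univ]
    refine Finset.sum_congr rfl fun α _ => ?_
    rw [Complex.ofReal_prod, ← Finset.prod_mul_distrib]
    refine Finset.prod_congr rfl fun i _ => ?_
    push_cast
    ring
  · simp [taylorWave, freqMonomial, Set.indicator_of_notMem hs]

lemma measurable_taylorWave (N : ℕ) (Ω : ℝ) (ξ : Fin d → ℝ) :
    Measurable (taylorWave ν N Ω ξ) := by
  refine Measurable.indicator (Finset.measurable_prod _ fun i _ => ?_) (measurableSet_lowFreq Ω)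
  have := measurable_freq (ν := ν) i
  unfold expTaylor
  fun_prop

lemma bddFeat_freqMonomial (N : ℕ) (Ω : ℝ) :
    BddFeat (freqMonomial (d := d) ν N Ω) := by
  refine fun α => ⟨?_, ∏ i, |Ω| ^ (α i : ℕ), fun s => ?_⟩
  · refine Measurable.indicator (Finset.measurable_prod _ fun i _ => ?_) (measurableSet_lowFreq Ω)
    have := measurable_freq (ν := ν) i
    fun_prop
  · by_cases hs : s ∈ lowFreq ν d Ω
    · rw [freqMonomial, Set.indicator_of_mem hs, norm_prod]
      refine Finset.prod_le_prod (fun i _ => norm_nonneg _) fun i _ => ?_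
      rw [norm_div, norm_pow, norm_mul, Complex.norm_I, mul_one, Complex.norm_real,
        Complex.norm_natCast, Real.norm_eq_abs]
      have h1 : |freq ν s i| ^ (α i : ℕ) ≤ |Ω| ^ (α i : ℕ) :=
        pow_le_pow_left₀ (abs_nonneg _) ((abs_freq_le hs i).trans (le_abs_self _)) _
      refine (div_le_self (by positivity) ?_).trans h1
      exact_mod_cast Nat.one_le_iff_ne_zero.2 (Nat.factorial_ne_zero _)
    · rw [freqMonomial, Set.indicator_of_notMem hs, norm_zero]
      positivity

lemma taylorWave_approx {N : ℕ} {Ω ρ ε : ℝ} (hε : 0 < ε) (hε1 : ε ≤ 1)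
    (hN : 3 * (Ω * ρ) + Real.log (2 / ε) ≤ N) {ξ : Fin d → ℝ} (hξ : ∀ i, |ξ i| ≤ ρ)
    {s : ℝ × (Fin d → ℝ)} (hs : s ∈ lowFreq ν d Ω) :
    ‖taylorWave ν N Ω ξ s‖ ≤ 2 ^ d ∧ ‖wave ν ξ s - taylorWave ν N Ω ξ s‖ ≤ 2 ^ d * ε := by
  have h := norm_prod_sub_prod_le (Finset.univ : Finset (Fin d))
    (A := fun i => cexp (freq ν s i * ξ i * I)) (D := fun i => expTaylor N (freq ν s i * ξ i))
    hε.le hε1 (fun i => by rw [← Complex.ofReal_mul, Complex.norm_exp_ofReal_mul_I]) (fun i => by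
      have := norm_exp_sub_expTaylor_le (t := freq ν s i * ξ i) hε hε1 (by
        rw [abs_mul]
        exact mul_le_mul (abs_freq_le hs i) (hξ i) (abs_nonneg _)
          ((abs_nonneg _).trans (abs_freq_le hs i))) hN
      rwa [Complex.ofReal_mul] at this)
  rw [Finset.card_univ, Fintype.card_fin] at h
  rwa [taylorWave, Set.indicator_of_mem hs]

/-- Below the cutoff the Taylor error applies. Above it the approximation is zero and the wave has
modulus one, leaving the tail probability. -/
lemma integral_wave_sub_taylorWave_le (hν : 0 < ν) {N : ℕ} {Ω ρ ε : ℝ} (hε : 0 < ε)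
    (hε1 : ε ≤ 1) (hN : 3 * (Ω * ρ) + Real.log (2 / ε) ≤ N) {ξ : Fin d → ℝ} (hξ : ∀ i, |ξ i| ≤ ρ) :
    ∫ s, ‖wave ν ξ s - taylorWave ν N Ω ξ s‖ ^ 2 ∂specMeasure ν d
      ≤ (2 ^ d * ε) ^ 2 + (specMeasure ν d).real {s | Ω < ∑ i, |freq ν s i|} := by
  have := isProbabilityMeasure_specMeasure (d := d) hν
  have hset : {s | Ω < ∑ i, |freq ν s i|} = (lowFreq ν d Ω)ᶜ := by
    ext s; simp [lowFreq]
  have hm : MeasurableSet {s | Ω < ∑ i, |freq ν s i|} := hset ▸ (measurableSet_lowFreq Ω).compl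
  have h1 : ∫ s, ‖wave ν ξ s - taylorWave ν N Ω ξ s‖ ^ 2 ∂specMeasure ν d
      ≤ ∫ s, ((2 ^ d * ε) ^ 2 + {s | Ω < ∑ i, |freq ν s i|}.indicator (fun _ => (1 : ℝ)) s)
        ∂specMeasure ν d := by
    refine integral_mono_of_nonneg (ae_of_all _ fun s => by positivity)
      ((integrable_const _).add ((integrable_const _).indicator hm)) (ae_of_all _ fun s => ?_)
    simp only
    by_cases hs : s ∈ lowFreq ν d Ω
    · have h0 : 0 ≤ {s | Ω < ∑ i, |freq ν s i|}.indicator (fun _ => (1 : ℝ)) s :=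
        Set.indicator_nonneg (fun _ _ => zero_le_one) s
      have := pow_le_pow_left₀ (norm_nonneg _) (taylorWave_approx hε hε1 hN hξ hs).2 2
      linarith
    · have hs' : s ∈ {s | Ω < ∑ i, |freq ν s i|} := hset ▸ hs
      rw [Set.indicator_of_mem hs', taylorWave, Set.indicator_of_notMem hs, sub_zero, norm_wave]
      nlinarith [sq_nonneg (2 ^ d * ε)]
  refine h1.trans_eq ?_
  rw [integral_add (integrable_const _) ((integrable_const _).indicator hm),
    integral_indicator_const _ hm]
  simp

/-- Information gain of a Matérn kernel in terms of a cutoff `Ω` of the frequencies and an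
order `N` of the expansion. -/
lemma infoGain_matern_le (hν : 0 < ν) {var : ℝ} (hvar : 0 < var) (hvar1 : var ≤ 1)
    (grp : Fin d → Fin m) (θ : Fin m → ℝ) {σ : ℝ} (hσ : 1 ≤ σ) {n N : ℕ} (hn : 1 ≤ n)
    {Ω ρ : ℝ} (hN : 3 * (Ω * ρ) + Real.log (2 * n) ≤ N)
    (x : Fin n → EuclideanSpace ℝ (Fin d)) (hx : ∀ j i, |x j i / θ (grp i)| ≤ ρ) :
    infoGain (matern ν var grp θ) σ x ≤ (N : ℝ) ^ d * Real.log (1 + n * (2 * 4 ^ d)) + 4 ^ d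
      + n * (specMeasure ν d).real {s | Ω < ∑ i, |freq ν s i|} := by
  have := isProbabilityMeasure_specMeasure (d := d) hν
  have hn' : (1 : ℝ) ≤ n := by exact_mod_cast hn
  -- Accuracy 1/n per wave keeps the summed low-frequency error below 4^d and costs only log(2n) in
  -- the order N.
  have hε : (0 : ℝ) < 1 / n := by positivity
  have hε1 : (1 : ℝ) / n ≤ 1 := by rw [div_le_one (by positivity)]; exact hn'
  have hN' : 3 * (Ω * ρ) + Real.log (2 / (1 / n)) ≤ N := by
    rwa [div_div_eq_mul_div, div_one]
  have hbd : ∀ (ξ : Fin d → ℝ), (∀ i, |ξ i| ≤ ρ) → ∀ s, ‖taylorWave ν N Ω ξ s‖ ≤ 2 ^ d := by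
    intro ξ hξ s
    by_cases hs : s ∈ lowFreq ν d Ω
    · exact (taylorWave_approx hε hε1 hN' hξ hs).1
    · rw [taylorWave, Set.indicator_of_notMem hs, norm_zero]; positivity
  have hκ : (σ ^ 2)⁻¹ * var ≤ 1 :=
    mul_le_one₀ (inv_le_one_of_one_le₀ (one_le_pow₀ hσ)) hvar.le hvar1
  have h := log_det_featGram_le (μ := specMeasure ν d)
    (φ := fun j : Fin n => wave ν fun i => x j i / θ (grp i))
    (p := fun j : Fin n => taylorWave ν N Ω fun i => x j i / θ (grp i))
    (g := freqMonomial ν N Ω)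
    (fun j => ⟨measurable_wave _, 1, fun s => (norm_wave _ s).le⟩)
    (fun j => ⟨measurable_taylorWave _ _ _, 2 ^ d, hbd _ (hx j)⟩)
    (bddFeat_freqMonomial N Ω)
    (Matrix.of fun j α => ∏ i, (x j i / θ (grp i)) ^ (α i : ℕ))
    (fun j s => taylorWave_eq N Ω _ s) (κ := (σ ^ 2)⁻¹ * var) (by positivity) hκ
    (fun j => hbd _ (hx j))
    (fun j => integral_wave_sub_taylorWave_le hν hε hε1 hN' (hx j))
  rw [infoGain, gram_matern_eq hν, smul_smul]
  simp only [Fintype.card_pi, Fintype.card_fin, Finset.prod_const, Finset.card_univ] at h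
  push_cast at h
  have e4 : ((2 : ℝ) ^ d) ^ 2 = 4 ^ d := by rw [← pow_mul, mul_comm, pow_mul]; norm_num
  rw [mul_pow, e4] at h
  have hlog : 0 ≤ Real.log (1 + n * (2 * 4 ^ d)) := Real.log_nonneg (by
    have : (0 : ℝ) ≤ n * (2 * 4 ^ d) := by positivity
    linarith)
  have h1 : 0 ≤ (N : ℝ) ^ d * Real.log (1 + n * (2 * 4 ^ d)) := by positivity
  have h2 : (n : ℝ) * (4 ^ d * (1 / n) ^ 2) ≤ 4 ^ d := by
    have : (n : ℝ) * (4 ^ d * (1 / n) ^ 2) = 4 ^ d * (1 / n) := by field_simp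
    rw [this]
    exact mul_le_of_le_one_right (by positivity) hε1
  linarith

end LowRank

/-! ### Growth of the information gain and of the rate -/

section Growth

variable {d m : ℕ}

lemma Problem.exists_abs_div_le (P : Problem d m) :
    ∃ ρ : ℝ, 0 ≤ ρ ∧ ∀ x ∈ P.X, ∀ θ ∈ P.Θ, ∀ i, |x i / θ (P.grp i)| ≤ ρ := by
  obtain ⟨lo, hi, hlo, -, hb⟩ := P.exists_bounds
  obtain ⟨r, hr⟩ := P.X_compact.isBounded.exists_norm_le
  obtain ⟨x₀, hx₀⟩ := P.X_nonempty
  have hr0 : 0 ≤ r := (norm_nonneg x₀).trans (hr x₀ hx₀)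
  refine ⟨r / lo, by positivity, fun x hx θ hθ i => ?_⟩
  have hθi := P.Θ_pos θ hθ (P.grp i)
  rw [abs_div, abs_of_pos hθi]
  exact div_le_div₀ hr0 ((PiLp.norm_apply_le x i).trans (hr x hx)) hlo (hb θ hθ _).1

/-- For smoothness above `d / 2` the information gain grows slower than `√n`. -/
lemma Problem.exists_supGain_le (P : Problem d m) (hd : (d : ℝ) < 2 * P.ν) :
    ∃ C a : ℝ, 0 ≤ C ∧ 0 < a ∧ a < 1 / 2 ∧ ∀ (n : ℕ) (σ : ℝ), 1 ≤ n → 1 ≤ σ →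
      P.supGain σ n ≤ C * (n : ℝ) ^ a := by
  have hν := P.ν_pos
  have hd0 : (0 : ℝ) ≤ d := Nat.cast_nonneg d
  obtain ⟨ρ, hρ, hx⟩ := P.exists_abs_div_le
  -- The midpoint of d/2 and ν: below ν, so that the tail bound holds, and above d/2, so that s·d <
  -- 1/2 below.
  set κ := (P.ν + d / 2) / 2 with hκ
  have hκ0 : 0 < κ := by positivity
  have hκ1 : κ < P.ν := by rw [hκ]; linarith
  obtain ⟨C, hC, htail⟩ := exists_specMeasure_tail_le (d := d) hν hκ0 hκ1
  -- The cutoff Ω = n^s balances the rank N^d, of order n^(sd) up to constants, with the tail term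
  -- n·Ω^(-2κ) = n^(1 - 2κs) = n^(sd).
  set s := 1 / (2 * κ + d) with hs
  have hs0 : 0 < s := by positivity
  have hsd : s * (2 * κ) = 1 - s * d := by rw [hs]; field_simp; ring
  have hsd2 : s * d < 1 / 2 := by
    rw [hs, div_mul_eq_mul_div, one_mul, div_lt_div_iff₀ (by positivity) (by norm_num)]
    rw [hκ]; linarith
  -- Half of the remaining gap to 1/2 absorbs the logarithm of the determinant bound.
  set ε := (1 / 2 - s * d) / 2 with hε
  have hε0 : 0 < ε := by rw [hε]; linarith
  set A := 3 * ρ + 2 ^ s / s + 1 with hA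
  have hA0 : 0 ≤ A := by positivity
  set D : ℝ := 1 + 2 * 4 ^ d with hD
  have hsd0 : 0 ≤ s * d := by positivity
  refine ⟨A ^ d * (D ^ ε / ε) + 4 ^ d + C, s * d + ε, by positivity, by linarith,
    by rw [hε]; linarith, fun n σ hn hσ => ?_⟩
  have hn' : (1 : ℝ) ≤ n := by exact_mod_cast hn
  have hn0 : (0 : ℝ) < n := by linarith
  have hpow : 1 ≤ (n : ℝ) ^ (s * d + ε) := Real.one_le_rpow hn' (by linarith)
  have hns : 1 ≤ (n : ℝ) ^ s := Real.one_le_rpow hn' hs0.le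
  refine Real.iSup_le (fun θ => Real.iSup_le (fun x => ?_) (by positivity)) (by positivity)
  set N := ⌈3 * ((n : ℝ) ^ s * ρ) + Real.log (2 * n)⌉₊ with hN
  have hlog0 : 0 ≤ Real.log (2 * n) := Real.log_nonneg (by linarith)
  have hNA : (N : ℝ) ≤ A * (n : ℝ) ^ s := by
    have h1 : (N : ℝ) ≤ 3 * ((n : ℝ) ^ s * ρ) + Real.log (2 * n) + 1 :=
      (Nat.ceil_lt_add_one (by positivity)).le
    have h2 := Real.log_le_rpow_div (x := 2 * n) (by positivity) hs0
    rw [Real.mul_rpow (by norm_num) hn0.le] at h2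
    calc (N : ℝ) ≤ 3 * ((n : ℝ) ^ s * ρ) + 2 ^ s * (n : ℝ) ^ s / s + (n : ℝ) ^ s := by linarith
      _ = _ := by rw [hA]; ring
  have h := infoGain_matern_le hν P.var_pos P.var_le_one P.grp θ hσ hn
    (N := N) (Ω := (n : ℝ) ^ s) (Nat.le_ceil _)
    (fun j => (x j : EuclideanSpace ℝ (Fin d))) (fun j i => hx _ (x j).2 _ θ.2 i)
  refine h.trans ?_
  rw [add_mul, add_mul]
  refine add_le_add (add_le_add ?_ ?_) ?_
  · have h1 : (N : ℝ) ^ d ≤ A ^ d * (n : ℝ) ^ (s * d) := by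
      rw [Real.rpow_mul hn0.le, Real.rpow_natCast, ← mul_pow]
      exact pow_le_pow_left₀ (Nat.cast_nonneg _) hNA d
    have h2 : Real.log (1 + n * (2 * 4 ^ d)) ≤ D ^ ε / ε * (n : ℝ) ^ ε := by
      have h3 : (1 : ℝ) + n * (2 * 4 ^ d) ≤ D * n := by rw [hD, add_mul]; linarith
      calc _ ≤ Real.log (D * n) := Real.log_le_log (by positivity) h3
        _ ≤ (D * n) ^ ε / ε := Real.log_le_rpow_div (by positivity) hε0
        _ = _ := by rw [Real.mul_rpow (by positivity) hn0.le]; ring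
    have h4 : 0 ≤ Real.log (1 + n * (2 * 4 ^ d)) := Real.log_nonneg (by
      have : (0 : ℝ) ≤ n * (2 * 4 ^ d) := by positivity
      linarith)
    calc _ ≤ (A ^ d * (n : ℝ) ^ (s * d)) * (D ^ ε / ε * (n : ℝ) ^ ε) :=
          mul_le_mul h1 h2 h4 (by positivity)
      _ = _ := by rw [Real.rpow_add hn0]; ring
  · exact le_mul_of_one_le_right (by positivity) hpow
  · calc (n : ℝ) * _ ≤ n * (C * ((n : ℝ) ^ s) ^ (-(2 * κ))) := by
          gcongr
          exact htail _ (by positivity)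
      _ = C * ((n : ℝ) ^ (1 : ℝ) * (n : ℝ) ^ (s * -(2 * κ))) := by
          rw [← Real.rpow_mul hn0.le, Real.rpow_one]; ring
      _ = C * (n : ℝ) ^ (s * d) := by
          rw [← Real.rpow_add hn0, mul_neg, hsd]; ring_nf
      _ ≤ _ := by gcongr; linarith

/-- The logarithm of the covering number grows slower than any power. -/
lemma Problem.exists_log_covNum_le (P : Problem d m) {δ a : ℝ} (hδ : 0 < δ) (hδ1 : δ < 1)
    (ha : 0 < a) : ∃ C : ℝ, 0 ≤ C ∧ ∀ T : ℕ, 1 ≤ T →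
      Real.log (6 * P.covNum (epsT T) / δ) ≤ C * (T : ℝ) ^ a := by
  obtain ⟨K, hK, hcov⟩ := P.exists_covNum_le
  have hK0 : 0 < K := by linarith
  have hlog0 : 0 ≤ Real.log (6 * K ^ m / δ) := Real.log_nonneg (by
    rw [le_div_iff₀ hδ]
    linarith [one_le_pow₀ hK (n := m)])
  refine ⟨Real.log (6 * K ^ m / δ) + (4 * m : ℕ) / a, by positivity, fun T hT => ?_⟩
  have hT' : (1 : ℝ) ≤ T := by exact_mod_cast hT
  have hT0 : (0 : ℝ) < T := by linarith
  have hcov' := hcov _ (epsT_pos hT) (epsT_le_one hT)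
  have hN : (0 : ℝ) < P.covNum (epsT T) := by
    exact_mod_cast P.one_le_covNum (epsT_pos hT) (epsT_le_one hT)
  have h1 : 6 * (P.covNum (epsT T) : ℝ) / δ ≤ 6 * K ^ m / δ * (T : ℝ) ^ (4 * m) := by
    rw [epsT, div_inv_eq_mul, mul_pow, ← pow_mul] at hcov'
    calc _ ≤ 6 * (K ^ m * (T : ℝ) ^ (4 * m)) / δ := by gcongr; exact hcov'
      _ = _ := by ring
  calc _ ≤ Real.log (6 * K ^ m / δ * (T : ℝ) ^ (4 * m)) := Real.log_le_log (by positivity) h1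
    _ = Real.log (6 * K ^ m / δ) + (4 * m : ℕ) * Real.log T := by
      rw [Real.log_mul (by positivity) (by positivity), Real.log_pow]
    _ ≤ Real.log (6 * K ^ m / δ) * (T : ℝ) ^ a + (4 * m : ℕ) * ((T : ℝ) ^ a / a) := by
      gcongr
      · exact le_mul_of_one_le_right hlog0 (Real.one_le_rpow hT' ha.le)
      · exact Real.log_le_rpow_div hT0.le ha
    _ = _ := by ring

lemma regretRate_nonneg (P : Problem d m) (σ : ℝ) {B : ℝ} (hB : 0 ≤ B) (δ : ℝ) (T : ℕ)
    (θ : Fin m → ℝ) : 0 ≤ regretRate P σ B δ T θ := by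
  unfold regretRate
  positivity

/-- For smoothness above `d / 2` the rate is sublinear. -/
lemma tendsto_regretRate_div (P : Problem d m) (hd : (d : ℝ) < 2 * P.ν) {B δ : ℝ} (hB : 0 < B)
    (hδ : 0 < δ) (hδ1 : δ < 1) {θ : Fin m → ℝ} (hθ : θ ∈ P.Θ) {σ : ℕ → ℝ} (hσ : ∀ T, 1 ≤ σ T) :
    Tendsto (fun T : ℕ => regretRate P (σ T) B δ T θ / T) atTop (𝓝 0) := by
  obtain ⟨C, a, hC, ha, ha2, hgain⟩ := P.exists_supGain_le hd
  obtain ⟨C', hC', hcov⟩ := P.exists_log_covNum_le hδ hδ1 ha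
  set E := (B + √(C + C')) * (1 + √C) with hE
  -- The first factor of the rate is of order T^(a/2) and the second of order T^(3/4), as (1 + a)/2
  -- ≤ 3/4. After division by T the exponent is a/2 - 1/4, negative since a < 1/2.
  have hlim : Tendsto (fun T : ℕ => E * (T : ℝ) ^ (-(1 / 4 - a / 2))) atTop (𝓝 0) := by
    have := ((tendsto_rpow_neg_atTop (y := 1 / 4 - a / 2) (by linarith)).comp
      tendsto_natCast_atTop_atTop).const_mul E
    simpa using this
  refine squeeze_zero' (Eventually.of_forall fun T =>
    div_nonneg (regretRate_nonneg P _ hB.le δ T θ) (Nat.cast_nonneg T)) ?_ hlim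
  filter_upwards [eventually_ge_atTop 1] with T hT
  have hT' : (1 : ℝ) ≤ T := by exact_mod_cast hT
  have hT0 : (0 : ℝ) < T := by linarith
  have hsqrt : ∀ c b : ℝ, 0 ≤ c → √(c * (T : ℝ) ^ b) = √c * (T : ℝ) ^ (b / 2) := fun c b hc => by
    rw [Real.sqrt_mul hc, Real.sqrt_eq_rpow ((T : ℝ) ^ b), ← Real.rpow_mul hT0.le]
    ring_nf
  have h1 : B + √(P.supGain (σ T) (T - 1) + Real.log (6 * P.covNum (epsT T) / δ))
      ≤ (B + √(C + C')) * (T : ℝ) ^ (a / 2) := by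
    have h2 : P.supGain (σ T) (T - 1) + Real.log (6 * P.covNum (epsT T) / δ)
        ≤ (C + C') * (T : ℝ) ^ a := by
      have := P.supGain_mono (hσ T) (Nat.sub_le T 1)
      linarith [hgain T (σ T) hT (hσ T), hcov T hT]
    have h3 := Real.sqrt_le_sqrt h2
    rw [hsqrt _ _ (by positivity)] at h3
    rw [add_mul]
    exact add_le_add (le_mul_of_one_le_right hB.le (Real.one_le_rpow hT' (by linarith))) h3
  have h2 : (T : ℝ) ^ (3 / 4 : ℝ) + √(T * P.gain (σ T) T θ)
      ≤ (1 + √C) * (T : ℝ) ^ (3 / 4 : ℝ) := by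
    have h3 : T * P.gain (σ T) T θ ≤ C * (T : ℝ) ^ (1 + a) := by
      rw [Real.rpow_add hT0, Real.rpow_one]
      calc _ ≤ T * (C * (T : ℝ) ^ a) := by
            gcongr
            exact (P.gain_le_supGain (hσ T) T hθ).trans (hgain T (σ T) hT (hσ T))
        _ = _ := by ring
    have h4 := Real.sqrt_le_sqrt h3
    rw [hsqrt _ _ hC] at h4
    have h5 : (T : ℝ) ^ ((1 + a) / 2) ≤ (T : ℝ) ^ (3 / 4 : ℝ) :=
      Real.rpow_le_rpow_of_exponent_le hT' (by linarith)
    rw [add_mul, one_mul]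
    exact add_le_add le_rfl (h4.trans (mul_le_mul_of_nonneg_left h5 (Real.sqrt_nonneg _)))
  rw [div_le_iff₀ hT0]
  calc regretRate P (σ T) B δ T θ
      ≤ ((B + √(C + C')) * (T : ℝ) ^ (a / 2)) * ((1 + √C) * (T : ℝ) ^ (3 / 4 : ℝ)) :=
        mul_le_mul h1 h2 (by positivity) (by positivity)
    _ = E * ((T : ℝ) ^ (a / 2) * (T : ℝ) ^ (3 / 4 : ℝ)) := by rw [hE]; ring
    _ = E * ((T : ℝ) ^ (-(1 / 4 - a / 2)) * (T : ℝ) ^ (1 : ℝ)) := by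
        rw [← Real.rpow_add hT0, ← Real.rpow_add hT0]; ring_nf
    _ = _ := by rw [Real.rpow_one]; ring

end Growth

end OSCBO

end

/-! ### The regret theorem -/

theorem mainTheorem1 {d m : ℕ} (P : OSCBO.Problem d m) (R σmax : ℝ) (hR : 0 ≤ R) :
    ∃ (C : ℝ) (q : ℕ), 0 < C ∧
      (∀ (c : OSCBO.Config), c.R = R → 1 ≤ c.σ → c.σ ≤ σmax → 0 < c.B →
        0 < c.δ → c.δ < 1 → 1 ≤ c.T →
        ∀ (a : OSCBO.Tuning) (θ : Fin m → ℝ), θ ∈ P.Θ →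
        ∀ (f : EuclideanSpace ℝ (Fin d) → ℝ),
        (∀ θ' ∈ P.Θ, OSCBO.InRKHSBall P.X (P.ker θ') c.B f) →
        ∀ (xstar : EuclideanSpace ℝ (Fin d)), xstar ∈ P.X → IsMaxOn f P.X xstar →
        ∀ (Ω : Type*) [MeasurableSpace Ω] (μ : Measure Ω) [IsProbabilityMeasure μ]
          (r : OSCBO.Run μ P c a f),
          ENNReal.ofReal (1 - c.δ) ≤
            μ {ω | r.regret xstar ω ≤
              C * (1 + Real.log c.T) ^ q * OSCBO.regretRate P c.σ c.B c.δ c.T θ}) ∧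
      ((d : ℝ) < 2 * P.ν →
        ∀ (B δ : ℝ), 0 < B → 0 < δ → δ < 1 → ∀ θ ∈ P.Θ,
        ∀ (σ : ℕ → ℝ), (∀ T, 1 ≤ σ T ∧ σ T ≤ σmax) →
          Tendsto (fun T : ℕ =>
            C * (1 + Real.log T) ^ q * OSCBO.regretRate P (σ T) B δ T θ / T) atTop (𝓝 0)) := by
  obtain ⟨b, hb, hcmp⟩ := P.exists_kernelLE
  -- No logarithmic factor is needed, hence q = 0. The absolute value keeps the constant positive
  -- for every real σmax.
  refine ⟨4 * (1 + 2 * R) * (√b * |σmax|) + 4 * (R + 2), 0, by positivity, ?_, ?_⟩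
  · intro c hcR hσ hσm hB hδ hδ1 hT a θ hθ f hf xstar hxs _ Ω _ μ _ r
    have hR' : 0 ≤ c.R := hcR ▸ hR
    have hT0 : (0 : ℝ) < c.T := by exact_mod_cast hT
    obtain ⟨s, hs, hcard⟩ := P.exists_min_net (OSCBO.epsT_pos hT) (OSCBO.epsT_le_one hT)
    have h1 : 1 ≤ s.card := hcard ▸ P.one_le_covNum (OSCBO.epsT_pos hT) (OSCBO.epsT_le_one hT)
    -- Adding 1/T makes the sub-Gaussian constant strictly positive when `c.R` = 0; the extra width
    -- is part of `slack`.
    refine (r.measure_goodNoise_ge hR' (R := c.R + (c.T : ℝ)⁻¹) (by positivity)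
      (le_add_of_nonneg_right (by positivity)) (by linarith) hδ hδ1 hT
      (fun θ hθ => hs.1 hθ) h1).trans (measure_mono fun ω hω => ?_)
    refine (r.regret_le hR' hσ hB hδ hδ1 hT hf hxs hb hcmp hθ hs hcard hω).trans ?_
    rw [pow_zero, mul_one, hcR]
    have := OSCBO.regretRate_nonneg P c.σ hB.le c.δ c.T θ
    gcongr
    exact hσm.trans (le_abs_self _)
  · intro hd B δ hB hδ hδ1 θ hθ σ hσ
    have h := (OSCBO.tendsto_regretRate_div P hd hB hδ hδ1 hθ fun T => (hσ T).1).const_mul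
      (4 * (1 + 2 * R) * (√b * |σmax|) + 4 * (R + 2))
    rw [mul_zero] at h
    refine h.congr fun T => ?_
    rw [pow_zero]; ring
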